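/- For $d\ge 2$ and $p\in(0,1)$ let $\tau^p_d$ be the number with $\Pr[\langle U,V\rangle\ge\tau^p_d]=p$, where $U,V$ are independent and uniform on the sphere $\mathbb S^{d-1}\subset\mathbb R^d$, and let $F_d$ be the distribution function of $\langle U,V\rangle$. Let $G(n,p)$ be the Erdős–Rényi random graph on $\{1,\dots,n\}$, with adjacency matrix $(H_{ij})$. There are a randomized algorithm and an absolute constant $c>0$ with the following properties. On input $n$, $d$, $p$ and a graph $H$ on $n$ vertices, the algorithm outputs $n$ vectors $V_1,\dots,V_n\in\mathbb R^d$, and its number of steps is at most a fixed polynomial in $n$ and $d$, for every input and every outcome of its internal randomness. (Steps are counted for one fixed program on a machine with exact real arithmetic, for which arithmetic operations, square roots, comparisons, evaluations of $F_d$ and $F_d^{-1}$, and drawing an independent standard normal random number each cost one step.) Let $a,b>0$ be arbitrary constants, and consider $n\ge 1$, $d\ge 2$ and $p$ with $$d\ge a\max(np,\log n),\qquad \frac bn\le p\le\frac12 .$$ Run the algorithm on $H\sim G(n,p)$, with internal randomness independent of $H$. 1. The output vectors $V_1,\dots,V_n$ are independent and uniformly distributed on $\mathbb S^{d-1}$.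 2. With high probability over $H$ and the internal randomness, $\mathbf 1[\langle V_i,V_j\rangle\ge\tau^p_d]=H_{ij}$ holds simultaneously for all pairs $i\ne j$ such that $$\bigl|\langle V_i,V_j\rangle-\tau^p_d\bigr|\ge\frac{c\,\max(\sqrt{np},\sqrt{\log n})\,(\log n)^{3/2}}{d}.$$ That is, for all $a,b,\varepsilon>0$ there is $N$ such that for all $n\ge N$ and all $d,p$ as above this fails with probability at most $\varepsilon$. -/

import Mathlib

open MeasureTheory ProbabilityTheory

noncomputable section

/-! ### The uniform law on the sphere and the law of one coordinate -/

/-- The uniform probability measure on the unit sphere of `ℝ^d` (normalised surface measure),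
regarded as a measure on the ambient space. -/
def unifSphere (d : ℕ) : Measure (EuclideanSpace ℝ (Fin d)) :=
  let σ := (volume : Measure (EuclideanSpace ℝ (Fin d))).toSphere
  ((σ Set.univ)⁻¹ • σ).map Subtype.val

/-- The law of `⟨U, V⟩` for independent uniform `U, V` on the sphere; by rotation invariance it is
also the law of `⟨V, e⟩` for any fixed unit vector `e`. -/
def sphereInnerLaw (d : ℕ) : Measure ℝ :=
  ((unifSphere d).prod (unifSphere d)).map (fun x => inner ℝ x.1 x.2)

/-- `τ` is the threshold of density `p` in dimension `d`: `P[⟨U, V⟩ ≥ τ] = p`. -/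
def IsSphereThreshold (d : ℕ) (p τ : ℝ) : Prop :=
  sphereInnerLaw d (Set.Ici τ) = ENNReal.ofReal p

/-- The distribution function of `sphereInnerLaw d`. -/
def sphereCDF (d : ℕ) (x : ℝ) : ℝ := (sphereInnerLaw d).real (Set.Iic x)

/-- The quantile function (on `[-1, 1]`) inverse to `sphereCDF d`. -/
def sphereQuantile (d : ℕ) (u : ℝ) : ℝ := sInf {x : ℝ | -1 ≤ x ∧ u ≤ sphereCDF d x}

/-! ### A real random-access machine with a step count

A program is a finite syntactic object which does not depend on the input. It works with
integer registers `idx 0, idx 1, …` and with real cells `mem m i j` (the entry `(i, j)` of the array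
number `m`, where `m` is fixed in the program text and `i`, `j` are computed addresses). Real numbers
are exact. Integers only admit addition and truncated subtraction, and there is no rounding of reals
to integers. -/

namespace RealRAM

/-- Integer (address) expressions. -/
inductive IExpr : Type
  | const (k : ℕ)
  | reg (x : ℕ)
  | add (a b : IExpr)
  | sub (a b : IExpr)

/-- Real expressions: integer literals, memory cells, field operations, square root, and the
distribution and quantile functions of a coordinate of a uniform unit vector of `ℝ^d`. -/
inductive RExpr : Type
  | const (k : ℤ)
  | cell (m : ℕ) (i j : IExpr)
  | add (a b : RExpr)
  | sub (a b : RExpr)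
  | mul (a b : RExpr)
  | div (a b : RExpr)
  | sqrt (a : RExpr)
  | cdf (d : IExpr) (a : RExpr)
  | quantile (d : IExpr) (a : RExpr)

/-- Programs. `normal m i j` stores a fresh standard normal random number in a cell, `ifIdx a b s t`
and `ifReal a b s t` execute `s` if `a ≤ b` and `t` otherwise, and `loop x e s` executes `s` for
`x = 0, 1, …, e - 1`, where `e` is evaluated once, on entry. -/
inductive Cmd : Type
  | skip
  | setIdx (x : ℕ) (e : IExpr)
  | store (m : ℕ) (i j : IExpr) (e : RExpr)
  | normal (m : ℕ) (i j : IExpr)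
  | seq (s t : Cmd)
  | ifIdx (a b : IExpr) (s t : Cmd)
  | ifReal (a b : RExpr) (s t : Cmd)
  | loop (x : ℕ) (e : IExpr) (s : Cmd)

/-- A machine state: the registers, the real memory, the number of random numbers drawn so far, and
the number of elementary steps made so far. -/
structure State where
  idx : ℕ → ℕ
  mem : ℕ → ℕ → ℕ → ℝ
  draws : ℕ
  time : ℕ

def IExpr.eval (s : State) : IExpr → ℕ
  | .const k => k
  | .reg x => s.idx x
  | .add a b => a.eval s + b.eval s
  | .sub a b => a.eval s - b.eval s

/-- Each node of an expression costs one step. -/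
def IExpr.cost : IExpr → ℕ
  | .const _ => 1
  | .reg _ => 1
  | .add a b => a.cost + b.cost + 1
  | .sub a b => a.cost + b.cost + 1

def RExpr.eval (s : State) : RExpr → ℝ
  | .const k => (k : ℝ)
  | .cell m i j => s.mem m (i.eval s) (j.eval s)
  | .add a b => a.eval s + b.eval s
  | .sub a b => a.eval s - b.eval s
  | .mul a b => a.eval s * b.eval s
  | .div a b => a.eval s / b.eval s
  | .sqrt a => Real.sqrt (a.eval s)
  | .cdf d a => sphereCDF (d.eval s) (a.eval s)
  | .quantile d a => sphereQuantile (d.eval s) (a.eval s)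

/-- Each node of an expression costs one step. -/
def RExpr.cost : RExpr → ℕ
  | .const _ => 1
  | .cell _ i j => i.cost + j.cost + 1
  | .add a b => a.cost + b.cost + 1
  | .sub a b => a.cost + b.cost + 1
  | .mul a b => a.cost + b.cost + 1
  | .div a b => a.cost + b.cost + 1
  | .sqrt a => a.cost + 1
  | .cdf d a => d.cost + a.cost + 1
  | .quantile d a => d.cost + a.cost + 1

def State.tick (s : State) (k : ℕ) : State := { s with time := s.time + k }

def State.setIdx (s : State) (x v : ℕ) : State :=
  { s with idx := fun y => if y = x then v else s.idx y }

def State.store (s : State) (m i j : ℕ) (v : ℝ) : State :=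
  { s with mem := fun m' i' j' => if m' = m ∧ i' = i ∧ j' = j then v else s.mem m' i' j' }

/-- Execution of a program, where `ω 0, ω 1, …` are the successive random numbers. -/
def exec (ω : ℕ → ℝ) : Cmd → State → State
  | .skip, s => s.tick 1
  | .setIdx x e, s => (s.setIdx x (e.eval s)).tick (e.cost + 1)
  | .store m i j e, s =>
      (s.store m (i.eval s) (j.eval s) (e.eval s)).tick (i.cost + j.cost + e.cost + 1)
  | .normal m i j, s =>
      ({ s.store m (i.eval s) (j.eval s) (ω s.draws) with draws := s.draws + 1 } : State).tick
        (i.cost + j.cost + 1)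
  | .seq s₁ s₂, s => exec ω s₂ (exec ω s₁ s)
  | .ifIdx a b s₁ s₂, s =>
      if a.eval s ≤ b.eval s then exec ω s₁ (s.tick (a.cost + b.cost + 1))
      else exec ω s₂ (s.tick (a.cost + b.cost + 1))
  | .ifReal a b s₁ s₂, s =>
      if a.eval s ≤ b.eval s then exec ω s₁ (s.tick (a.cost + b.cost + 1))
      else exec ω s₂ (s.tick (a.cost + b.cost + 1))
  | .loop x e s₁, s =>
      (List.range (e.eval s)).foldl (fun t k => exec ω s₁ ((t.setIdx x k).tick 1))
        (s.tick (e.cost + 1))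

open Classical in
/-- The initial state on input `n, d, p, H`: registers `0` and `1` hold `n` and `d`, array `0` holds the
adjacency matrix of `H`, the entry `(0, 0)` of array `1` holds `p`; everything else is `0`. -/
def init (n d : ℕ) (p : ℝ) (H : SimpleGraph (Fin n)) : State where
  idx x := if x = 0 then n else if x = 1 then d else 0
  mem m i j :=
    if m = 0 then (if ∃ (hi : i < n) (hj : j < n), H.Adj ⟨i, hi⟩ ⟨j, hj⟩ then 1 else 0)
    else if m = 1 ∧ i = 0 ∧ j = 0 then p
    else 0
  draws := 0
  time := 0

/-- The number of steps of the program `prog` on input `n, d, p, H` and random numbers `ω`. -/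
def runTime (prog : Cmd) (n d : ℕ) (p : ℝ) (H : SimpleGraph (Fin n)) (ω : ℕ → ℝ) : ℕ :=
  (exec ω prog (init n d p H)).time

/-- The `n` vectors of `ℝ^d` that the program outputs: the rows of array `2`. -/
def output (prog : Cmd) (n d : ℕ) (p : ℝ) (H : SimpleGraph (Fin n)) (ω : ℕ → ℝ) :
    Fin n → EuclideanSpace ℝ (Fin d) :=
  fun i => WithLp.toLp 2 fun k => (exec ω prog (init n d p H)).mem 2 i k

/-- The joint law of the input graph `H ∼ G(n, p)` and of the internal randomness, an independent
sequence of i.i.d. standard normal random numbers. -/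
def inputLaw (n : ℕ) (p : unitInterval) : Measure (SimpleGraph (Fin n) × (ℕ → ℝ)) :=
  (SimpleGraph.binomialRandom (Fin n) p).prod (Measure.infinitePi fun _ : ℕ => gaussianReal 0 1)

end RealRAM

end

/-! The vertices are placed one after the other. Vertex i starts at a fresh uniform unit vector u,
and its coordinates along the placed vectors V_0, ..., V_{i-1} are adjusted in turn. In step j the
coordinate x = ⟨u, V_j⟩ is kept if it lies on the side of τ that the bit H_ij asks for. Otherwise
its rank is mapped affinely to the other side, and the component orthogonal to V_j is merely
rescaled. The bit is an independent coin of bias p, and a coordinate of a uniform vector exceeds τ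
with the same probability p; so the new coordinate has the law of the old one
(`coin_prod_map_newCoord`), and a step preserves the uniform law on the sphere
(`coin_prod_map_step`). Refreshing one coin or one round at a time turns this into exact
independence and uniformity of the output (`lintegral_embed`, `embed_map_eq_pi`).

Right after step j the inner product with V_j is on the correct side of τ (`newCoord_side`), so an
error can only be caused by the later steps k of the round. Such a step changes the vector only if
it moves the coordinate, which has probability at most 2p. Let s, of order √(log n / d), bound all
inner products that occur (`sphereInnerLaw_tail`). A move changes ⟨u, V_j⟩ by a drift O(s³) and a
noise O(s²) (`abs_inner_step_sub_le`, `stepNoise_sq_le`). The noise is odd under the reflection of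
V_k in the line of u, which preserves both the law of V_k and the coordinate ⟨u, V_k⟩; hence exp(l D
- l² D² / 2) has conditional mean at most 1 for each noise term D (`lintegral_exp_stepNoise_le`).

Put r² = max(np, log n). There are O(r²) moves, so the noise adds up to O(r s² √(log n)), which is
the width of the window. The drift O(r² s³) is dominated by this when d is a large multiple of r²;
for smaller d the window is wider than 2s and the displacement cannot exceed it as long as the inner
products stay below s. `measure_mismatch_le` carries out both cases, and a union bound over pairs
finishes the estimate.

The remaining work shows that a concrete program computes this recursion (`output_embedProg`) in
polynomial time (`exec_time_le`), and that graph and Gaussian input may be replaced by coins and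
uniform vectors (`inputLaw_map_output`). -/

noncomputable section

/-! ### Polar coordinates for the Gaussian; the uniform law as its direction. -/

section Polar

lemma pi_gaussianReal_eq_withDensity (m : ℕ) :
    (Measure.pi fun _ : Fin m => gaussianReal 0 1) =
      (volume : Measure (Fin m → ℝ)).withDensity
        (fun x => ENNReal.ofReal (∏ i, gaussianPDFReal 0 1 (x i))) := by
  refine Measure.pi_eq fun s hs => ?_
  rw [withDensity_apply _ (MeasurableSet.univ_pi hs), volume_pi, Measure.restrict_pi_pi,
    ← ofReal_integral_eq_lintegral_ofReal, integral_fintype_prod_eq_prod,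
    ENNReal.ofReal_prod_of_nonneg]
  · refine Finset.prod_congr rfl fun i _ => ?_
    rw [gaussianReal_apply_eq_integral _ one_ne_zero]
  · exact fun i _ => integral_nonneg fun x => gaussianPDFReal_nonneg _ _ _
  · exact Integrable.fintype_prod fun i => (integrable_gaussianPDFReal 0 1).restrict
  · exact Filter.Eventually.of_forall fun x =>
      Finset.prod_nonneg fun i _ => gaussianPDFReal_nonneg _ _ _

/-- The radial profile of the standard Gaussian density. -/
def gaussianProfile (m : ℕ) (r : ℝ) : ENNReal :=
  ENNReal.ofReal ((√(2 * Real.pi))⁻¹ ^ m * Real.exp (-r ^ 2 / 2))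

lemma measurable_gaussianProfile (m : ℕ) : Measurable (gaussianProfile m) := by
  unfold gaussianProfile; fun_prop

/-- The product of the one-dimensional densities sees x only through the sum of squares. This radial
form lets polar coordinates split off the direction. -/
lemma stdGaussian_eq_withDensity (m : ℕ) :
    stdGaussian (EuclideanSpace ℝ (Fin m)) =
      volume.withDensity (fun x => gaussianProfile m ‖x‖) := by
  rw [← map_pi_eq_stdGaussian, pi_gaussianReal_eq_withDensity]
  ext s hs
  have hmp := PiLp.volume_preserving_toLp (Fin m)
  rw [Measure.map_apply (by fun_prop) hs, withDensity_apply _ hs,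
    withDensity_apply _ (hs.preimage (by fun_prop)),
    ← hmp.setLIntegral_comp_preimage hs (f := fun x => gaussianProfile m ‖x‖)
      ((measurable_gaussianProfile m).comp measurable_norm)]
  refine setLIntegral_congr_fun (hs.preimage (by fun_prop)) fun x _ => ?_
  simp only [gaussianProfile, gaussianPDFReal, Finset.prod_mul_distrib]
  rw [← Real.exp_sum]
  simp [EuclideanSpace.real_norm_sq_eq, Finset.sum_div, neg_div]

/-- In polar coordinates Lebesgue measure is surface measure times a power weight in r, and a radial
density multiplies the second factor only. The sphere factor is not normalised here, so `τ` need not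
have mass 1. -/
lemma stdGaussian_map_polar_eq_prod (m : ℕ) [NeZero m] :
    ∃ τ : Measure ℝ, SFinite τ ∧ τ (Set.Iic 0) = 0 ∧
      (stdGaussian (EuclideanSpace ℝ (Fin m))).map (fun x => (‖x‖⁻¹ • x, ‖x‖)) =
        ((volume : Measure (EuclideanSpace ℝ (Fin m))).toSphere.map Subtype.val).prod τ := by
  have : Nontrivial (EuclideanSpace ℝ (Fin m)) := by
    have : Nonempty (Fin m) := ⟨0⟩
    infer_instance
  set E := EuclideanSpace ℝ (Fin m)
  set κ := (Measure.volumeIoiPow (Module.finrank ℝ E - 1)).withDensity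
    (fun r => gaussianProfile m r.1) with hκ
  have hgm : Measurable fun r : Set.Ioi (0 : ℝ) => gaussianProfile m r.1 :=
    (measurable_gaussianProfile m).comp measurable_subtype_coe
  have : SFinite κ := by rw [hκ]; infer_instance
  refine ⟨κ.map Subtype.val, inferInstance, ?_, ?_⟩
  · rw [Measure.map_apply measurable_subtype_coe measurableSet_Iic]
    convert measure_empty (μ := κ)
    ext x
    simpa using Set.mem_Ioi.1 x.2
  · rw [Measure.map_prod_map _ _ measurable_subtype_coe measurable_subtype_coe]
    have hpol : Measurable fun x : E => (‖x‖⁻¹ • x, ‖x‖) := by fun_prop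
    refine Measure.ext_of_lintegral _ fun f hf => ?_
    have hgn : Measurable fun x : E => gaussianProfile m ‖x‖ :=
      (measurable_gaussianProfile m).comp measurable_norm
    have hmp := (volume : Measure E).measurePreserving_homeomorphUnitSphereProd
    have h1 := lintegral_withDensity_eq_lintegral_mul (volume : Measure E) hgn (hf.comp hpol)
    have h2 := lintegral_withDensity_eq_lintegral_mul
      ((volume : Measure E).toSphere.prod (Measure.volumeIoiPow (Module.finrank ℝ E - 1)))
      (hgm.comp measurable_snd)
      (hf.comp (measurable_subtype_coe.prodMap measurable_subtype_coe))
    have h3 := (hgm.comp measurable_snd).mul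
        (hf.comp (measurable_subtype_coe.prodMap measurable_subtype_coe) :
          Measurable fun a : Metric.sphere (0 : E) 1 × Set.Ioi (0 : ℝ) => _)
    simp only [Function.comp_def, Pi.mul_apply, Pi.mul_def] at h1 h2 h3
    rw [lintegral_map hf hpol, lintegral_map hf (by fun_prop), stdGaussian_eq_withDensity,
      h1, hκ, prod_withDensity_right hgm, h2,
      ← hmp.lintegral_comp h3]
    -- Polar coordinates are defined off the origin, which is a null set.
    have h0 : (volume : Measure E) = volume.restrict {0}ᶜ := by
      rw [restrict_compl_singleton]
    rw [h0]
    rw [← map_comap_subtype_coe (measurableSet_singleton (0 : E)).compl]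
    rw [(MeasurableEmbedding.subtype_coe (measurableSet_singleton (0 : E)).compl).lintegral_map]
    rw [map_comap_subtype_coe (measurableSet_singleton (0 : E)).compl, ← h0]
    refine lintegral_congr fun x => ?_
    have hx : homeomorphUnitSphereProd (EuclideanSpace ℝ (Fin m)) x =
      (⟨‖x.1‖⁻¹ • x.1, by simp [norm_smul, norm_ne_zero_iff.2 x.2]⟩,
        ⟨‖x.1‖, norm_pos_iff.2 x.2⟩) := by
      ext
      · simp; rfl
      · simp
    simp only [E, hx, Prod.map_apply]

lemma stdGaussian_map_polar (m : ℕ) [NeZero m] :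
    ∃ τ : Measure ℝ, IsProbabilityMeasure τ ∧ τ (Set.Iic 0) = 0 ∧
      (stdGaussian (EuclideanSpace ℝ (Fin m))).map (fun x => (‖x‖⁻¹ • x, ‖x‖)) =
        (unifSphere m).prod τ := by
  have : Nontrivial (EuclideanSpace ℝ (Fin m)) := by
    have : Nonempty (Fin m) := ⟨0⟩
    infer_instance
  obtain ⟨τ, hτ, hτ0, h⟩ := stdGaussian_map_polar_eq_prod m
  set σ := (volume : Measure (EuclideanSpace ℝ (Fin m))).toSphere with hσ
  have hσ0 : σ Set.univ ≠ 0 := Measure.measure_univ_ne_zero.2 (Measure.toSphere_ne_zero _)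
  have hσt : σ Set.univ ≠ ⊤ := measure_ne_top _ _
  have hμ : unifSphere m = (σ Set.univ)⁻¹ • σ.map Subtype.val := by
    simp only [unifSphere, ← hσ, Measure.map_smul]
  have hc : (σ Set.univ) * (σ Set.univ)⁻¹ = 1 := ENNReal.mul_inv_cancel hσ0 hσt
  have hτu : σ Set.univ * τ Set.univ = 1 := by
    have : IsProbabilityMeasure ((stdGaussian (EuclideanSpace ℝ (Fin m))).map
        (fun x => (‖x‖⁻¹ • x, ‖x‖))) := Measure.isProbabilityMeasure_map (by fun_prop)
    have h2 : ((σ.map Subtype.val).prod τ) (Set.univ ×ˢ Set.univ) = 1 := by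
      rw [← h, Set.univ_prod_univ, measure_univ]
    rwa [Measure.prod_prod, Measure.map_apply measurable_subtype_coe MeasurableSet.univ] at h2
  refine ⟨σ Set.univ • τ, ⟨by simpa using hτu⟩, by simp [hτ0], ?_⟩
  rw [h, hμ, Measure.prod_smul_left, Measure.prod_smul_right, smul_smul, mul_comm, hc, one_smul]

instance (m : ℕ) [NeZero m] : IsProbabilityMeasure (unifSphere m) := by
  have : Nontrivial (EuclideanSpace ℝ (Fin m)) := by
    have : Nonempty (Fin m) := ⟨0⟩
    infer_instance
  constructor
  rw [unifSphere, Measure.map_apply measurable_subtype_coe MeasurableSet.univ]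
  simp only [Set.preimage_univ, Measure.smul_apply, smul_eq_mul]
  exact ENNReal.inv_mul_cancel
    (Measure.measure_univ_ne_zero.2 (Measure.toSphere_ne_zero _)) (measure_ne_top _ _)

lemma stdGaussian_map_normalize (m : ℕ) [NeZero m] :
    (stdGaussian (EuclideanSpace ℝ (Fin m))).map (fun x => ‖x‖⁻¹ • x) = unifSphere m := by
  obtain ⟨τ, hτ, -, h⟩ := stdGaussian_map_polar m
  have := congrArg (fun ν => ν.map Prod.fst) h
  simp only [Measure.map_fst_prod, measure_univ, one_smul] at this
  rw [Measure.map_map measurable_fst (by fun_prop)] at this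
  exact this

lemma unifSphere_ae_norm (m : ℕ) : ∀ᵐ x ∂unifSphere m, ‖x‖ = 1 := by
  rw [unifSphere, ae_map_iff measurable_subtype_coe.aemeasurable
    (measurableSet_eq_fun measurable_norm measurable_const)]
  exact Filter.Eventually.of_forall fun x => by simp

/-- Normalisation commutes with linear isometries and the Gaussian is invariant under them, so the
invariance passes to the sphere. -/
lemma unifSphere_map_isometry (m : ℕ) [NeZero m]
    (f : EuclideanSpace ℝ (Fin m) ≃ₗᵢ[ℝ] EuclideanSpace ℝ (Fin m)) :
    (unifSphere m).map f = unifSphere m := by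
  have hf : Measurable f := f.continuous.measurable
  conv_lhs => rw [← stdGaussian_map_normalize]
  conv_rhs => rw [← stdGaussian_map_normalize, ← stdGaussian_map f]
  rw [Measure.map_map hf (by fun_prop), Measure.map_map (by fun_prop) hf]
  congr 1
  ext1 x
  simp

end Polar

/-! ### Splitting a uniform vector along a fixed direction. -/

section Decomposition

lemma exists_orthonormalBasis_zero_eq {m : ℕ} (v : EuclideanSpace ℝ (Fin (m + 1))) (hv : ‖v‖ = 1) :
    ∃ b : OrthonormalBasis (Fin (m + 1)) ℝ (EuclideanSpace ℝ (Fin (m + 1))), b 0 = v := by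
  obtain ⟨b, hb⟩ := Orthonormal.exists_orthonormalBasis_extension_of_card_eq (𝕜 := ℝ)
    (E := EuclideanSpace ℝ (Fin (m + 1))) (ι := Fin (m + 1)) (by simp) (v := fun _ => v) (s := {0})
    (by
      refine ⟨fun i => by simpa using hv, fun i j hij => ?_⟩
      exact absurd (Subtype.ext (i.2.trans j.2.symm)) hij)
  exact ⟨b, hb 0 rfl⟩

/-- Gaussian coordinates in an orthonormal basis starting with `v`: the first is independent of the
other m, which `ι` embeds into the orthogonal complement of `v`. -/
lemma exists_stdGaussian_decomposition {m : ℕ} (v : EuclideanSpace ℝ (Fin (m + 1)))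
    (hv : ‖v‖ = 1) :
    ∃ ι : EuclideanSpace ℝ (Fin m) →ₗᵢ[ℝ] EuclideanSpace ℝ (Fin (m + 1)),
      (∀ θ, inner ℝ v (ι θ) = 0) ∧
      stdGaussian (EuclideanSpace ℝ (Fin (m + 1))) =
        ((gaussianReal 0 1).prod (stdGaussian (EuclideanSpace ℝ (Fin m)))).map
          (fun y => y.1 • v + ι y.2) := by
  obtain ⟨b, hb⟩ := exists_orthonormalBasis_zero_eq v hv
  let pad : EuclideanSpace ℝ (Fin m) →ₗ[ℝ] EuclideanSpace ℝ (Fin (m + 1)) :=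
    { toFun := fun θ => WithLp.toLp 2 (Fin.cons 0 θ.ofLp)
      map_add' := fun x y => by
        ext i; refine Fin.cases ?_ (fun i => ?_) i <;> simp
      map_smul' := fun r x => by
        ext i; refine Fin.cases ?_ (fun i => ?_) i <;> simp }
  have hpad : ∀ θ, ‖pad θ‖ = ‖θ‖ := fun θ => by
    simp [pad, EuclideanSpace.norm_eq, Fin.sum_univ_succ]
  let padI : EuclideanSpace ℝ (Fin m) →ₗᵢ[ℝ] EuclideanSpace ℝ (Fin (m + 1)) := ⟨pad, hpad⟩
  let ι := b.repr.symm.toLinearIsometry.comp padI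
  have hcons : ∀ (ξ : ℝ) (θ : EuclideanSpace ℝ (Fin m)),
      b.repr.symm (WithLp.toLp 2 (Fin.cons ξ θ.ofLp)) = ξ • v + ι θ := by
    intro ξ θ
    have h1 : (WithLp.toLp 2 (Fin.cons ξ θ.ofLp) : EuclideanSpace ℝ (Fin (m + 1))) =
        ξ • EuclideanSpace.single 0 1 + pad θ := by
      ext i; refine Fin.cases ?_ (fun i => ?_) i <;> simp [pad]
    rw [h1, map_add, map_smul, b.repr_symm_single, hb]
    rfl
  refine ⟨ι, fun θ => ?_, ?_⟩
  · have h1 : v = b.repr.symm (EuclideanSpace.single 0 1) := by rw [b.repr_symm_single, hb]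
    have h2 : ι θ = b.repr.symm (pad θ) := rfl
    rw [h1, h2, LinearIsometryEquiv.inner_map_map]
    simp [pad, EuclideanSpace.inner_single_left]
  · have hmp := (measurePreserving_piFinSuccAbove
      (fun _ : Fin (m + 1) => gaussianReal 0 1) 0).symm
    rw [← stdGaussian_map b.repr.symm, ← map_pi_eq_stdGaussian, ← map_pi_eq_stdGaussian,
      ← hmp.map_eq]
    have hpm : (gaussianReal 0 1).prod ((Measure.pi fun _ : Fin m => gaussianReal 0 1).map
        (WithLp.toLp 2)) = ((gaussianReal 0 1).prod
          (Measure.pi fun _ : Fin m => gaussianReal 0 1)).map (Prod.map id (WithLp.toLp 2)) := by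
      rw [← Measure.map_prod_map _ _ measurable_id (by fun_prop), Measure.map_id]
    have hι : Measurable ι := ι.continuous.measurable
    have hbm : Measurable b.repr.symm := b.repr.symm.continuous.measurable
    rw [hpm, Measure.map_map (by fun_prop) (by fun_prop), Measure.map_map (by fun_prop)
      (by fun_prop), Measure.map_map (by fun_prop) (by fun_prop)]
    congr 1
    ext1 y
    simp only [Function.comp]
    rw [Prod.map_fst, Prod.map_snd, ← hcons]
    congr 2
    funext i
    refine Fin.cases ?_ (fun i => ?_) i <;> simp [MeasurableEquiv.piFinSuccAbove]

/-- Decomposition of a uniform unit vector along a fixed direction. -/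
lemma exists_unifSphere_decomposition_aux {m : ℕ} [NeZero m] :
    ∃ ν : Measure ℝ, IsProbabilityMeasure ν ∧ NullSingletonClass ν ∧ ν (Set.Ioo (-1) 1)ᶜ = 0 ∧
    ∀ v : EuclideanSpace ℝ (Fin (m + 1)), ‖v‖ = 1 →
    ∃ ι : EuclideanSpace ℝ (Fin m) →ₗᵢ[ℝ] EuclideanSpace ℝ (Fin (m + 1)),
      (∀ θ, inner ℝ v (ι θ) = 0) ∧
      unifSphere (m + 1) = (ν.prod (unifSphere m)).map
          (fun y => y.1 • v + √(1 - y.1 ^ 2) • ι y.2) := by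
  obtain ⟨τ, hτ, hτ0, hpol⟩ := stdGaussian_map_polar m
  have hτpos : ∀ᵐ r ∂τ, 0 < r := by
    rw [ae_iff]; convert hτ0 using 2; ext; simp
  -- The coordinate along v after normalisation, from the Gaussian coordinate `y.1` and the length
  -- `y.2` of the orthogonal part. It does not see the direction of the orthogonal part, hence the
  -- independence.
  set q : ℝ × ℝ → ℝ := fun y => y.1 / √(y.1 ^ 2 + y.2 ^ 2) with hq
  have hqm : Measurable q := by fun_prop
  have hfst : Filter.Tendsto Prod.fst (ae ((gaussianReal 0 1).prod τ)) (ae (gaussianReal 0 1)) :=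
    Measure.quasiMeasurePreserving_fst.tendsto_ae
  have hsnd : ∀ᵐ y ∂(gaussianReal 0 1).prod τ, 0 < y.2 :=
    Measure.quasiMeasurePreserving_snd.ae hτpos
  have hsq : ∀ y : ℝ × ℝ, 0 < y.2 → q y ^ 2 = y.1 ^ 2 / (y.1 ^ 2 + y.2 ^ 2) := fun y hy => by
    rw [hq]; simp only; rw [div_pow, Real.sq_sqrt (by positivity)]
  refine ⟨((gaussianReal 0 1).prod τ).map q, Measure.isProbabilityMeasure_map hqm.aemeasurable,
    ⟨fun c => ?_⟩, ?_, fun v hv => ?_⟩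
  · rw [Measure.map_apply hqm (measurableSet_singleton c),
      Measure.prod_apply_symm (hqm (measurableSet_singleton c)),
      lintegral_eq_zero_iff (measurable_measure_prodMk_right (hqm (measurableSet_singleton c)))]
    have := nullSingletonClass_gaussianReal (μ := 0) (v := 1) one_ne_zero
    filter_upwards [hτpos] with r hr
    -- For fixed r > 0 the map x ↦ x / √(x² + r²) is injective, so its fibres are null for the
    -- Gaussian.
    refine Set.Subsingleton.measure_zero (fun x hx y hy => ?_) _
    have hx : q (x, r) = c := hx
    have hy : q (y, r) = c := hy
    have h1 := hsq (x, r) hr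
    have h2 := hsq (y, r) hr
    rw [hx] at h1
    rw [hy] at h2
    have h3 : x ^ 2 = y ^ 2 := by
      have h4 := h1.symm.trans h2
      simp only at h4
      rw [div_eq_div_iff (by positivity) (by positivity)] at h4
      have : (x ^ 2 - y ^ 2) * r ^ 2 = 0 := by linarith
      rcases mul_eq_zero.1 this with h | h
      · linarith
      · exact absurd h (by positivity)
    have h5 := hx.trans hy.symm
    simp only [hq, h3] at h5
    have h6 : √(y ^ 2 + r ^ 2) ≠ 0 := by positivity
    field_simp at h5
    exact h5
  · rw [Measure.map_apply hqm measurableSet_Ioo.compl]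
    refine measure_mono_null (fun y hy => ?_) (ae_iff.1 hsnd)
    simp only [Set.mem_ofPred_eq]
    intro hy2
    apply hy
    have h1 := hsq y hy2
    have : q y ^ 2 < 1 := by
      rw [h1, div_lt_one (by positivity)]
      have : 0 < y.2 ^ 2 := by positivity
      linarith
    exact ⟨by nlinarith, by nlinarith⟩
  · obtain ⟨ι, hι, hg⟩ := exists_stdGaussian_decomposition v hv
    have hιm : Measurable ι := ι.continuous.measurable
    refine ⟨ι, hι, ?_⟩
    have hpolm : Measurable fun x : EuclideanSpace ℝ (Fin m) => (‖x‖⁻¹ • x, ‖x‖) := by fun_prop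
    -- Reorders coordinate, direction and radius so that coordinate and radius, which `q` merges,
    -- stand together.
    have hR : MeasurePreserving
        (fun y : ℝ × EuclideanSpace ℝ (Fin m) × ℝ => ((y.1, y.2.2), y.2.1))
        ((gaussianReal 0 1).prod ((unifSphere m).prod τ))
        (((gaussianReal 0 1).prod τ).prod (unifSphere m)) :=
      ((measurePreserving_prodAssoc (gaussianReal 0 1) τ (unifSphere m)).symm).comp
        ((MeasurePreserving.id (gaussianReal 0 1)).prod Measure.measurePreserving_swap)
    have hγ : (gaussianReal 0 1).prod ((unifSphere m).prod τ) =
        ((gaussianReal 0 1).prod (stdGaussian (EuclideanSpace ℝ (Fin m)))).map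
          (Prod.map id fun x => (‖x‖⁻¹ • x, ‖x‖)) := by
      rw [← hpol, ← Measure.map_prod_map _ _ measurable_id hpolm, Measure.map_id]
    have hν : (((gaussianReal 0 1).prod τ).map q).prod (unifSphere m) =
        (((gaussianReal 0 1).prod τ).prod (unifSphere m)).map (Prod.map q id) := by
      rw [← Measure.map_prod_map _ _ hqm measurable_id, Measure.map_id]
    rw [← stdGaussian_map_normalize, hg, hν, ← hR.map_eq, hγ,
      Measure.map_map (by fun_prop) (by fun_prop),
      Measure.map_map (by fun_prop) (by fun_prop),
      Measure.map_map (by fun_prop) (by fun_prop),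
      Measure.map_map (by fun_prop) (by fun_prop)]
    congr 1
    ext1 ⟨ξ, h⟩
    have hn : ‖ξ • v + ι h‖ = √(ξ ^ 2 + ‖h‖ ^ 2) := by
      rw [← Real.sqrt_sq (norm_nonneg (ξ • v + ι h)), norm_add_sq_real, real_inner_smul_left, hι,
        norm_smul, hv]
      simp
    simp only [Function.comp, Prod.map, id, hn, map_smul, hq]
    rcases eq_or_ne h 0 with rfl | h0
    · simp [smul_smul, div_eq_inv_mul]
    · have hpos : 0 < ‖h‖ := norm_pos_iff.2 h0
      have h1 := hsq (ξ, ‖h‖) hpos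
      simp only [hq] at h1
      have h2 : 1 - ξ ^ 2 / (ξ ^ 2 + ‖h‖ ^ 2) = ‖h‖ ^ 2 / (ξ ^ 2 + ‖h‖ ^ 2) := by
        field_simp; ring
      rw [h1, h2, Real.sqrt_div (by positivity), Real.sqrt_sq hpos.le, smul_add, smul_smul,
        smul_smul]
      congr 2
      · ring
      · field_simp

/-- The coordinate law in `exists_unifSphere_decomposition_aux` is anonymous. It is the law of ⟨u,
v⟩ for every fixed unit `v`, hence also after averaging over v, which identifies it. -/
lemma exists_sphereInnerLaw_decomposition {m : ℕ} [NeZero m] :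
    NullSingletonClass (sphereInnerLaw (m + 1)) ∧ IsProbabilityMeasure (sphereInnerLaw (m + 1)) ∧
      sphereInnerLaw (m + 1) (Set.Ioo (-1) 1)ᶜ = 0 ∧
    ∀ v : EuclideanSpace ℝ (Fin (m + 1)), ‖v‖ = 1 →
      (unifSphere (m + 1)).map (fun u => inner ℝ u v) = sphereInnerLaw (m + 1) ∧
    ∃ ι : EuclideanSpace ℝ (Fin m) →ₗᵢ[ℝ] EuclideanSpace ℝ (Fin (m + 1)),
      (∀ θ, inner ℝ v (ι θ) = 0) ∧
      unifSphere (m + 1) = ((sphereInnerLaw (m + 1)).prod (unifSphere m)).map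
          (fun y => y.1 • v + √(1 - y.1 ^ 2) • ι y.2) := by
  obtain ⟨ν, hν, hν1, hν2, h⟩ := exists_unifSphere_decomposition_aux (m := m)
  have hinner : ∀ v : EuclideanSpace ℝ (Fin (m + 1)), ‖v‖ = 1 →
      (unifSphere (m + 1)).map (fun u => inner ℝ u v) = ν := by
    intro v hv
    obtain ⟨ι, hι, hU⟩ := h v hv
    have hιm : Measurable ι := ι.continuous.measurable
    rw [hU, Measure.map_map (by fun_prop) (by fun_prop)]
    have : ((fun u => inner ℝ u v) ∘ fun y : ℝ × EuclideanSpace ℝ (Fin m) =>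
        y.1 • v + √(1 - y.1 ^ 2) • ι y.2) = Prod.fst := by
      ext1 y
      rw [Function.comp, real_inner_comm]
      simp [inner_add_right, real_inner_smul_right, hv, hι]
    rw [this, Measure.map_fst_prod, measure_univ, one_smul]
  have hlaw : sphereInnerLaw (m + 1) = ν := by
    have hm : Measurable fun x : EuclideanSpace ℝ (Fin (m + 1)) × EuclideanSpace ℝ (Fin (m + 1)) =>
      inner ℝ x.1 x.2 := by fun_prop
    ext s hs
    rw [sphereInnerLaw, Measure.map_apply hm hs, Measure.prod_apply_symm (hm hs)]
    have : ∀ᵐ v ∂unifSphere (m + 1), unifSphere (m + 1) ((fun u => (u, v)) ⁻¹'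
        ((fun x => inner ℝ x.1 x.2) ⁻¹' s)) = ν s := by
      filter_upwards [unifSphere_ae_norm (m + 1)] with v hv
      rw [← hinner v hv, Measure.map_apply (by fun_prop) hs]
      rfl
    rw [lintegral_congr_ae this]
    simp
  rw [hlaw]
  exact ⟨hν1, hν, hν2, fun v hv => ⟨hinner v hv, h v hv⟩⟩

end Decomposition

/-! ### The coordinate law in dimension at least two. -/

section TwoLe

variable {d : ℕ} [hd : Fact (2 ≤ d)]

instance : NeZero d := ⟨by have := hd.out; omega⟩

instance : NullSingletonClass (sphereInnerLaw d) := by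
  obtain ⟨m, rfl⟩ : ∃ m, d = m + 1 := ⟨d - 1, by have := hd.out; omega⟩
  have : NeZero m := ⟨by have := hd.out; omega⟩
  exact exists_sphereInnerLaw_decomposition.1

instance : IsProbabilityMeasure (sphereInnerLaw d) := by
  obtain ⟨m, rfl⟩ : ∃ m, d = m + 1 := ⟨d - 1, by have := hd.out; omega⟩
  have : NeZero m := ⟨by have := hd.out; omega⟩
  exact exists_sphereInnerLaw_decomposition.2.1

lemma sphereInnerLaw_ae_mem_Ioo : ∀ᵐ x ∂sphereInnerLaw d, x ∈ Set.Ioo (-1 : ℝ) 1 := by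
  obtain ⟨m, rfl⟩ : ∃ m, d = m + 1 := ⟨d - 1, by have := hd.out; omega⟩
  have : NeZero m := ⟨by have := hd.out; omega⟩
  exact exists_sphereInnerLaw_decomposition.2.2.1

lemma unifSphere_map_inner (v : EuclideanSpace ℝ (Fin d)) (hv : ‖v‖ = 1) :
    (unifSphere d).map (fun u => inner ℝ u v) = sphereInnerLaw d := by
  obtain ⟨m, rfl⟩ : ∃ m, d = m + 1 := ⟨d - 1, by have := hd.out; omega⟩
  have : NeZero m := ⟨by have := hd.out; omega⟩
  exact (exists_sphereInnerLaw_decomposition.2.2.2 v hv).1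

/-- A uniform unit vector is `x • v + √(1 - x ^ 2) • θ` where the coordinate `x` along the fixed
direction `v` is independent of the unit vector `θ` orthogonal to `v`. -/
lemma exists_unifSphere_decomposition (v : EuclideanSpace ℝ (Fin d)) (hv : ‖v‖ = 1) :
    ∃ η : Measure (EuclideanSpace ℝ (Fin d)), IsProbabilityMeasure η ∧
      (∀ᵐ θ ∂η, ‖θ‖ = 1 ∧ inner ℝ θ v = 0) ∧
      unifSphere d = ((sphereInnerLaw d).prod η).map
          (fun y => y.1 • v + √(1 - y.1 ^ 2) • y.2) := by
  obtain ⟨m, rfl⟩ : ∃ m, d = m + 1 := ⟨d - 1, by have := hd.out; omega⟩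
  have : NeZero m := ⟨by have := hd.out; omega⟩
  obtain ⟨ι, hι, h⟩ := (exists_sphereInnerLaw_decomposition.2.2.2 v hv).2
  have hιm : Measurable ι := ι.continuous.measurable
  refine ⟨(unifSphere m).map ι, Measure.isProbabilityMeasure_map hιm.aemeasurable, ?_, ?_⟩
  · rw [ae_map_iff hιm.aemeasurable]
    · filter_upwards [unifSphere_ae_norm m] with θ hθ
      exact ⟨by simpa using hθ, by rw [real_inner_comm]; exact hι θ⟩
    · exact (measurableSet_eq_fun (by fun_prop) (by fun_prop)).inter
        (measurableSet_eq_fun (by fun_prop) (by fun_prop))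
  · have h1 : (sphereInnerLaw (m + 1)).prod ((unifSphere m).map ι) =
        ((sphereInnerLaw (m + 1)).prod (unifSphere m)).map (Prod.map id ι) := by
      rw [← Measure.map_prod_map _ _ measurable_id hιm, Measure.map_id]
    rw [h1, Measure.map_map (by fun_prop) (by fun_prop)]
    exact h

end TwoLe

/-! ### Distribution function, quantile function and ranks. -/

section Quantile

variable {d : ℕ}

lemma sphereCDF_nonneg (x : ℝ) : 0 ≤ sphereCDF d x := measureReal_nonneg

lemma bddBelow_quantile (u : ℝ) : BddBelow {x : ℝ | -1 ≤ x ∧ u ≤ sphereCDF d x} :=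
  ⟨-1, fun _ h => h.1⟩

variable [hd : Fact (2 ≤ d)]

lemma sphereCDF_le_one (x : ℝ) : sphereCDF d x ≤ 1 := measureReal_le_one

lemma sphereCDF_mono : Monotone (sphereCDF d) := fun _ _ h =>
  measureReal_mono (Set.Iic_subset_Iic.2 h)

lemma sphereCDF_eq_cdf : sphereCDF d = cdf (sphereInnerLaw d) := by
  ext x; rw [cdf_eq_real]; rfl

lemma continuous_sphereCDF : Continuous (sphereCDF d) := by
  rw [continuous_iff_continuousAt]
  intro x
  rw [sphereCDF_eq_cdf, (monotone_cdf _).continuousAt_iff_leftLim_eq_rightLim,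
    StieltjesFunction.rightLim_eq]
  have h : (cdf (sphereInnerLaw d)).measure {x} = 0 := by
    rw [measure_cdf, measure_singleton]
  rw [StieltjesFunction.measure_singleton, ENNReal.ofReal_eq_zero, sub_nonpos] at h
  exact le_antisymm ((monotone_cdf _).leftLim_le le_rfl) h

lemma sphereCDF_of_le_neg_one {x : ℝ} (hx : x ≤ -1) : sphereCDF d x = 0 := by
  rw [sphereCDF, measureReal_eq_zero_iff]
  refine measure_mono_null (fun y hy => ?_) (ae_iff.1 (sphereInnerLaw_ae_mem_Ioo (d := d)))
  intro h
  have := h.1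
  have : y ≤ x := hy
  linarith

lemma sphereCDF_of_one_le {x : ℝ} (hx : 1 ≤ x) : sphereCDF d x = 1 := by
  rw [sphereCDF, measureReal_def, (prob_compl_eq_zero_iff measurableSet_Iic).1, ENNReal.toReal_one]
  refine measure_mono_null (fun y hy => ?_) (ae_iff.1 (sphereInnerLaw_ae_mem_Ioo (d := d)))
  intro h
  have := h.2
  have : x < y := not_le.1 hy
  linarith

lemma nonempty_quantile {u : ℝ} (hu : u ≤ 1) : {x : ℝ | -1 ≤ x ∧ u ≤ sphereCDF d x}.Nonempty :=
  ⟨1, by norm_num, by rwa [sphereCDF_of_one_le le_rfl]⟩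

/-- Continuity makes the infimum attained. Positivity of `u` matters: at 0 the quantile is -1, while
the right-hand side holds for every x. -/
lemma sphereQuantile_le_iff {u x : ℝ} (hu0 : 0 < u) (hu1 : u ≤ 1) :
    sphereQuantile d u ≤ x ↔ u ≤ sphereCDF d x := by
  constructor
  · intro h
    have hclosed : IsClosed {x : ℝ | -1 ≤ x ∧ u ≤ sphereCDF d x} :=
      (isClosed_Ici).inter (isClosed_le continuous_const continuous_sphereCDF)
    have := hclosed.csInf_mem (nonempty_quantile hu1) (bddBelow_quantile u)
    exact this.2.trans (sphereCDF_mono h)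
  · intro h
    refine csInf_le (bddBelow_quantile u) ⟨?_, h⟩
    by_contra! hx
    rw [sphereCDF_of_le_neg_one hx.le] at h
    linarith

lemma sphereCDF_sphereQuantile {u : ℝ} (hu0 : 0 < u) (hu1 : u ≤ 1) :
    sphereCDF d (sphereQuantile d u) = u := by
  refine le_antisymm ?_ ((sphereQuantile_le_iff hu0 hu1).1 le_rfl)
  refine le_of_tendsto (f := sphereCDF d) (x := nhdsWithin (sphereQuantile d u) (Set.Iio (sphereQuantile d u)))
    (continuous_sphereCDF.continuousAt.mono_left nhdsWithin_le_nhds) ?_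
  filter_upwards [self_mem_nhdsWithin] with x hx
  by_contra! h
  exact absurd ((sphereQuantile_le_iff hu0 hu1).2 h.le) (not_le.2 hx)

lemma measurable_sphereQuantile : Measurable (sphereQuantile d) := by
  -- Beyond 1 the defining set is empty and `sInf` returns 0, so monotonicity is available only
  -- after truncation at 1.
  have hmono : Monotone fun u => sphereQuantile d (min u 1) := fun u v huv =>
    csInf_le_csInf (bddBelow_quantile _) (nonempty_quantile (min_le_right _ _))
      fun x hx => ⟨hx.1, (min_le_min_right 1 huv).trans hx.2⟩
  have : sphereQuantile d = fun u => if u ≤ 1 then sphereQuantile d (min u 1) else 0 := by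
    ext u
    split_ifs with h
    · rw [min_eq_left h]
    · have : {x : ℝ | -1 ≤ x ∧ u ≤ sphereCDF d x} = ∅ := by
        ext x
        have := sphereCDF_le_one (d := d) x
        simp only [Set.mem_ofPred_eq, Set.mem_empty_iff_false, iff_false, not_and]
        intro _; linarith
      rw [sphereQuantile, this, Real.sInf_empty]
  rw [this]
  exact Measurable.ite measurableSet_Iic hmono.measurable measurable_const

lemma measurable_sphereCDF : Measurable (sphereCDF d) := sphereCDF_mono.measurable

/-- The uniform distribution on `(0, 1]`. -/
abbrev unifIoc : Measure ℝ := volume.restrict (Set.Ioc 0 1)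

instance : IsProbabilityMeasure unifIoc := ⟨by simp⟩

lemma unifIoc_map_quantile : unifIoc.map (sphereQuantile d) = sphereInnerLaw d := by
  have : IsProbabilityMeasure (unifIoc.map (sphereQuantile d)) :=
    Measure.isProbabilityMeasure_map measurable_sphereQuantile.aemeasurable
  refine Measure.ext_of_Iic _ _ fun x => ?_
  rw [Measure.map_apply measurable_sphereQuantile measurableSet_Iic,
    Measure.restrict_apply (measurable_sphereQuantile measurableSet_Iic)]
  have : sphereQuantile d ⁻¹' Set.Iic x ∩ Set.Ioc 0 1 = Set.Ioc 0 (sphereCDF d x) := by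
    ext u
    simp only [Set.mem_inter_iff, Set.mem_preimage, Set.mem_Iic, Set.mem_Ioc]
    constructor
    · rintro ⟨h1, h2, h3⟩; exact ⟨h2, (sphereQuantile_le_iff h2 h3).1 h1⟩
    · rintro ⟨h1, h2⟩
      have h3 := h2.trans (sphereCDF_le_one x)
      exact ⟨(sphereQuantile_le_iff h1 h3).2 h2, h1, h3⟩
  rw [this, Real.volume_Ioc, sub_zero, sphereCDF, ofReal_measureReal]

lemma ae_unifIoc : ∀ᵐ u ∂unifIoc, 0 < u ∧ u ≤ 1 := by
  filter_upwards [ae_restrict_mem measurableSet_Ioc] with u hu using hu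

lemma sphereInnerLaw_map_cdf : (sphereInnerLaw d).map (sphereCDF d) = unifIoc := by
  rw [← unifIoc_map_quantile, Measure.map_map measurable_sphereCDF measurable_sphereQuantile]
  conv_rhs => rw [← Measure.map_id (μ := unifIoc)]
  refine Measure.map_congr ?_
  filter_upwards [ae_unifIoc] with u hu using sphereCDF_sphereQuantile hu.1 hu.2

lemma ae_sphereCDF_ne (c : ℝ) : ∀ᵐ x ∂sphereInnerLaw d, sphereCDF d x ≠ c := by
  have h : ∀ᵐ u ∂(sphereInnerLaw d).map (sphereCDF d), u ≠ c := by
    rw [sphereInnerLaw_map_cdf, ae_iff]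
    simp
  exact ae_of_ae_map measurable_sphereCDF.aemeasurable h

lemma sphereInnerLaw_cdf_le {c : ℝ} (hc1 : c ≤ 1) :
    sphereInnerLaw d {x | sphereCDF d x ≤ c} = ENNReal.ofReal c := by
  have : sphereInnerLaw d {x | sphereCDF d x ≤ c} =
      (sphereInnerLaw d).map (sphereCDF d) (Set.Iic c) := by
    rw [Measure.map_apply measurable_sphereCDF measurableSet_Iic]; rfl
  rw [this, sphereInnerLaw_map_cdf, Measure.restrict_apply measurableSet_Iic]
  have : Set.Iic c ∩ Set.Ioc 0 1 = Set.Ioc 0 c := by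
    ext u; simp only [Set.mem_inter_iff, Set.mem_Iic, Set.mem_Ioc]
    constructor
    · rintro ⟨h1, h2, h3⟩; exact ⟨h2, h1⟩
    · rintro ⟨h1, h2⟩; exact ⟨h2, h1, h2.trans hc1⟩
  rw [this, Real.volume_Ioc, sub_zero]

lemma IsSphereThreshold.cdf_eq {p τ : ℝ} (hp : 0 ≤ p) (h : IsSphereThreshold d p τ) :
    sphereCDF d τ = 1 - p := by
  have h1 : (sphereInnerLaw d).real (Set.Ici τ) = p := by
    rw [measureReal_def, h, ENNReal.toReal_ofReal hp]
  have h2 := probReal_compl_eq_one_sub (μ := sphereInnerLaw d) (measurableSet_Ici (a := τ))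
  rw [h1, Set.compl_Ici, measureReal_def, measure_congr Iio_ae_eq_Iic, ← measureReal_def] at h2
  exact h2

end Quantile

/-! ### One adjustment step and its invariance. -/

section Step

/-- The law of a random proposition which holds with probability `p`. -/
def coin (p : unitInterval) : Measure Prop :=
  unitInterval.toNNReal p • Measure.dirac True +
    unitInterval.toNNReal (unitInterval.symm p) • Measure.dirac False

instance (p : unitInterval) : IsProbabilityMeasure (coin p) := by
  unfold coin; infer_instance

lemma lintegral_coin (p : unitInterval) (f : Prop → ENNReal) :
    ∫⁻ h, f h ∂coin p = ENNReal.ofReal p * f True + ENNReal.ofReal (1 - p) * f False := by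
  have h1 : ∀ q : unitInterval, (unitInterval.toNNReal q : ENNReal) = ENNReal.ofReal q := fun q => by
    rw [ENNReal.ofReal, ENNReal.coe_inj]
    ext; simp [Real.coe_toNNReal _ q.2.1]
  simp only [coin, lintegral_add_measure, lintegral_smul_measure, lintegral_dirac]
  change (unitInterval.toNNReal p : ENNReal) * _ + (unitInterval.toNNReal _ : ENNReal) * _ = _
  rw [h1, h1, unitInterval.coe_symm_eq]

open Classical in
/-- The rank of the new coordinate, as a function of the edge indicator and of the old rank. -/
def newRank (p : ℝ) (h : Prop) (u : ℝ) : ℝ :=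
  if h then (if u ≤ 1 - p then 1 - p + p * u / (1 - p) else u)
  else (if u ≤ 1 - p then u else (1 - p) * (u - (1 - p)) / p)

open Classical in
/-- The new coordinate along an already placed vector: `x` is kept if it is on the side of the
threshold which is prescribed by the edge indicator `h`, and is moved to this side otherwise. -/
def newCoord (d : ℕ) (p : ℝ) (h : Prop) (x : ℝ) : ℝ :=
  if h then (if sphereCDF d x ≤ 1 - p then
      sphereQuantile d (1 - p + p * sphereCDF d x / (1 - p)) else x)
  else (if sphereCDF d x ≤ 1 - p then x else
      sphereQuantile d ((1 - p) * (sphereCDF d x - (1 - p)) / p))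

lemma measurable_of_prop {α β : Type*} [MeasurableSpace α] [MeasurableSpace β] {f : Prop × α → β}
    (h : ∀ a, Measurable fun x => f (a, x)) : Measurable f :=
  measurable_from_prod_countable_right h

lemma measurable_newRank (p : ℝ) : Measurable fun y : Prop × ℝ => newRank p y.1 y.2 := by
  refine measurable_of_prop fun h => ?_
  by_cases hh : h <;> simp only [newRank, hh, if_true, if_false]
  · exact Measurable.ite measurableSet_Iic (by fun_prop) (by fun_prop)
  · exact Measurable.ite measurableSet_Iic (by fun_prop) (by fun_prop)

lemma newRank_mem {p : ℝ} (hp0 : 0 < p) (hp1 : p < 1) (h : Prop) {u : ℝ} (hu0 : 0 < u)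
    (hu1 : u ≤ 1) : 0 < newRank p h u ∧ newRank p h u ≤ 1 := by
  have h1p : 0 < 1 - p := by linarith
  unfold newRank
  split_ifs with hh hu hu
  · refine ⟨by positivity, ?_⟩
    have : p * u / (1 - p) ≤ p := by rw [div_le_iff₀ h1p]; gcongr
    linarith
  · exact ⟨hu0, hu1⟩
  · exact ⟨hu0, hu1⟩
  · push Not at hu
    refine ⟨div_pos (mul_pos h1p (by linarith)) hp0, ?_⟩
    rw [div_le_one hp0]; nlinarith

/-- The cut 1 - p splits the ranks into parts of mass 1 - p and p, the probabilities of a non-edge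
and of an edge. Given the coin, kept and moved ranks are each uniform on the prescribed part, so the
new rank is uniform there; averaging over the coin restores the uniform law. This is checked on
half-lines, with the end point below or above the cut. -/
lemma coin_prod_unifIoc_map_newRank {p : unitInterval} (hp0 : (0 : ℝ) < p) (hp1 : (p : ℝ) < 1) :
    ((coin p).prod unifIoc).map (fun y => newRank p y.1 y.2) = unifIoc := by
  have hm := measurable_newRank p
  have : IsProbabilityMeasure (((coin p).prod unifIoc).map (fun y => newRank p y.1 y.2)) :=
    Measure.isProbabilityMeasure_map hm.aemeasurable
  have h1p : 0 < 1 - (p : ℝ) := by linarith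
  have hfac : 0 < (p : ℝ) / (1 - p) := by positivity
  have hbase : ∀ c : ℝ, 0 ≤ c → c ≤ 1 → unifIoc (Set.Iic c) = ENNReal.ofReal c := fun c h0 h1 => by
    rw [Measure.restrict_apply measurableSet_Iic]
    have : Set.Iic c ∩ Set.Ioc 0 1 = Set.Ioc 0 c := by
      ext u; simp only [Set.mem_inter_iff, Set.mem_Iic, Set.mem_Ioc]
      constructor
      · rintro ⟨h1, h2, h3⟩; exact ⟨h2, h1⟩
      · rintro ⟨h1', h2⟩; exact ⟨h2, h1', h2.trans h1⟩
    rw [this, Real.volume_Ioc, sub_zero]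
  have key : ∀ c : ℝ, 0 ≤ c → c ≤ 1 → (((coin p).prod unifIoc).map (fun y => newRank p y.1 y.2))
      (Set.Iic c) = ENNReal.ofReal c := by
    intro c hc0 hc1
    have hms := hm (measurableSet_Iic (a := c))
    rw [Measure.map_apply hm measurableSet_Iic, Measure.prod_apply hms, lintegral_coin]
    by_cases hc : c < 1 - p
    · have hT : unifIoc (Prod.mk True ⁻¹' ((fun y : Prop × ℝ => newRank p y.1 y.2) ⁻¹' Set.Iic c))
          = 0 := by
        rw [Measure.restrict_apply (measurable_prodMk_left hms)]
        convert measure_empty (μ := volume (α := ℝ))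
        ext u
        simp only [Set.mem_inter_iff, Set.mem_preimage, Set.mem_Iic, Set.mem_Ioc,
          Set.mem_empty_iff_false, iff_false, newRank, if_true]
        rintro ⟨h1, h2, h3⟩
        split_ifs at h1 with hu
        · have : 0 < (p : ℝ) * u / (1 - p) := by positivity
          linarith
        · linarith
      have hF : unifIoc (Prod.mk False ⁻¹' ((fun y : Prop × ℝ => newRank p y.1 y.2) ⁻¹' Set.Iic c))
          = ENNReal.ofReal (c / (1 - p)) := by
        rw [Measure.restrict_apply (measurable_prodMk_left hms)]
        -- The first interval consists of kept ranks, the second of ranks moved down from above the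
        -- cut.
        have : (Prod.mk False ⁻¹' ((fun y : Prop × ℝ => newRank p y.1 y.2) ⁻¹' Set.Iic c)) ∩
            Set.Ioc 0 1 = Set.Ioc 0 c ∪ Set.Ioc (1 - (p : ℝ)) (1 - p + p * c / (1 - p)) := by
          have hcp : c / (1 - p) ≤ 1 := by rw [div_le_one h1p]; exact hc.le
          have hcp' : (p : ℝ) * c / (1 - p) ≤ p := by
            rw [mul_div_assoc]; exact mul_le_of_le_one_right hp0.le hcp
          have hcp0 : 0 ≤ (p : ℝ) * c / (1 - p) := by positivity
          have hiff : ∀ u : ℝ, (1 - p) * (u - (1 - p)) / p ≤ c ↔ u ≤ 1 - p + p * c / (1 - p) := by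
            intro u
            rw [div_le_iff₀ hp0, ← sub_le_iff_le_add', le_div_iff₀ h1p, mul_comm c, mul_comm (1 - _)]
          ext u
          simp only [Set.mem_inter_iff, Set.mem_preimage, Set.mem_Iic, Set.mem_Ioc,
            Set.mem_union, newRank, if_false]
          constructor
          · rintro ⟨h1, h2, h3⟩
            split_ifs at h1 with hu
            · exact Or.inl ⟨h2, h1⟩
            · exact Or.inr ⟨not_le.1 hu, (hiff u).1 h1⟩
          · rintro (⟨h1, h2⟩ | ⟨h1, h2⟩)
            · rw [if_pos (by linarith)]; exact ⟨h2, h1, by linarith⟩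
            · rw [if_neg (by linarith)]; exact ⟨(hiff u).2 h2, by linarith, by linarith⟩
        rw [this, measure_union _ measurableSet_Ioc, Real.volume_Ioc, Real.volume_Ioc,
          ← ENNReal.ofReal_add]
        · congr 1; field_simp; ring
        · linarith
        · have : 0 ≤ (p : ℝ) * c / (1 - p) := by positivity
          linarith
        · rw [Set.disjoint_left]; rintro u ⟨h1, h2⟩ ⟨h3, h4⟩; linarith
      rw [hT, hF, mul_zero, zero_add, ← ENNReal.ofReal_mul h1p.le]
      congr 1; field_simp
    · push Not at hc
      have hF : unifIoc (Prod.mk False ⁻¹' ((fun y : Prop × ℝ => newRank p y.1 y.2) ⁻¹' Set.Iic c))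
          = 1 := by
        rw [Measure.restrict_apply (measurable_prodMk_left hms)]
        have : (Prod.mk False ⁻¹' ((fun y : Prop × ℝ => newRank p y.1 y.2) ⁻¹' Set.Iic c)) ∩
            Set.Ioc 0 1 = Set.Ioc 0 1 := by
          rw [Set.inter_eq_right]
          rintro u ⟨h2, h3⟩
          simp only [Set.mem_preimage, Set.mem_Iic, newRank, if_false]
          split_ifs with hu
          · linarith
          · rw [div_le_iff₀ hp0]; nlinarith
        rw [this]; simp
      have hT : unifIoc (Prod.mk True ⁻¹' ((fun y : Prop × ℝ => newRank p y.1 y.2) ⁻¹' Set.Iic c))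
          = ENNReal.ofReal ((c - (1 - p)) / p) := by
        rw [Measure.restrict_apply (measurable_prodMk_left hms)]
        have : (Prod.mk True ⁻¹' ((fun y : Prop × ℝ => newRank p y.1 y.2) ⁻¹' Set.Iic c)) ∩
            Set.Ioc 0 1 = Set.Ioc 0 ((1 - p) * (c - (1 - p)) / p) ∪ Set.Ioc (1 - (p : ℝ)) c := by
          have hiff : ∀ u : ℝ, 1 - p + p * u / (1 - p) ≤ c ↔ u ≤ (1 - p) * (c - (1 - p)) / p := by
            intro u
            rw [le_div_iff₀ hp0, ← le_sub_iff_add_le', div_le_iff₀ h1p, mul_comm u, mul_comm (1 - _)]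
          have hle : (1 - p) * (c - (1 - p)) / p ≤ 1 - p := by
            rw [div_le_iff₀ hp0]; nlinarith
          ext u
          simp only [Set.mem_inter_iff, Set.mem_preimage, Set.mem_Iic, Set.mem_Ioc,
            Set.mem_union, newRank, if_true]
          constructor
          · rintro ⟨h1, h2, h3⟩
            split_ifs at h1 with hu
            · exact Or.inl ⟨h2, (hiff u).1 h1⟩
            · exact Or.inr ⟨not_le.1 hu, h1⟩
          · rintro (⟨h1, h2⟩ | ⟨h1, h2⟩)
            · rw [if_pos (by linarith)]; exact ⟨(hiff u).2 h2, h1, by linarith⟩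
            · rw [if_neg (by linarith)]; exact ⟨h2, by linarith, by linarith⟩
        rw [this, measure_union _ measurableSet_Ioc, Real.volume_Ioc, Real.volume_Ioc,
          ← ENNReal.ofReal_add]
        · congr 1; field_simp; ring
        · have : 0 ≤ (1 - p) * (c - (1 - p)) / p :=
            div_nonneg (mul_nonneg h1p.le (by linarith)) hp0.le
          linarith
        · linarith
        · have hle : (1 - p) * (c - (1 - p)) / p ≤ 1 - p := by
            rw [div_le_iff₀ hp0]; nlinarith
          rw [Set.disjoint_left]; rintro u ⟨h1, h2⟩ ⟨h3, h4⟩; linarith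
      rw [hT, hF, mul_one, ← ENNReal.ofReal_mul hp0.le, ← ENNReal.ofReal_add]
      · congr 1; field_simp; ring
      · rw [mul_div_cancel₀ _ hp0.ne']; linarith
      · exact h1p.le
  refine Measure.ext_of_Iic _ _ fun c => ?_
  rcases lt_or_ge c 0 with hc | hc
  · have h0 := key 0 le_rfl zero_le_one
    have h0' := hbase 0 le_rfl zero_le_one
    simp only [ENNReal.ofReal_zero] at h0 h0'
    rw [measure_mono_null (Set.Iic_subset_Iic.2 hc.le) h0,
      measure_mono_null (Set.Iic_subset_Iic.2 hc.le) h0']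
  rcases le_or_gt c 1 with hc1 | hc1
  · rw [key c hc hc1, hbase c hc hc1]
  · have h0 := key 1 zero_le_one le_rfl
    have h0' := hbase 1 zero_le_one le_rfl
    simp only [ENNReal.ofReal_one] at h0 h0'
    rw [le_antisymm prob_le_one (h0 ▸ measure_mono (Set.Iic_subset_Iic.2 hc1.le)),
      le_antisymm prob_le_one (h0' ▸ measure_mono (Set.Iic_subset_Iic.2 hc1.le))]

variable {d : ℕ} [hd : Fact (2 ≤ d)]

lemma measurable_newCoord (p : ℝ) : Measurable fun y : Prop × ℝ => newCoord d p y.1 y.2 := by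
  have hF := measurable_sphereCDF (d := d)
  have hQ := measurable_sphereQuantile (d := d)
  refine measurable_of_prop fun h => ?_
  by_cases hh : h <;> simp only [newCoord, hh, if_true, if_false]
  · exact Measurable.ite (hF measurableSet_Iic) (hQ.comp (by fun_prop)) (by fun_prop)
  · exact Measurable.ite (hF measurableSet_Iic) (by fun_prop) (hQ.comp (by fun_prop))

lemma newCoord_sphereQuantile (p : ℝ) (h : Prop) {u : ℝ} (hu0 : 0 < u) (hu1 : u ≤ 1) :
    newCoord d p h (sphereQuantile d u) = sphereQuantile d (newRank p h u) := by
  unfold newCoord newRank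
  rw [sphereCDF_sphereQuantile hu0 hu1]
  split_ifs <;> rfl

/-- The quantile function intertwines `newRank` and `newCoord`, so the invariance of the uniform
rank carries over. -/
lemma coin_prod_map_newCoord {p : unitInterval} (hp0 : (0 : ℝ) < p) (hp1 : (p : ℝ) < 1) :
    ((coin p).prod (sphereInnerLaw d)).map (fun y => newCoord d p y.1 y.2) =
      sphereInnerLaw d := by
  have hQ := measurable_sphereQuantile (d := d)
  have h1 : (coin p).prod (sphereInnerLaw d) =
      ((coin p).prod unifIoc).map (Prod.map id (sphereQuantile d)) := by
    rw [← Measure.map_prod_map _ _ measurable_id hQ, Measure.map_id, unifIoc_map_quantile]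
  rw [h1, Measure.map_map (measurable_newCoord _) (by fun_prop)]
  conv_rhs => rw [← unifIoc_map_quantile, ← coin_prod_unifIoc_map_newRank hp0 hp1,
    Measure.map_map hQ (measurable_newRank _)]
  refine Measure.map_congr ?_
  have : ∀ᵐ y ∂(coin p).prod unifIoc, 0 < y.2 ∧ y.2 ≤ 1 :=
    Measure.quasiMeasurePreserving_snd.ae ae_unifIoc
  filter_upwards [this] with y hy
  exact newCoord_sphereQuantile _ _ hy.1 hy.2

/-- The quantifier over `h` stands inside, so the exceptional null set does not depend on the edge.
Moved coordinates land correctly because the quantile is a lower adjoint of the distribution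
function, whose value at `τ` is the cut 1 - p. -/
lemma newCoord_side {p τ : ℝ} (hp0 : 0 < p) (hp1 : p < 1) (hτ : IsSphereThreshold d p τ) :
    ∀ᵐ x ∂sphereInnerLaw d, ∀ h : Prop,
      (h → τ ≤ newCoord d p h x) ∧ (¬ h → newCoord d p h x ≤ τ) := by
  have hFτ := hτ.cdf_eq hp0.le
  have h1p : 0 < 1 - p := by linarith
  -- Rank 0 is where the quantile fails to invert; rank 1 - p could also be attained to the right of
  -- `τ`, on a plateau of the distribution function.
  filter_upwards [ae_sphereCDF_ne (d := d) 0, ae_sphereCDF_ne (d := d) (1 - p)] with x h0 h1 h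
  have hpos : 0 < sphereCDF d x := lt_of_le_of_ne (sphereCDF_nonneg x) (Ne.symm h0)
  have hle := sphereCDF_le_one (d := d) x
  unfold newCoord
  constructor
  · intro hh
    rw [if_pos hh]
    split_ifs with hx
    · have hr := newRank_mem hp0 hp1 True hpos hle
      simp only [newRank, if_true, if_pos hx] at hr
      by_contra! hlt
      have h2 := (sphereQuantile_le_iff (d := d) hr.1 hr.2).1 hlt.le
      rw [hFτ] at h2
      have : 0 < p * sphereCDF d x / (1 - p) := by positivity
      linarith
    · by_contra! hlt
      exact hx (hFτ ▸ sphereCDF_mono hlt.le)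
  · intro hh
    rw [if_neg hh]
    split_ifs with hx
    · by_contra! hlt
      exact h1 (le_antisymm hx (hFτ ▸ sphereCDF_mono hlt.le))
    · have hr := newRank_mem hp0 hp1 False hpos hle
      simp only [newRank, if_false, if_neg hx] at hr
      rw [sphereQuantile_le_iff hr.1 hr.2, hFτ, div_le_iff₀ hp0]
      nlinarith

/-- The coordinate has to be moved to the other side of the threshold. -/
def IsMoved (d : ℕ) (p : ℝ) (h : Prop) (x : ℝ) : Prop := ¬ (h ↔ 1 - p < sphereCDF d x)

omit hd in
lemma newCoord_of_not_isMoved {p : ℝ} {h : Prop} {x : ℝ} (hm : ¬ IsMoved d p h x) :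
    newCoord d p h x = x := by
  simp only [IsMoved, not_not] at hm
  unfold newCoord
  split_ifs with h1 h2 h2
  · exact absurd (hm.1 h1) (not_lt.2 h2)
  · rfl
  · rfl
  · exact absurd (hm.2 (not_le.1 h2)) h1

lemma measurableSet_isMoved (p : ℝ) :
    MeasurableSet {y : Prop × ℝ | IsMoved d p y.1 y.2} := by
  have hF := measurable_sphereCDF (d := d)
  have : Measurable fun y : Prop × ℝ => IsMoved d p y.1 y.2 := by
    refine measurable_of_prop fun h => ?_
    have : Measurable fun x => 1 - p < sphereCDF d x :=
      measurableSet_setOfPred.1 (measurableSet_lt measurable_const hF)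
    by_cases hh : h
    · simpa [IsMoved, hh] using this.not
    · simpa [IsMoved, hh] using this
  exact measurableSet_setOfPred.2 this

/-- Coin and side are independent, each positive with probability p, so they disagree with
probability 2p(1 - p). -/
lemma coin_prod_isMoved_le (p : unitInterval) :
    ((coin p).prod (sphereInnerLaw d)) {y | IsMoved d p y.1 y.2} ≤ ENNReal.ofReal (2 * p) := by
  have hp0 := p.2.1
  have hp1 := p.2.2
  have hlow := sphereInnerLaw_cdf_le (d := d) (c := 1 - p) (by linarith)
  have hhigh : sphereInnerLaw d {x | sphereCDF d x ≤ 1 - p}ᶜ = ENNReal.ofReal p := by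
    rw [prob_compl_eq_one_sub (measurableSet_le measurable_sphereCDF measurable_const), hlow,
      ← ENNReal.ofReal_one, ← ENNReal.ofReal_sub _ (by linarith)]
    congr 1; ring
  rw [Measure.prod_apply (measurableSet_isMoved _), lintegral_coin]
  have hT : Prod.mk True ⁻¹' {y : Prop × ℝ | IsMoved d p y.1 y.2} =
      {x | sphereCDF d x ≤ 1 - p} := by ext x; simp [IsMoved]
  have hF : Prod.mk False ⁻¹' {y : Prop × ℝ | IsMoved d p y.1 y.2} =
      {x | sphereCDF d x ≤ 1 - p}ᶜ := by ext x; simp [IsMoved]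
  rw [hT, hF, hlow, hhigh, ← ENNReal.ofReal_mul hp0, ← ENNReal.ofReal_mul (by linarith),
    ← ENNReal.ofReal_add (by nlinarith) (by nlinarith)]
  exact ENNReal.ofReal_le_ofReal (by nlinarith)

/-- One step of the embedding: replace the coordinate of `u` along `v` by the new coordinate,
keeping the direction of the component orthogonal to `v`. -/
def step (d : ℕ) (p : ℝ) (h : Prop) (v u : EuclideanSpace ℝ (Fin d)) :
    EuclideanSpace ℝ (Fin d) :=
  √((1 - newCoord d p h (inner ℝ u v) ^ 2) / (1 - inner ℝ u v ^ 2)) • u +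
    (newCoord d p h (inner ℝ u v) -
      √((1 - newCoord d p h (inner ℝ u v) ^ 2) / (1 - inner ℝ u v ^ 2)) * inner ℝ u v) • v

omit hd in
lemma inner_step (p : ℝ) (h : Prop) {v : EuclideanSpace ℝ (Fin d)} (hv : ‖v‖ = 1)
    (u : EuclideanSpace ℝ (Fin d)) :
    inner ℝ (step d p h v u) v = newCoord d p h (inner ℝ u v) := by
  simp [step, inner_add_left, real_inner_smul_left, hv]

lemma measurable_step {α : Type*} [MeasurableSpace α] {p : ℝ} {h : α → Prop}
    {v u : α → EuclideanSpace ℝ (Fin d)} (hh : Measurable h) (hv : Measurable v)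
    (hu : Measurable u) : Measurable fun a => step d p (h a) (v a) (u a) := by
  have hx : Measurable fun a => (inner ℝ (u a) (v a) : ℝ) := hu.inner hv
  have ht : Measurable fun a => newCoord d p (h a) (inner ℝ (u a) (v a)) :=
    (measurable_newCoord p).comp (hh.prodMk hx)
  unfold step
  fun_prop

lemma ae_newCoord_mem {p : unitInterval} (hp0 : (0 : ℝ) < p) (hp1 : (p : ℝ) < 1) :
    ∀ᵐ y ∂(coin p).prod (sphereInnerLaw d), newCoord d p y.1 y.2 ∈ Set.Ioo (-1 : ℝ) 1 := by
  have h : ∀ᵐ t ∂((coin p).prod (sphereInnerLaw d)).map (fun y => newCoord d p y.1 y.2),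
      t ∈ Set.Ioo (-1 : ℝ) 1 := by
    rw [coin_prod_map_newCoord hp0 hp1]; exact sphereInnerLaw_ae_mem_Ioo
  exact ae_of_ae_map (measurable_newCoord _).aemeasurable h

/-- Writing u = x v + √(1 - x²) θ, a step replaces x by the new coordinate t and keeps θ. Here t has
the law of x and is again independent of θ. -/
lemma coin_prod_map_step {p : unitInterval} (hp0 : (0 : ℝ) < p) (hp1 : (p : ℝ) < 1)
    {v : EuclideanSpace ℝ (Fin d)} (hv : ‖v‖ = 1) :
    ((coin p).prod (unifSphere d)).map (fun y => step d p y.1 v y.2) = unifSphere d := by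
  obtain ⟨η, hη, hη1, hU⟩ := exists_unifSphere_decomposition v hv
  set f : ℝ × EuclideanSpace ℝ (Fin d) → EuclideanSpace ℝ (Fin d) :=
    fun y => y.1 • v + √(1 - y.1 ^ 2) • y.2 with hf
  have hfm : Measurable f := by fun_prop
  set g : Prop × ℝ → ℝ := fun y => newCoord d p y.1 y.2
  have hgm : Measurable g := measurable_newCoord _
  have hstep : Measurable fun y : Prop × EuclideanSpace ℝ (Fin d) => step d p y.1 v y.2 :=
    measurable_step measurable_fst measurable_const measurable_snd
  have hmp := (measurePreserving_prodAssoc (coin p) (sphereInnerLaw d) η)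
  have h1 : (coin p).prod (unifSphere d) =
      ((coin p).prod ((sphereInnerLaw d).prod η)).map (Prod.map id f) := by
    rw [← Measure.map_prod_map _ _ measurable_id hfm, Measure.map_id, ← hU]
  have h2 : (sphereInnerLaw d).prod η =
      (((coin p).prod (sphereInnerLaw d)).prod η).map (Prod.map g id) := by
    rw [← Measure.map_prod_map _ _ hgm measurable_id, Measure.map_id,
      coin_prod_map_newCoord hp0 hp1]
  rw [h1, Measure.map_map hstep (by fun_prop), ← hmp.map_eq,
    Measure.map_map (hstep.comp (by fun_prop)) (by fun_prop)]
  conv_rhs => rw [hU, h2, Measure.map_map hfm (by fun_prop)]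
  refine Measure.map_congr ?_
  have hx : ∀ᵐ y ∂((coin p).prod (sphereInnerLaw d)).prod η, y.1.2 ∈ Set.Ioo (-1 : ℝ) 1 :=
    Measure.quasiMeasurePreserving_fst.ae
      (Measure.quasiMeasurePreserving_snd.ae sphereInnerLaw_ae_mem_Ioo)
  have ht : ∀ᵐ y ∂((coin p).prod (sphereInnerLaw d)).prod η, g y.1 ∈ Set.Ioo (-1 : ℝ) 1 :=
    Measure.quasiMeasurePreserving_fst.ae (ae_newCoord_mem hp0 hp1)
  have hθ : ∀ᵐ y ∂((coin p).prod (sphereInnerLaw d)).prod η, ‖y.2‖ = 1 ∧ inner ℝ y.2 v = 0 :=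
    Measure.quasiMeasurePreserving_snd.ae hη1
  filter_upwards [hx, ht, hθ] with y hx ht hθ
  obtain ⟨⟨h, x⟩, θ⟩ := y
  simp only [Function.comp, Prod.map, id, MeasurableEquiv.prodAssoc, MeasurableEquiv.coe_mk,
    Equiv.prodAssoc_apply, g, hf] at hx ht hθ ⊢
  have hin : inner ℝ (x • v + √(1 - x ^ 2) • θ) v = x := by
    simp [inner_add_left, real_inner_smul_left, hv, hθ.2]
  set t := newCoord d p h x
  -- Both coordinates are strictly inside (-1, 1), so the ratio of square roots is genuine.
  have hx2 : 0 < 1 - x ^ 2 := by nlinarith [hx.1, hx.2]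
  have ht2 : 0 < 1 - t ^ 2 := by nlinarith [ht.1, ht.2]
  have hsx : √(1 - x ^ 2) ≠ 0 := (Real.sqrt_pos.2 hx2).ne'
  simp only [step, hin]
  change √((1 - t ^ 2) / (1 - x ^ 2)) • _ + (t - √((1 - t ^ 2) / (1 - x ^ 2)) * x) • v = _
  rw [Real.sqrt_div ht2.le]
  rw [smul_add, smul_smul, smul_smul, div_mul_cancel₀ _ hsx, add_right_comm, ← add_smul]
  congr 2
  ring

end Step

/-! ### Refreshing one entry of an i.i.d. sequence. -/

section Resample

variable {X : Type*} [MeasurableSpace X] (κ : Measure X) [IsProbabilityMeasure κ]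

lemma infinitePi_map_update (k : ℕ) :
    ((Measure.infinitePi fun _ : ℕ => κ).prod κ).map (fun y => Function.update y.1 k y.2) =
      Measure.infinitePi fun _ : ℕ => κ := by
  have hm : Measurable fun y : (ℕ → X) × X => Function.update y.1 k y.2 := by
    rw [measurable_pi_iff]
    intro i
    by_cases h : i = k
    · subst h; simpa using measurable_snd
    · simp only [Function.update_of_ne h]; fun_prop
  refine Measure.eq_infinitePi _ fun s t ht => ?_
  rw [Measure.map_apply hm (MeasurableSet.pi s.countable_toSet fun i _ => ht i)]
  by_cases hk : k ∈ s
  · have : (fun y : (ℕ → X) × X => Function.update y.1 k y.2) ⁻¹' ((s : Set ℕ).pi t) =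
        (((s.erase k : Finset ℕ) : Set ℕ).pi t) ×ˢ t k := by
      ext ⟨w, x⟩
      simp only [Set.mem_preimage, Set.mem_pi, Finset.mem_coe, Set.mem_prod, Finset.mem_erase]
      constructor
      · intro h
        refine ⟨fun i hi => by simpa [hi.1] using h i hi.2, by simpa using h k hk⟩
      · rintro ⟨h1, h2⟩ i hi
        by_cases hik : i = k
        · subst hik; simpa using h2
        · simpa [hik] using h1 i ⟨hik, hi⟩
    rw [this, Measure.prod_prod, Measure.infinitePi_pi _ (fun i _ => ht i), mul_comm,
      Finset.mul_prod_erase s (fun i => κ (t i)) hk]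
  · have : (fun y : (ℕ → X) × X => Function.update y.1 k y.2) ⁻¹' ((s : Set ℕ).pi t) =
        ((s : Set ℕ).pi t) ×ˢ Set.univ := by
      ext ⟨w, x⟩
      simp only [Set.mem_preimage, Set.mem_pi, Finset.mem_coe, Set.mem_prod, Set.mem_univ, and_true]
      refine forall₂_congr fun i hi => ?_
      rw [Function.update_of_ne (by rintro rfl; exact hk hi)]
    rw [this, Measure.prod_prod, Measure.infinitePi_pi _ (fun i _ => ht i), measure_univ, mul_one]

lemma measurable_update_pair (k : ℕ) :
    Measurable fun y : (ℕ → X) × X => Function.update y.1 k y.2 := by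
  rw [measurable_pi_iff]
  intro i
  by_cases h : i = k
  · subst h; simpa using measurable_snd
  · simp only [Function.update_of_ne h]; fun_prop

/-- Resampling one coordinate of an i.i.d. sequence. -/
lemma lintegral_infinitePi_update (k : ℕ) {f : (ℕ → X) → ENNReal} (hf : Measurable f) :
    ∫⁻ w, f w ∂(Measure.infinitePi fun _ : ℕ => κ) =
      ∫⁻ w, ∫⁻ x, f (Function.update w k x) ∂κ ∂(Measure.infinitePi fun _ : ℕ => κ) := by
  have hm := measurable_update_pair (X := X) k
  conv_lhs => rw [← infinitePi_map_update κ k, lintegral_map hf hm]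
  exact lintegral_prod _ (hf.comp hm).aemeasurable

variable {Y : Type*} [MeasurableSpace Y] (η : Measure Y) [IsProbabilityMeasure η]

/-- Both sequences are refreshed at the same index because a round of the embedding reads its own
row of coins and its own initial vector, besides the outcome of the earlier rounds. -/
lemma lintegral_prod_infinitePi_update (k : ℕ) {f : (ℕ → X) × (ℕ → Y) → ENNReal}
    (hf : Measurable f) :
    ∫⁻ w, f w ∂((Measure.infinitePi fun _ : ℕ => κ).prod (Measure.infinitePi fun _ : ℕ => η)) =
      ∫⁻ w, ∫⁻ x, ∫⁻ y, f (Function.update w.1 k x, Function.update w.2 k y) ∂η ∂κ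
        ∂((Measure.infinitePi fun _ : ℕ => κ).prod (Measure.infinitePi fun _ : ℕ => η)) := by
  have hX := measurable_update_pair (X := X) k
  have hY := measurable_update_pair (X := Y) k
  have h1 : Measurable fun q : ((ℕ → X) × (ℕ → Y)) × X × Y =>
      f (Function.update q.1.1 k q.2.1, Function.update q.1.2 k q.2.2) :=
    hf.comp ((hX.comp (by fun_prop : Measurable fun q : ((ℕ → X) × (ℕ → Y)) × X × Y =>
      (q.1.1, q.2.1))).prodMk (hY.comp (by fun_prop : Measurable
        fun q : ((ℕ → X) × (ℕ → Y)) × X × Y => (q.1.2, q.2.2))))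
  have h2 : Measurable fun q : ((ℕ → X) × (ℕ → Y)) × X => ∫⁻ y,
      f (Function.update q.1.1 k q.2, Function.update q.1.2 k y) ∂η :=
    Measurable.lintegral_prod_right' (f := fun r : (((ℕ → X) × (ℕ → Y)) × X) × Y =>
      f (Function.update r.1.1.1 k r.1.2, Function.update r.1.1.2 k r.2))
      (h1.comp (by fun_prop : Measurable fun r : (((ℕ → X) × (ℕ → Y)) × X) × Y =>
        (r.1.1, r.1.2, r.2)))
  have h3 : Measurable fun q : (ℕ → X) × (ℕ → Y) => ∫⁻ x, ∫⁻ y,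
      f (Function.update q.1 k x, Function.update q.2 k y) ∂η ∂κ := h2.lintegral_prod_right'
  have hR : Measurable fun w : ℕ → X => ∫⁻ v, f (w, v) ∂Measure.infinitePi fun _ : ℕ => η :=
    hf.lintegral_prod_right'
  rw [lintegral_prod _ hf.aemeasurable, lintegral_prod _ h3.aemeasurable,
    lintegral_infinitePi_update κ k hR]
  refine lintegral_congr fun w => ?_
  have h4 : Measurable fun q : (ℕ → Y) × X => ∫⁻ y,
      f (Function.update w k q.2, Function.update q.1 k y) ∂η :=
    h2.comp (by fun_prop : Measurable fun q : (ℕ → Y) × X => ((w, q.1), q.2))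
  refine Eq.trans ?_ (lintegral_lintegral_swap h4.aemeasurable).symm
  refine lintegral_congr fun x => ?_
  exact lintegral_infinitePi_update η k (hf.comp measurable_prodMk_left)

end Resample

/-! ### Indicators as test functions. -/

section Indicator

variable {α β : Type*} [MeasurableSpace α] [MeasurableSpace β]

lemma lintegral_indicator_one_comp (μ : Measure α) {S : Set β} (hS : MeasurableSet S) {g : α → β}
    (hg : Measurable g) : ∫⁻ x, S.indicator (1 : β → ENNReal) (g x) ∂μ = μ (g ⁻¹' S) := by
  rw [← lintegral_map (measurable_one.indicator hS) hg, lintegral_indicator_one hS,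
    Measure.map_apply hg hS]

omit [MeasurableSpace α] in
lemma indicator_one_congr {S : Set α} {x y : α} (h : x ∈ S ↔ y ∈ S) :
    S.indicator (1 : α → ENNReal) x = S.indicator 1 y := by
  by_cases hx : x ∈ S
  · rw [Set.indicator_of_mem hx, Set.indicator_of_mem (h.1 hx), Pi.one_apply, Pi.one_apply]
  · rw [Set.indicator_of_notMem hx, Set.indicator_of_notMem fun hy => hx (h.2 hy)]

end Indicator

/-! ### Whole rounds, and the exact law of the embedding. -/

section Chain

variable {d : ℕ}

/-- The successive vectors obtained from `u` by adjusting its coordinates along `v 0, v 1, …`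
according to the edge indicators `h 0, h 1, …`. -/
def chain (d : ℕ) (p : ℝ) (v : ℕ → EuclideanSpace ℝ (Fin d)) (h : ℕ → Prop)
    (u : EuclideanSpace ℝ (Fin d)) : ℕ → EuclideanSpace ℝ (Fin d)
  | 0 => u
  | k + 1 => step d p (h k) (v k) (chain d p v h u k)

lemma chain_congr {p : ℝ} {v v' : ℕ → EuclideanSpace ℝ (Fin d)} {h h' : ℕ → Prop}
    {u : EuclideanSpace ℝ (Fin d)} {m : ℕ} (hv : ∀ k < m, v k = v' k) (hh : ∀ k < m, h k = h' k) :
    chain d p v h u m = chain d p v' h' u m := by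
  induction m with
  | zero => rfl
  | succ m ih =>
    simp only [chain]
    rw [ih (fun k hk => hv k (by omega)) (fun k hk => hh k (by omega)), hv m (by omega),
      hh m (by omega)]

/-- The vectors placed after `i` rounds, from edge indicators `M` and initial vectors `u`. -/
def embed (d : ℕ) (p : ℝ) (M : ℕ → ℕ → Prop) (u : ℕ → EuclideanSpace ℝ (Fin d)) :
    ℕ → ℕ → EuclideanSpace ℝ (Fin d)
  | 0 => fun _ => 0
  | i + 1 => Function.update (embed d p M u i) i (chain d p (embed d p M u i) (M i) (u i) i)

lemma embed_apply_eq {p : ℝ} {M : ℕ → ℕ → Prop} {u : ℕ → EuclideanSpace ℝ (Fin d)} {i j k : ℕ}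
    (hk : k < i) (hij : i ≤ j) : embed d p M u j k = embed d p M u i k := by
  induction j, hij using Nat.le_induction with
  | base => rfl
  | succ j hj ih => rw [embed, Function.update_of_ne (by omega), ih]

lemma embed_congr {p : ℝ} {M M' : ℕ → ℕ → Prop} {u u' : ℕ → EuclideanSpace ℝ (Fin d)} {i : ℕ}
    (hM : ∀ k < i, M k = M' k) (hu : ∀ k < i, u k = u' k) :
    embed d p M u i = embed d p M' u' i := by
  induction i with
  | zero => rfl
  | succ i ih =>
    simp only [embed]
    rw [ih (fun k hk => hM k (by omega)) (fun k hk => hu k (by omega)), hM i (by omega),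
      hu i (by omega)]

variable [hd : Fact (2 ≤ d)]

lemma measurable_chain (p : ℝ) (m : ℕ) :
    Measurable fun y : (ℕ → EuclideanSpace ℝ (Fin d)) × (ℕ → Prop) × EuclideanSpace ℝ (Fin d) =>
      chain d p y.1 y.2.1 y.2.2 m := by
  induction m with
  | zero => simp only [chain]; fun_prop
  | succ m ih => exact measurable_step (by fun_prop) (by fun_prop) ih

lemma measurable_embed (p : ℝ) (i : ℕ) :
    Measurable fun y : (ℕ → ℕ → Prop) × (ℕ → EuclideanSpace ℝ (Fin d)) =>
      embed d p y.1 y.2 i := by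
  induction i with
  | zero => simp only [embed]; fun_prop
  | succ i ih =>
    exact (measurable_update_pair i).comp (ih.prodMk ((measurable_chain p i).comp
      (ih.prodMk ((by fun_prop : Measurable
        fun y : (ℕ → ℕ → Prop) × (ℕ → EuclideanSpace ℝ (Fin d)) => (y.1 i, y.2 i))))))

/-- The law of an i.i.d. sequence of coins. -/
abbrev coins (p : unitInterval) : Measure (ℕ → Prop) := Measure.infinitePi fun _ : ℕ => coin p

/-- The law of an i.i.d. sequence of uniform unit vectors. -/
abbrev unifSeq (d : ℕ) [Fact (2 ≤ d)] : Measure (ℕ → EuclideanSpace ℝ (Fin d)) :=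
  Measure.infinitePi fun _ : ℕ => unifSphere d

variable {p : unitInterval}

/-- The placed vectors are frozen. The last coin is invisible to the earlier steps, so it can be
averaged into the test function; the induction hypothesis makes the current vector uniform, and
`coin_prod_map_step` removes the last step. -/
lemma lintegral_chain (hp0 : (0 : ℝ) < p) (hp1 : (p : ℝ) < 1)
    {v : ℕ → EuclideanSpace ℝ (Fin d)} {m : ℕ} (hv : ∀ k < m, ‖v k‖ = 1)
    {f : EuclideanSpace ℝ (Fin d) → ENNReal} (hf : Measurable f) :
    ∫⁻ h, ∫⁻ u, f (chain d p v h u m) ∂unifSphere d ∂coins p = ∫⁻ u, f u ∂unifSphere d := by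
  induction m generalizing f with
  | zero => simp [chain]
  | succ m ih =>
    have hc : ∀ m, Measurable fun y : (ℕ → Prop) × EuclideanSpace ℝ (Fin d) =>
        f (chain d p v y.1 y.2 m) := fun m =>
      hf.comp ((measurable_chain (d := d) p m).comp measurable_prodMk_left)
    have hs : Measurable fun y : EuclideanSpace ℝ (Fin d) × Prop => f (step d p y.2 (v m) y.1) :=
      hf.comp (measurable_step (by fun_prop) (by fun_prop) (by fun_prop))
    rw [lintegral_infinitePi_update (coin p) m (hc (m + 1)).lintegral_prod_right']
    have h1 : ∀ h : ℕ → Prop, ∀ b u, chain d p v (Function.update h m b) u (m + 1) =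
        step d p b (v m) (chain d p v h u m) := fun h b u => by
      rw [chain, Function.update_self]
      congr 1
      exact chain_congr (fun _ _ => rfl) fun k hk => Function.update_of_ne hk.ne _ _
    simp only [h1]
    have h2 : ∀ h : ℕ → Prop, ∫⁻ b, ∫⁻ u, f (step d p b (v m) (chain d p v h u m))
        ∂unifSphere d ∂coin p = ∫⁻ u, (fun u' => ∫⁻ b, f (step d p b (v m) u') ∂coin p)
          (chain d p v h u m) ∂unifSphere d := fun h => by
      rw [lintegral_lintegral_swap]
      refine (hf.comp (measurable_step measurable_fst measurable_const ?_)).aemeasurable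
      exact ((measurable_chain (d := d) p m).comp
        (by fun_prop : Measurable fun y : EuclideanSpace ℝ (Fin d) => (v, h, y))).comp measurable_snd
    rw [lintegral_congr h2, ih (fun k hk => hv k (by omega)) hs.lintegral_prod_right']
    rw [lintegral_lintegral_swap hs.aemeasurable, lintegral_lintegral (f := fun b u =>
      f (step d p b (v m) u)) (hs.comp measurable_swap).aemeasurable]
    have h3 := coin_prod_map_step hp0 hp1 (hv m (by omega))
    conv_rhs => rw [← h3, lintegral_map hf (measurable_step (by fun_prop) (by fun_prop)
      (by fun_prop))]

lemma unifSeq_ae_norm : ∀ᵐ v ∂unifSeq d, ∀ k, ‖v k‖ = 1 := by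
  rw [ae_all_iff]
  intro k
  filter_upwards [(measurePreserving_eval_infinitePi (fun _ : ℕ => unifSphere d)
    k).quasiMeasurePreserving.ae (unifSphere_ae_norm d)] with v hv using hv

/-- The invariance at stage `i` is a hypothesis because the induction in `lintegral_embed` needs the
unit norms at stage i to pass to stage i + 1. -/
lemma ae_norm_embed_of_lintegral_eq {i : ℕ}
    (ih : ∀ f : (ℕ → EuclideanSpace ℝ (Fin d)) → ENNReal, Measurable f →
      (∀ v v', (∀ k < i, v k = v' k) → f v = f v') →
      ∫⁻ y, f (embed d p y.1 y.2 i)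
        ∂((Measure.infinitePi fun _ : ℕ => coins p).prod (unifSeq d)) = ∫⁻ v, f v ∂unifSeq d) :
    ∀ᵐ y ∂((Measure.infinitePi fun _ : ℕ => coins p).prod (unifSeq d)),
        ∀ k < i, ‖embed d p y.1 y.2 i k‖ = 1 := by
  set S : Set (ℕ → EuclideanSpace ℝ (Fin d)) := {v | ∀ k < i, ‖v k‖ = 1}ᶜ with hSdef
  have hS : MeasurableSet S := by
    simp only [hSdef, Set.ofPred_forall]
    exact (MeasurableSet.iInter fun k => MeasurableSet.iInter fun _ =>
      measurableSet_eq_fun (by fun_prop) (by fun_prop)).compl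
  have h1 := ih (S.indicator 1) (measurable_one.indicator hS) (by
    intro v v' h
    exact indicator_one_congr (not_congr (forall₂_congr fun k hk => by rw [h k hk])))
  have h2 : unifSeq d S = 0 := by
    have h3 : Sᶜ ∈ ae (unifSeq d) := by
      filter_upwards [unifSeq_ae_norm (d := d)] with v hv
      rw [hSdef, compl_compl]
      exact fun k _ => hv k
    rwa [mem_ae_iff, compl_compl] at h3
  rw [lintegral_indicator_one hS, h2,
    lintegral_indicator_one_comp _ hS (measurable_embed (p : ℝ) i)] at h1
  rw [ae_iff]
  exact h1

/-- Refreshing round i makes the new vector uniform whatever the earlier ones are, so it can be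
exchanged for an independent uniform vector. The test function may look only at the first i entries,
since the others are not yet placed. -/
lemma lintegral_embed (hp0 : (0 : ℝ) < p) (hp1 : (p : ℝ) < 1) {i : ℕ}
    {f : (ℕ → EuclideanSpace ℝ (Fin d)) → ENNReal} (hf : Measurable f)
    (hfi : ∀ v v', (∀ k < i, v k = v' k) → f v = f v') :
    ∫⁻ y, f (embed d p y.1 y.2 i)
      ∂((Measure.infinitePi fun _ : ℕ => coins p).prod (unifSeq d)) = ∫⁻ v, f v ∂unifSeq d := by
  induction i generalizing f with
  | zero =>
    have : ∀ v, f v = f 0 := fun v => hfi _ _ (by simp)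
    simp [this]
  | succ i ih =>
    have hcond := ae_norm_embed_of_lintegral_eq (fun _ hf hfi => ih hf hfi)
    rw [lintegral_prod_infinitePi_update (coins p) (unifSphere d) i
      (f := fun y => f (embed d p y.1 y.2 (i + 1))) (hf.comp (measurable_embed _ _))]
    have hup : ∀ (M : ℕ → ℕ → Prop) (u : ℕ → EuclideanSpace ℝ (Fin d)) r s,
        embed d p (Function.update M i r) (Function.update u i s) (i + 1) =
          Function.update (embed d p M u i) i (chain d p (embed d p M u i) r s i) := by
      intro M u r s
      rw [embed, Function.update_self, Function.update_self,
        embed_congr (fun k hk => Function.update_of_ne hk.ne _ _)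
          (fun k hk => Function.update_of_ne hk.ne _ _)]
    have hinner : (fun y : (ℕ → ℕ → Prop) × (ℕ → EuclideanSpace ℝ (Fin d)) =>
        ∫⁻ r, ∫⁻ s, f (embed d p (Function.update y.1 i r) (Function.update y.2 i s) (i + 1))
          ∂unifSphere d ∂coins p) =ᵐ[(Measure.infinitePi fun _ : ℕ => coins p).prod (unifSeq d)]
        fun y => ∫⁻ x, f (Function.update (embed d p y.1 y.2 i) i x) ∂unifSphere d := by
      filter_upwards [hcond] with y hy
      simp only [hup]
      exact lintegral_chain hp0 hp1 hy (f := fun x => f (Function.update _ i x))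
        (hf.comp ((measurable_update_pair i).comp measurable_prodMk_left))
    rw [lintegral_congr_ae hinner]
    have h5 := ih (f := fun v => ∫⁻ x, f (Function.update v i x) ∂unifSphere d)
      (hf.comp (measurable_update_pair i)).lintegral_prod_right' (by
        intro v v' h
        refine lintegral_congr fun x => hfi _ _ fun k hk => ?_
        by_cases hki : k = i
        · subst hki; simp
        · rw [Function.update_of_ne hki, Function.update_of_ne hki, h k (by omega)])
    rw [h5, ← lintegral_infinitePi_update (unifSphere d) i hf]

/-- Events of a single round are transferred to a simpler space, where the earlier vectors are
i.i.d. uniform and independent of fresh coins and a fresh initial vector. The error estimates are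
made there. -/
lemma measure_embed_row (hp0 : (0 : ℝ) < p) (hp1 : (p : ℝ) < 1) (i : ℕ)
    {S : Set ((ℕ → EuclideanSpace ℝ (Fin d)) × (ℕ → Prop) × EuclideanSpace ℝ (Fin d))}
    (hS : MeasurableSet S)
    (hSi : ∀ v v' r, (∀ k < i, v k = v' k) → ((v, r) ∈ S ↔ (v', r) ∈ S)) :
    ((Measure.infinitePi fun _ : ℕ => coins p).prod (unifSeq d))
        {y | (embed d p y.1 y.2 i, y.1 i, y.2 i) ∈ S} =
      ((unifSeq d).prod ((coins p).prod (unifSphere d))) S := by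
  have hm : Measurable fun y : (ℕ → ℕ → Prop) × (ℕ → EuclideanSpace ℝ (Fin d)) =>
      (embed d (p : ℝ) y.1 y.2 i, y.1 i, y.2 i) :=
    (measurable_embed _ _).prodMk (by fun_prop)
  have h1 : Measurable (S.indicator (1 : _ × _ × _ → ENNReal)) := measurable_one.indicator hS
  have h2 : Measurable fun v : ℕ → EuclideanSpace ℝ (Fin d) => ∫⁻ r, ∫⁻ s,
      S.indicator (1 : _ × _ × _ → ENNReal) (v, r, s) ∂unifSphere d ∂coins p := by
    refine Measurable.lintegral_prod_right' (f := fun q : (ℕ → EuclideanSpace ℝ (Fin d)) ×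
      (ℕ → Prop) => ∫⁻ s, S.indicator (1 : _ × _ × _ → ENNReal) (q.1, q.2, s) ∂unifSphere d) ?_
    exact Measurable.lintegral_prod_right' (f := fun q : ((ℕ → EuclideanSpace ℝ (Fin d)) ×
      (ℕ → Prop)) × EuclideanSpace ℝ (Fin d) => S.indicator (1 : _ × _ × _ → ENNReal) (q.1.1, q.1.2, q.2))
      (h1.comp (by fun_prop))
  have h3 := lintegral_indicator_one_comp
    ((Measure.infinitePi fun _ : ℕ => coins p).prod (unifSeq d)) hS hm
  refine h3.symm.trans ?_
  rw [lintegral_prod_infinitePi_update (coins p) (unifSphere d) i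
    (f := fun y => S.indicator 1 (embed d (p : ℝ) y.1 y.2 i, y.1 i, y.2 i))
    (h1.comp hm)]
  have h5 : ∀ (M : ℕ → ℕ → Prop) (u : ℕ → EuclideanSpace ℝ (Fin d)) r s,
      embed d p (Function.update M i r) (Function.update u i s) i = embed d p M u i :=
    fun M u r s => embed_congr (fun k hk => Function.update_of_ne hk.ne _ _)
      (fun k hk => Function.update_of_ne hk.ne _ _)
  simp only [h5, Function.update_self]
  rw [lintegral_embed hp0 hp1 h2]
  · rw [← lintegral_indicator_one hS, lintegral_prod _ h1.aemeasurable]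
    refine lintegral_congr fun v => ?_
    exact (lintegral_prod _ (h1.comp measurable_prodMk_left).aemeasurable).symm
  · intro v v' h
    refine lintegral_congr fun r => lintegral_congr fun s => ?_
    exact indicator_one_congr (hSi v v' (r, s) h)

lemma embed_map_eq_pi (hp0 : (0 : ℝ) < p) (hp1 : (p : ℝ) < 1) (n : ℕ) :
    ((Measure.infinitePi fun _ : ℕ => coins p).prod (unifSeq d)).map
      (fun y (i : Fin n) => embed d p y.1 y.2 n i) = Measure.pi fun _ : Fin n => unifSphere d := by
  have hm : Measurable fun y : (ℕ → ℕ → Prop) × (ℕ → EuclideanSpace ℝ (Fin d)) =>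
      fun i : Fin n => embed d (p : ℝ) y.1 y.2 n i :=
    measurable_pi_iff.2 fun i => (measurable_pi_apply _).comp (measurable_embed _ _)
  refine (Measure.pi_eq fun s hs => ?_).symm
  -- Positions from n on carry no constraint.
  set T : ℕ → Set (EuclideanSpace ℝ (Fin d)) := fun k => if h : k < n then s ⟨k, h⟩ else Set.univ
    with hT
  have hTm : ∀ k, MeasurableSet (T k) := fun k => by
    simp only [hT]; split_ifs
    · exact hs _
    · exact MeasurableSet.univ
  set B : Set (ℕ → EuclideanSpace ℝ (Fin d)) := (Finset.range n : Set ℕ).pi T with hB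
  have hBm : MeasurableSet B := MeasurableSet.pi (Finset.countable_toSet _) fun i _ => hTm i
  have hpre : (fun y : (ℕ → ℕ → Prop) × (ℕ → EuclideanSpace ℝ (Fin d)) =>
      fun i : Fin n => embed d (p : ℝ) y.1 y.2 n i) ⁻¹' Set.univ.pi s =
      {y | embed d (p : ℝ) y.1 y.2 n ∈ B} := by
    ext y
    simp only [Set.mem_preimage, Set.mem_pi, Set.mem_univ, true_imp_iff, Set.mem_ofPred_eq, hB,
      Finset.coe_range, Set.mem_Iio, hT]
    constructor
    · intro h k hk; rw [dif_pos hk]; exact h ⟨k, hk⟩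
    · intro h i; simpa using h i i.2
  have h1 := lintegral_embed (d := d) hp0 hp1 (i := n) (f := B.indicator 1)
    (measurable_one.indicator hBm) (by
      intro v v' h
      exact indicator_one_congr (forall₂_congr fun k hk => by
        rw [h k (by simpa using hk)]))
  rw [lintegral_indicator_one hBm, Measure.infinitePi_pi _ (fun i _ => hTm i),
    lintegral_indicator_one_comp _ hBm (measurable_embed (p : ℝ) n)] at h1
  rw [Measure.map_apply hm (MeasurableSet.univ_pi hs), hpre]
  refine h1.trans ?_
  rw [Finset.prod_range]
  simp [hT]

end Chain

/-! ### Gaussian tail of one coordinate. -/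

section Tail

lemma integral_exp_mul_sq_gaussianReal {a : ℝ} (ha : a < 1 / 2) :
    ∫ x, Real.exp (a * x ^ 2) ∂gaussianReal 0 1 = (√(1 - 2 * a))⁻¹ := by
  rw [integral_gaussianReal_eq_integral_smul one_ne_zero]
  have h1 : ∀ x : ℝ, gaussianPDFReal 0 1 x • Real.exp (a * x ^ 2) =
      (√(2 * Real.pi))⁻¹ * Real.exp (-(1 / 2 - a) * x ^ 2) := fun x => by
    rw [gaussianPDFReal, smul_eq_mul, mul_assoc, ← Real.exp_add]
    simp only [NNReal.coe_one, mul_one, sub_zero]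
    congr 2
    ring
  simp_rw [h1]
  rw [integral_const_mul, integral_gaussian, ← Real.sqrt_inv, ← Real.sqrt_inv,
    ← Real.sqrt_mul (by positivity)]
  congr 1
  have : 1 - 2 * a ≠ 0 := by linarith
  have : 1 / 2 - a ≠ 0 := by linarith
  field_simp

/-- A non-integrable function has integral 0 by convention, but the integral was computed to be
positive. -/
lemma integrable_exp_mul_sq_gaussianReal {a : ℝ} (ha : a < 1 / 2) :
    Integrable (fun x => Real.exp (a * x ^ 2)) (gaussianReal 0 1) := by
  by_contra h
  have h1 := integral_exp_mul_sq_gaussianReal ha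
  rw [integral_undef h] at h1
  have : 0 < (√(1 - 2 * a))⁻¹ := inv_pos.2 (Real.sqrt_pos.2 (by linarith))
  linarith

/-- Exponential Markov inequality for (x₀² - s² Σ xᵢ²) / 4, whose exponential splits over the
coordinates. The first one contributes at most 2 and each of the other m at most exp(-s² / 8). -/
lemma pi_gaussianReal_cone_le {m : ℕ} {s : ℝ} (hs1 : s ≤ 1) (hs0 : 0 ≤ s) :
    (Measure.pi fun _ : Fin (m + 1) => gaussianReal 0 1)
      {x | s ^ 2 * ∑ i, x i ^ 2 < x 0 ^ 2} ≤ ENNReal.ofReal (2 * Real.exp (-(s ^ 2 * m / 8))) := by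
  set c : Fin (m + 1) → ℝ := Fin.cons ((1 - s ^ 2) / 4) fun _ => -(s ^ 2 / 4) with hc
  have hs2 : s ^ 2 ≤ 1 := by nlinarith
  have hs20 : 0 ≤ s ^ 2 := sq_nonneg s
  have hclt : ∀ i, c i < 1 / 2 := by
    intro i
    refine Fin.cases ?_ (fun i => ?_) i
    · simp only [hc, Fin.cons_zero]; linarith
    · simp only [hc, Fin.cons_succ]; linarith
  set P := Measure.pi fun _ : Fin (m + 1) => gaussianReal 0 1
  have hint : Integrable (fun x : Fin (m + 1) → ℝ => ∏ i, Real.exp (c i * x i ^ 2)) P :=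
    Integrable.fintype_prod fun i => integrable_exp_mul_sq_gaussianReal (hclt i)
  have hexp : ∀ x : Fin (m + 1) → ℝ, ∏ i, Real.exp (c i * x i ^ 2) =
      Real.exp (1 / 4 * (x 0 ^ 2 - s ^ 2 * ∑ i, x i ^ 2)) := fun x => by
    rw [← Real.exp_sum]
    congr 1
    rw [Fin.sum_univ_succ, Fin.sum_univ_succ]
    simp only [hc, Fin.cons_zero, Fin.cons_succ]
    rw [← Finset.mul_sum]
    ring
  have hle : P {x | s ^ 2 * ∑ i, x i ^ 2 < x 0 ^ 2} ≤
      ∫⁻ x, ENNReal.ofReal (∏ i, Real.exp (c i * x i ^ 2)) ∂P := by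
    have hS : MeasurableSet {x : Fin (m + 1) → ℝ | s ^ 2 * ∑ i, x i ^ 2 < x 0 ^ 2} :=
      measurableSet_lt (by fun_prop) (by fun_prop)
    rw [← lintegral_indicator_one hS]
    refine lintegral_mono fun x => ?_
    by_cases hx : x ∈ {x : Fin (m + 1) → ℝ | s ^ 2 * ∑ i, x i ^ 2 < x 0 ^ 2}
    · rw [Set.indicator_of_mem hx, Pi.one_apply, ← ENNReal.ofReal_one, hexp]
      refine ENNReal.ofReal_le_ofReal (Real.one_le_exp ?_)
      have : s ^ 2 * ∑ i, x i ^ 2 < x 0 ^ 2 := hx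
      linarith
    · rw [Set.indicator_of_notMem hx]; exact zero_le
  refine hle.trans ?_
  rw [← ofReal_integral_eq_lintegral_ofReal hint
    (Filter.Eventually.of_forall fun x => Finset.prod_nonneg fun i _ => (Real.exp_pos _).le),
    integral_fintype_prod_eq_prod (fun i (x : ℝ) => Real.exp (c i * x ^ 2))]
  refine ENNReal.ofReal_le_ofReal ?_
  simp_rw [integral_exp_mul_sq_gaussianReal (hclt _)]
  rw [Fin.prod_univ_succ]
  simp only [hc, Fin.cons_zero, Fin.cons_succ, Finset.prod_const, Finset.card_univ,
    Fintype.card_fin]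
  have h1 : (√(1 - 2 * ((1 - s ^ 2) / 4)))⁻¹ ≤ 2 := by
    rw [inv_le_comm₀ (Real.sqrt_pos.2 (by linarith)) (by norm_num)]
    exact Real.le_sqrt_of_sq_le (by linarith)
  -- After squaring this is exp(s² / 4) ≤ 1 + s² / 2, which follows through 1 / (1 - s² / 4) since
  -- s² ≤ 1.
  have h2 : (√(1 - 2 * -(s ^ 2 / 4)))⁻¹ ≤ Real.exp (-(s ^ 2 / 8)) := by
    rw [Real.exp_neg]
    refine inv_anti₀ (Real.exp_pos _) (Real.le_sqrt_of_sq_le ?_)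
    rw [← Real.exp_nat_mul]
    have h3 : (1 + s ^ 2 / 4) * (1 - s ^ 2 / 4) * Real.exp (s ^ 2 / 4) ≤ 1 + s ^ 2 / 4 := by
      have h4 : (1 - s ^ 2 / 4) * Real.exp (s ^ 2 / 4) ≤ 1 := by
        have := Real.add_one_le_exp (-(s ^ 2 / 4))
        calc (1 - s ^ 2 / 4) * Real.exp (s ^ 2 / 4)
            ≤ Real.exp (-(s ^ 2 / 4)) * Real.exp (s ^ 2 / 4) := by gcongr; linarith
          _ = 1 := by rw [← Real.exp_add]; simp
      nlinarith
    have h5 : 0 < 1 - s ^ 2 / 4 := by linarith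
    have h6 : Real.exp (s ^ 2 / 4) ≤ 1 / (1 - s ^ 2 / 4) := by
      rw [le_div_iff₀ h5]; nlinarith
    have h7 : 1 / (1 - s ^ 2 / 4) ≤ 1 - 2 * -(s ^ 2 / 4) := by
      rw [div_le_iff₀ h5]; nlinarith
    push_cast
    rw [show 2 * (s ^ 2 / 8) = s ^ 2 / 4 by ring]
    exact h6.trans h7
  have h0 : 0 ≤ (√(1 - 2 * -(s ^ 2 / 4)))⁻¹ := by positivity
  calc (√(1 - 2 * ((1 - s ^ 2) / 4)))⁻¹ * (√(1 - 2 * -(s ^ 2 / 4)))⁻¹ ^ m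
      ≤ 2 * Real.exp (-(s ^ 2 / 8)) ^ m := by gcongr
    _ = 2 * Real.exp (-(s ^ 2 * m / 8)) := by
        rw [← Real.exp_nat_mul]; congr 2; ring

variable {d : ℕ} [hd : Fact (2 ≤ d)]

lemma sphereInnerLaw_tail {s : ℝ} (hs0 : 0 ≤ s) :
    sphereInnerLaw d {x | s < |x|} ≤ ENNReal.ofReal (2 * Real.exp (-(s ^ 2 * d / 16))) := by
  rcases lt_or_ge 1 s with hs1 | hs1
  · refine (measure_mono_null (fun x hx h => ?_)
      (ae_iff.1 (sphereInnerLaw_ae_mem_Ioo (d := d)))).trans_le zero_le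
    have : |x| < 1 := abs_lt.2 h
    have : s < |x| := hx
    linarith
  obtain ⟨m, rfl⟩ : ∃ m, d = m + 1 := ⟨d - 1, by have := hd.out; omega⟩
  have hm : (1 : ℝ) ≤ m := by
    have := hd.out
    exact_mod_cast (by omega : 1 ≤ m)
  set e : EuclideanSpace ℝ (Fin (m + 1)) := EuclideanSpace.single 0 1 with he
  have hS : MeasurableSet {x : ℝ | s < |x|} := measurableSet_lt measurable_const (by fun_prop)
  rw [← unifSphere_map_inner e (by simp [he]), ← stdGaussian_map_normalize,
    ← map_pi_eq_stdGaussian, Measure.map_map (by fun_prop) (by fun_prop),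
    Measure.map_map (by fun_prop) (by fun_prop), Measure.map_apply (by fun_prop) hS]
  refine (measure_mono fun x hx => ?_).trans
    ((pi_gaussianReal_cone_le (m := m) hs1 hs0).trans (ENNReal.ofReal_le_ofReal ?_))
  · simp only [Set.mem_preimage, Function.comp, Set.mem_ofPred_eq, he,
      EuclideanSpace.inner_single_right, one_mul, conj_trivial, PiLp.smul_apply,
      smul_eq_mul] at hx ⊢
    have hn : ‖(WithLp.toLp 2 x : EuclideanSpace ℝ (Fin (m + 1)))‖ ^ 2 = ∑ i, x i ^ 2 := by
      rw [EuclideanSpace.real_norm_sq_eq]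
    rw [← hn]
    set N := ‖(WithLp.toLp 2 x : EuclideanSpace ℝ (Fin (m + 1)))‖ with hN
    have hN0 : 0 < N := by
      rcases (norm_nonneg (WithLp.toLp 2 x : EuclideanSpace ℝ (Fin (m + 1)))).eq_or_lt with h | h
      · rw [hN, ← h] at hx; simp at hx; linarith
      · exact h
    rw [abs_mul, abs_inv, abs_of_pos hN0, ← div_eq_inv_mul, lt_div_iff₀ hN0] at hx
    rw [← mul_pow, ← sq_abs (x 0)]
    exact pow_lt_pow_left₀ hx (by positivity) two_ne_zero
  -- The bound m + 1 ≤ 2m turns the exponent m / 8 into d / 16.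
  · push_cast
    gcongr 2 * Real.exp ?_
    nlinarith [sq_nonneg s]

end Tail

/-! ### Laws and exponential moments within one round. -/

section ChainLaw

variable {d : ℕ} [hd : Fact (2 ≤ d)] {p : unitInterval}

/-- The joint law of the already placed vectors, of the edge indicators and of the initial vector
in one round of the embedding. -/
abbrev roundLaw (d : ℕ) [Fact (2 ≤ d)] (p : unitInterval) :
    Measure (((ℕ → EuclideanSpace ℝ (Fin d)) × (ℕ → Prop)) × EuclideanSpace ℝ (Fin d)) :=
  ((unifSeq d).prod (coins p)).prod (unifSphere d)

/-- The vector after `k` steps of a round. -/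
def roundVec (p : ℝ) (k : ℕ)
    (y : ((ℕ → EuclideanSpace ℝ (Fin d)) × (ℕ → Prop)) × EuclideanSpace ℝ (Fin d)) :
    EuclideanSpace ℝ (Fin d) := chain d p y.1.1 y.1.2 y.2 k

lemma measurable_roundVec (p : ℝ) (k : ℕ) : Measurable (roundVec (d := d) p k) :=
  (measurable_chain p k).comp (by fun_prop : Measurable
    fun y : ((ℕ → EuclideanSpace ℝ (Fin d)) × (ℕ → Prop)) × EuclideanSpace ℝ (Fin d) =>
      (y.1.1, y.1.2, y.2))

lemma lintegral_roundLaw_update (k : ℕ)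
    {f : ((ℕ → EuclideanSpace ℝ (Fin d)) × (ℕ → Prop)) × EuclideanSpace ℝ (Fin d) → ENNReal}
    (hf : Measurable f) :
    ∫⁻ y, f y ∂roundLaw d p = ∫⁻ y, ∫⁻ x, ∫⁻ b,
      f ((Function.update y.1.1 k x, Function.update y.1.2 k b), y.2)
        ∂coin p ∂unifSphere d ∂roundLaw d p := by
  have hX := measurable_update_pair (X := EuclideanSpace ℝ (Fin d)) k
  have hY := measurable_update_pair (X := Prop) k
  have h1 : Measurable fun q : ((((ℕ → EuclideanSpace ℝ (Fin d)) × (ℕ → Prop)) ×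
      EuclideanSpace ℝ (Fin d)) × EuclideanSpace ℝ (Fin d)) × Prop =>
      f ((Function.update q.1.1.1.1 k q.1.2, Function.update q.1.1.1.2 k q.2), q.1.1.2) := by
    refine hf.comp ((Measurable.prodMk ?_ ?_).prodMk (by fun_prop))
    · exact hX.comp (by fun_prop : Measurable fun q : ((((ℕ → EuclideanSpace ℝ (Fin d)) ×
        (ℕ → Prop)) × EuclideanSpace ℝ (Fin d)) × EuclideanSpace ℝ (Fin d)) × Prop =>
        (q.1.1.1.1, q.1.2))
    · exact hY.comp (by fun_prop : Measurable fun q : ((((ℕ → EuclideanSpace ℝ (Fin d)) ×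
        (ℕ → Prop)) × EuclideanSpace ℝ (Fin d)) × EuclideanSpace ℝ (Fin d)) × Prop =>
        (q.1.1.1.2, q.2))
  have h2 := h1.lintegral_prod_right' (ν := coin p)
  have h3 := h2.lintegral_prod_right' (ν := unifSphere d)
  rw [lintegral_prod_symm _ hf.aemeasurable, lintegral_prod_symm _ h3.aemeasurable]
  refine lintegral_congr fun u => ?_
  exact lintegral_prod_infinitePi_update (unifSphere d) (coin p) k (hf.comp measurable_prodMk_right)

lemma roundLaw_ae_norm_vec : ∀ᵐ y ∂roundLaw d p, ∀ k, ‖y.1.1 k‖ = 1 :=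
  Measure.quasiMeasurePreserving_fst.ae (p := fun y : (ℕ → EuclideanSpace ℝ (Fin d)) × (ℕ → Prop) =>
    ∀ k, ‖y.1 k‖ = 1) (Measure.quasiMeasurePreserving_fst.ae unifSeq_ae_norm)

/-- At every moment of a round the current vector is uniform and independent of all placed vectors,
even of those it has been adjusted to. Hence each of its inner products with a placed vector has the
law of one coordinate and a Gaussian tail. -/
lemma lintegral_roundVec (hp0 : (0 : ℝ) < p) (hp1 : (p : ℝ) < 1) (k : ℕ)
    {f : (ℕ → EuclideanSpace ℝ (Fin d)) × EuclideanSpace ℝ (Fin d) → ENNReal}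
    (hf : Measurable f) :
    ∫⁻ y, f (y.1.1, roundVec p k y) ∂roundLaw d p =
      ∫⁻ y, f y ∂(unifSeq d).prod (unifSphere d) := by
  have h1 : Measurable fun y : ((ℕ → EuclideanSpace ℝ (Fin d)) × (ℕ → Prop)) ×
      EuclideanSpace ℝ (Fin d) => f (y.1.1, roundVec p k y) :=
    hf.comp ((by fun_prop : Measurable fun y : ((ℕ → EuclideanSpace ℝ (Fin d)) × (ℕ → Prop)) ×
      EuclideanSpace ℝ (Fin d) => y.1.1).prodMk (measurable_roundVec _ _))
  rw [lintegral_prod _ h1.aemeasurable, lintegral_prod _ h1.lintegral_prod_right'.aemeasurable,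
    lintegral_prod _ hf.aemeasurable]
  refine lintegral_congr_ae ?_
  filter_upwards [unifSeq_ae_norm (d := d)] with v hv
  exact lintegral_chain hp0 hp1 (fun k _ => hv k) (hf.comp measurable_prodMk_left)

lemma unifSeq_prod_inner (j : ℕ) {f : ℝ → ENNReal} (hf : Measurable f) :
    ∫⁻ y, f (inner ℝ y.2 (y.1 j)) ∂(unifSeq d).prod (unifSphere d) =
      ∫⁻ x, f x ∂sphereInnerLaw d := by
  have h1 : Measurable fun y : (ℕ → EuclideanSpace ℝ (Fin d)) × EuclideanSpace ℝ (Fin d) =>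
      f (inner ℝ y.2 (y.1 j)) := hf.comp (by fun_prop)
  rw [lintegral_prod _ h1.aemeasurable]
  have h2 : ∀ᵐ v ∂unifSeq d, ∫⁻ u, f (inner ℝ u (v j)) ∂unifSphere d =
      ∫⁻ x, f x ∂sphereInnerLaw d := by
    filter_upwards [unifSeq_ae_norm (d := d)] with v hv
    rw [← unifSphere_map_inner _ (hv j), lintegral_map hf (by fun_prop)]
  rw [lintegral_congr_ae h2]
  simp

lemma roundVec_inner_law (hp0 : (0 : ℝ) < p) (hp1 : (p : ℝ) < 1) (k j : ℕ) {S : Set ℝ}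
    (hS : MeasurableSet S) :
    roundLaw d p {y | inner ℝ (roundVec p k y) (y.1.1 j) ∈ S} = sphereInnerLaw d S := by
  have hm : Measurable fun y : ((ℕ → EuclideanSpace ℝ (Fin d)) × (ℕ → Prop)) ×
      EuclideanSpace ℝ (Fin d) => (inner ℝ (roundVec p k y) (y.1.1 j) : ℝ) :=
    Measurable.inner (measurable_roundVec _ _) (by fun_prop)
  have h1 := lintegral_indicator_one_comp (roundLaw d p) hS hm
  have h2 := lintegral_roundVec (d := d) hp0 hp1 k
    (f := fun y => S.indicator 1 (inner ℝ y.2 (y.1 j) : ℝ))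
    ((measurable_one.indicator hS).comp (by fun_prop))
  rw [unifSeq_prod_inner j (measurable_one.indicator hS), lintegral_indicator_one hS] at h2
  exact h1.symm.trans h2

lemma roundVec_ae_norm (hp0 : (0 : ℝ) < p) (hp1 : (p : ℝ) < 1) (k : ℕ) :
    ∀ᵐ y ∂roundLaw d p, ‖roundVec p k y‖ = 1 := by
  have hS : MeasurableSet {u : EuclideanSpace ℝ (Fin d) | ‖u‖ = 1}ᶜ :=
    (measurableSet_eq_fun (by fun_prop) (by fun_prop)).compl
  have h1 := lintegral_indicator_one_comp (roundLaw d p) hS (measurable_roundVec (d := d) p k)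
  have h2 := lintegral_roundVec (d := d) hp0 hp1 k
    (f := fun y => Set.indicator {u : EuclideanSpace ℝ (Fin d) | ‖u‖ = 1}ᶜ 1 y.2)
    ((measurable_one.indicator hS).comp (by fun_prop))
  rw [lintegral_indicator_one_comp _ hS measurable_snd] at h2
  have h3 : ((unifSeq d).prod (unifSphere d)) (Prod.snd ⁻¹' {u | ‖u‖ = 1}ᶜ) = 0 :=
    Measure.quasiMeasurePreserving_snd.ae (unifSphere_ae_norm d)
  exact (h1.symm.trans h2).trans h3

lemma unifSeq_inner_law {j k : ℕ} (hjk : j ≠ k) {S : Set ℝ} (hS : MeasurableSet S) :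
    roundLaw d p {y | inner ℝ (y.1.1 k) (y.1.1 j) ∈ S} = sphereInnerLaw d S := by
  have hm : Measurable fun v : ℕ → EuclideanSpace ℝ (Fin d) => (inner ℝ (v k) (v j) : ℝ) := by
    fun_prop
  have h0 : roundLaw d p {y | inner ℝ (y.1.1 k) (y.1.1 j) ∈ S} =
      unifSeq d ((fun v => (inner ℝ (v k) (v j) : ℝ)) ⁻¹' S) := by
    have h1 : MeasurePreserving (fun y : ((ℕ → EuclideanSpace ℝ (Fin d)) × (ℕ → Prop)) ×
        EuclideanSpace ℝ (Fin d) => y.1.1) (roundLaw d p) (unifSeq d) :=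
      measurePreserving_fst.comp measurePreserving_fst
    exact h1.measure_preimage (hm hS).nullMeasurableSet
  rw [h0, ← lintegral_indicator_one_comp _ hS hm, lintegral_infinitePi_update (unifSphere d) k
    (f := fun v => S.indicator 1 (inner ℝ (v k) (v j) : ℝ)) ((measurable_one.indicator hS).comp hm)]
  have h2 : ∀ᵐ v ∂unifSeq d, ∫⁻ x, S.indicator (1 : ℝ → ENNReal) (inner ℝ (Function.update v k x k)
      (Function.update v k x j)) ∂unifSphere d = sphereInnerLaw d S := by
    filter_upwards [unifSeq_ae_norm (d := d)] with v hv
    simp only [Function.update_self, Function.update_of_ne hjk]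
    rw [lintegral_indicator_one_comp _ hS (by fun_prop), ← unifSphere_map_inner _ (hv j),
      Measure.map_apply (by fun_prop) hS]
  rw [lintegral_congr_ae h2]
  simp

/-- Exponential moments along a round: a product of factors, each of conditional mean at most `c`,
has mean at most the product of the bounds. -/
lemma lintegral_prod_round_le (hp0 : (0 : ℝ) < p) (hp1 : (p : ℝ) < 1) (j m : ℕ)
    {G : Prop → EuclideanSpace ℝ (Fin d) → EuclideanSpace ℝ (Fin d) →
      EuclideanSpace ℝ (Fin d) → ENNReal}
    (hGm : Measurable fun q : Prop × EuclideanSpace ℝ (Fin d) × EuclideanSpace ℝ (Fin d) ×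
      EuclideanSpace ℝ (Fin d) => G q.1 q.2.1 q.2.2.1 q.2.2.2) {c : ENNReal}
    (hG : ∀ u w, ‖u‖ = 1 → ∫⁻ x, ∫⁻ b, G b x u w ∂coin p ∂unifSphere d ≤ c) :
    ∫⁻ y, ∏ k ∈ Finset.Ico (j + 1) m, G (y.1.2 k) (y.1.1 k) (roundVec p k y) (y.1.1 j)
      ∂roundLaw d p ≤ c ^ (m - (j + 1)) := by
  rcases le_total m (j + 1) with hm | hm
  · simp [Finset.Ico_eq_empty_of_le hm, Nat.sub_eq_zero_of_le hm]
  have hGk : ∀ k, Measurable fun y : ((ℕ → EuclideanSpace ℝ (Fin d)) × (ℕ → Prop)) ×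
      EuclideanSpace ℝ (Fin d) => G (y.1.2 k) (y.1.1 k) (roundVec p k y) (y.1.1 j) := fun k =>
    hGm.comp ((by fun_prop : Measurable fun y : ((ℕ → EuclideanSpace ℝ (Fin d)) × (ℕ → Prop)) ×
      EuclideanSpace ℝ (Fin d) => y.1.2 k).prodMk ((by fun_prop : Measurable
        fun y : ((ℕ → EuclideanSpace ℝ (Fin d)) × (ℕ → Prop)) × EuclideanSpace ℝ (Fin d) =>
          y.1.1 k).prodMk ((measurable_roundVec _ _).prodMk (by fun_prop))))
  induction m, hm using Nat.le_induction with
  | base => simp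
  | succ m hm ih =>
    have hP : ∀ m, Measurable fun y : ((ℕ → EuclideanSpace ℝ (Fin d)) × (ℕ → Prop)) ×
        EuclideanSpace ℝ (Fin d) => ∏ k ∈ Finset.Ico (j + 1) m,
          G (y.1.2 k) (y.1.1 k) (roundVec p k y) (y.1.1 j) := fun m =>
      Finset.measurable_prod _ fun k _ => hGk k
    -- Vector m and coin m are refreshed. The earlier factors, the current vector and vector j
    -- involve only smaller indices, so the last factor can be integrated first.
    rw [lintegral_roundLaw_update m (hP (m + 1))]
    have hchain : ∀ (y : ((ℕ → EuclideanSpace ℝ (Fin d)) × (ℕ → Prop)) ×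
        EuclideanSpace ℝ (Fin d)) x b, ∀ k ≤ m, roundVec p k
          ((Function.update y.1.1 m x, Function.update y.1.2 m b), y.2) = roundVec p k y :=
      fun y x b k hk => chain_congr (fun i hi => Function.update_of_ne (by omega) _ _)
        (fun i hi => Function.update_of_ne (by omega) _ _)
    have hfac : ∀ (y : ((ℕ → EuclideanSpace ℝ (Fin d)) × (ℕ → Prop)) ×
        EuclideanSpace ℝ (Fin d)) x b, (∏ k ∈ Finset.Ico (j + 1) (m + 1),
          G (Function.update y.1.2 m b k) (Function.update y.1.1 m x k) (roundVec p k
          ((Function.update y.1.1 m x, Function.update y.1.2 m b), y.2))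
            (Function.update y.1.1 m x j)) =
        (∏ k ∈ Finset.Ico (j + 1) m, G (y.1.2 k) (y.1.1 k) (roundVec p k y) (y.1.1 j)) *
          G b x (roundVec p m y) (y.1.1 j) := by
      intro y x b
      rw [Finset.prod_Ico_succ_top hm, Function.update_self, Function.update_self,
        hchain y x b m le_rfl, Function.update_of_ne (by omega : j ≠ m)]
      congr 1
      refine Finset.prod_congr rfl fun k hk => ?_
      have hk' := (Finset.mem_Ico.1 hk).2
      rw [Function.update_of_ne hk'.ne, Function.update_of_ne hk'.ne, hchain y x b k hk'.le]
    simp only [hfac]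
    calc _ ≤ ∫⁻ y, (∏ k ∈ Finset.Ico (j + 1) m,
            G (y.1.2 k) (y.1.1 k) (roundVec p k y) (y.1.1 j)) * c ∂roundLaw d p := by
          refine lintegral_mono_ae ?_
          filter_upwards [roundVec_ae_norm (d := d) hp0 hp1 m] with y hy
          have hb : ∀ x, Measurable fun b => G b x (roundVec p m y) (y.1.1 j) := fun x =>
            hGm.comp (by fun_prop : Measurable fun b => (b, x, roundVec (p : ℝ) m y, y.1.1 j))
          have hx : Measurable fun x => ∫⁻ b, G b x (roundVec p m y) (y.1.1 j) ∂coin p :=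
            Measurable.lintegral_prod_right' (f := fun q : EuclideanSpace ℝ (Fin d) × Prop =>
              G q.2 q.1 (roundVec p m y) (y.1.1 j)) (hGm.comp (by fun_prop : Measurable
                fun q : EuclideanSpace ℝ (Fin d) × Prop =>
                  (q.2, q.1, roundVec (p : ℝ) m y, y.1.1 j)))
          simp_rw [lintegral_const_mul _ (hb _)]
          rw [lintegral_const_mul _ hx]
          gcongr
          exact hG _ _ hy
      _ ≤ c ^ (m - (j + 1)) * c := by
          rw [lintegral_mul_const _ (hP m)]
          gcongr
      _ = c ^ (m + 1 - (j + 1)) := by rw [← pow_succ]; congr 1; omega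

end ChainLaw

/-! ### Drift, noise, and the displacement after step j. -/

section Concentration

variable {d : ℕ}

/-- The factor by which a step scales the current vector. -/
def stepRatio (d : ℕ) (p : ℝ) (h : Prop) (x : ℝ) : ℝ :=
  √((1 - newCoord d p h x ^ 2) / (1 - x ^ 2))

/-- The multiple of the already placed vector which a step adds. -/
def stepShift (d : ℕ) (p : ℝ) (h : Prop) (x : ℝ) : ℝ :=
  newCoord d p h x - stepRatio d p h x * x

lemma step_eq (p : ℝ) (h : Prop) (v u : EuclideanSpace ℝ (Fin d)) :
    step d p h v u = stepRatio d p h (inner ℝ u v) • u + stepShift d p h (inner ℝ u v) • v := rfl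

/-- The centred part of the change of the coordinate along `w` in a step. -/
def stepNoise (d : ℕ) (p : ℝ) (h : Prop) (v u w : EuclideanSpace ℝ (Fin d)) : ℝ :=
  stepShift d p h (inner ℝ u v) * (inner ℝ v w - inner ℝ u v * inner ℝ u w)

open Classical in
/-- The indicator that a step moves the vector. -/
def moveInd (d : ℕ) (p : ℝ) (h : Prop) (x : ℝ) : ℝ := if IsMoved d p h x then 1 else 0

lemma moveInd_nonneg (p : ℝ) (h : Prop) (x : ℝ) : 0 ≤ moveInd d p h x := by
  unfold moveInd; split_ifs <;> norm_num

lemma abs_sqrt_ratio_sub_one_le {s x t : ℝ} (hs : s ≤ 1 / 2) (hx : |x| ≤ s) (ht : |t| ≤ s) :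
    |√((1 - t ^ 2) / (1 - x ^ 2)) - 1| ≤ 2 * s ^ 2 := by
  have hs0 : 0 ≤ s := (abs_nonneg x).trans hx
  have hx2 : x ^ 2 ≤ s ^ 2 := sq_le_sq' (abs_le.1 hx).1 (abs_le.1 hx).2
  have ht2 : t ^ 2 ≤ s ^ 2 := sq_le_sq' (abs_le.1 ht).1 (abs_le.1 ht).2
  have hs2 : s ^ 2 ≤ 1 / 4 := by nlinarith
  have hxp : 0 < 1 - x ^ 2 := by linarith
  set r := (1 - t ^ 2) / (1 - x ^ 2) with hr
  have hr0 : 0 ≤ r := div_nonneg (by linarith) hxp.le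
  have h1 : |r - 1| ≤ 2 * s ^ 2 := by
    have : r - 1 = (x ^ 2 - t ^ 2) / (1 - x ^ 2) := by rw [hr]; field_simp; ring
    rw [this, abs_div, abs_of_pos hxp, div_le_iff₀ hxp, abs_le]
    constructor <;> nlinarith [sq_nonneg x, sq_nonneg t]
  have h2 : (√r - 1) * (√r + 1) = r - 1 := by
    have := Real.mul_self_sqrt hr0; linarith
  have h3 : |√r - 1| ≤ |r - 1| := by
    rw [← h2, abs_mul]
    have : 1 ≤ |√r + 1| := by
      rw [abs_of_nonneg (by positivity)]; linarith [Real.sqrt_nonneg r]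
    nlinarith [abs_nonneg (√r - 1)]
  exact h3.trans h1

lemma abs_stepRatio_sub_one_le {p s x : ℝ} {h : Prop} (hs : s ≤ 1 / 2) (hx : |x| ≤ s)
    (ht : |newCoord d p h x| ≤ s) : |stepRatio d p h x - 1| ≤ 2 * s ^ 2 * moveInd d p h x := by
  by_cases hm : IsMoved d p h x
  · simpa [moveInd, hm, stepRatio] using abs_sqrt_ratio_sub_one_le hs hx ht
  · have hx2 := abs_le.1 hx
    have : 1 - x ^ 2 ≠ 0 := by nlinarith
    simp [moveInd, hm, stepRatio, newCoord_of_not_isMoved hm, div_self this]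

lemma abs_stepShift_le {p s x : ℝ} {h : Prop} (hs : s ≤ 1 / 2) (hx : |x| ≤ s)
    (ht : |newCoord d p h x| ≤ s) : |stepShift d p h x| ≤ 3 * s * moveInd d p h x := by
  have hr := abs_stepRatio_sub_one_le hs hx ht
  have hs0 : 0 ≤ s := (abs_nonneg x).trans hx
  by_cases hm : IsMoved d p h x
  · simp only [moveInd, hm, if_true, mul_one] at hr ⊢
    have h1 : stepShift d p h x =
      newCoord d p h x - x - (stepRatio d p h x - 1) * x := by unfold stepShift; ring
    rw [h1]
    calc |newCoord d p h x - x - (stepRatio d p h x - 1) * x|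
        ≤ |newCoord d p h x| + |x| + |stepRatio d p h x - 1| * |x| := by
          rw [← abs_mul]; exact (abs_sub _ _).trans (by gcongr; exact abs_sub _ _)
      _ ≤ s + s + 2 * s ^ 2 * s := by gcongr
      _ ≤ 3 * s := by nlinarith [mul_nonneg hs0 hs0]
  · have h0 : |stepRatio d p h x - 1| ≤ 0 := by simpa [moveInd, hm] using hr
    have h1 : stepRatio d p h x = 1 := by
      have := abs_nonpos_iff.1 h0; linarith
    simp [moveInd, hm, stepShift, h1, newCoord_of_not_isMoved hm]

/-- Beyond the centred part a move has only third-order effects: rescaling `u` costs 2s² · s, and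
the product subtracted for centring in `stepNoise` costs 3s · s². -/
lemma abs_inner_step_sub_le {p s : ℝ} {h : Prop} {v u w : EuclideanSpace ℝ (Fin d)}
    (hs : s ≤ 1 / 2) (hx : |inner ℝ u v| ≤ s) (ht : |newCoord d p h (inner ℝ u v)| ≤ s)
    (hy : |inner ℝ u w| ≤ s) :
    |inner ℝ (step d p h v u) w - inner ℝ u w - stepNoise d p h v u w| ≤
      5 * s ^ 3 * moveInd d p h (inner ℝ u v) := by
  have hr := abs_stepRatio_sub_one_le hs hx ht
  have hδ := abs_stepShift_le hs hx ht
  have hs0 : 0 ≤ s := (abs_nonneg _).trans hx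
  have hm := moveInd_nonneg (d := d) p h (inner ℝ u v)
  have h1 : inner ℝ (step d p h v u) w - inner ℝ u w - stepNoise d p h v u w =
      (stepRatio d p h (inner ℝ u v) - 1) * inner ℝ u w +
        stepShift d p h (inner ℝ u v) * (inner ℝ u v * inner ℝ u w) := by
    rw [step_eq, stepNoise, inner_add_left, real_inner_smul_left, real_inner_smul_left]; ring
  rw [h1]
  calc _ ≤ |stepRatio d p h (inner ℝ u v) - 1| * |inner ℝ u w| +
        |stepShift d p h (inner ℝ u v)| * (|inner ℝ u v| * |inner ℝ u w|) := by
          rw [← abs_mul, ← abs_mul, ← abs_mul]; exact abs_add_le _ _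
    _ ≤ (2 * s ^ 2 * moveInd d p h (inner ℝ u v)) * s +
        (3 * s * moveInd d p h (inner ℝ u v)) * (s * s) := by gcongr
    _ = 5 * s ^ 3 * moveInd d p h (inner ℝ u v) := by ring

/-- The shift is at most 3s and its centred overlap with `w` at most s + s², so a move makes noise
of at most 6s². -/
lemma stepNoise_sq_le {p s : ℝ} {h : Prop} {v u w : EuclideanSpace ℝ (Fin d)}
    (hs : s ≤ 1 / 2) (hx : |inner ℝ u v| ≤ s) (ht : |newCoord d p h (inner ℝ u v)| ≤ s)
    (hy : |inner ℝ u w| ≤ s) (hvw : |inner ℝ v w| ≤ s) :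
    stepNoise d p h v u w ^ 2 ≤ 36 * s ^ 4 * moveInd d p h (inner ℝ u v) := by
  have hδ := abs_stepShift_le hs hx ht
  have hs0 : 0 ≤ s := (abs_nonneg _).trans hx
  have hm := moveInd_nonneg (d := d) p h (inner ℝ u v)
  have hm2 : moveInd d p h (inner ℝ u v) ^ 2 = moveInd d p h (inner ℝ u v) := by
    unfold moveInd; split_ifs <;> norm_num
  have h1 : |stepNoise d p h v u w| ≤ 6 * s ^ 2 * moveInd d p h (inner ℝ u v) := by
    rw [stepNoise, abs_mul]
    calc _ ≤ (3 * s * moveInd d p h (inner ℝ u v)) * (s + s * s) := by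
          gcongr
          calc _ ≤ |inner ℝ v w| + |inner ℝ u v * inner ℝ u w| := abs_sub _ _
            _ ≤ s + s * s := by rw [abs_mul]; gcongr
      _ = moveInd d p h (inner ℝ u v) * (3 * s ^ 2 * (1 + s)) := by ring
      _ ≤ moveInd d p h (inner ℝ u v) * (6 * s ^ 2) := by
          refine mul_le_mul_of_nonneg_left ?_ hm
          nlinarith [mul_nonneg hs0 hs0]
      _ = _ := by ring
  rw [← sq_abs]
  calc _ ≤ (6 * s ^ 2 * moveInd d p h (inner ℝ u v)) ^ 2 := by gcongr
    _ = 36 * s ^ 4 * moveInd d p h (inner ℝ u v) ^ 2 := by ring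
    _ = _ := by rw [hm2]

variable [hd : Fact (2 ≤ d)]

lemma measurable_stepShift (p : ℝ) : Measurable fun y : Prop × ℝ => stepShift d p y.1 y.2 := by
  have := measurable_newCoord (d := d) p
  unfold stepShift stepRatio
  fun_prop

lemma measurable_moveInd (p : ℝ) : Measurable fun y : Prop × ℝ => moveInd d p y.1 y.2 :=
  Measurable.ite (measurableSet_isMoved p) measurable_const measurable_const

lemma measurable_stepNoise (p : ℝ) :
    Measurable fun q : Prop × EuclideanSpace ℝ (Fin d) × EuclideanSpace ℝ (Fin d) ×
      EuclideanSpace ℝ (Fin d) => stepNoise d p q.1 q.2.1 q.2.2.1 q.2.2.2 := by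
  unfold stepNoise
  refine Measurable.mul ((measurable_stepShift p).comp (by fun_prop : Measurable
    fun q : Prop × EuclideanSpace ℝ (Fin d) × EuclideanSpace ℝ (Fin d) ×
      EuclideanSpace ℝ (Fin d) => (q.1, (inner ℝ q.2.2.1 q.2.1 : ℝ)))) (by fun_prop)

/-- For fixed coin the noise is symmetric in law, and averaging over the two signs leaves cosh(l r)
≤ exp(l² r² / 2). The increments need not be bounded, because the compensating term is the realised
square. -/
lemma lintegral_exp_stepNoise_le {p : unitInterval} (l : ℝ) {u : EuclideanSpace ℝ (Fin d)}
    (w : EuclideanSpace ℝ (Fin d)) (hu : ‖u‖ = 1) :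
    ∫⁻ x, ∫⁻ b, ENNReal.ofReal (Real.exp (l * stepNoise d p b x u w -
      l ^ 2 / 2 * stepNoise d p b x u w ^ 2)) ∂coin p ∂unifSphere d ≤ 1 := by
  set g : ℝ → ENNReal := fun r => ENNReal.ofReal (Real.exp (l * r - l ^ 2 / 2 * r ^ 2)) with hg
  have hgm : Measurable g := by fun_prop
  have hD : Measurable fun q : EuclideanSpace ℝ (Fin d) × Prop => stepNoise d p q.2 q.1 u w :=
    (measurable_stepNoise (p : ℝ)).comp (by fun_prop : Measurable
      fun q : EuclideanSpace ℝ (Fin d) × Prop => (q.2, q.1, u, w))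
  change ∫⁻ x, ∫⁻ b, g (stepNoise d p b x u w) ∂coin p ∂unifSphere d ≤ 1
  rw [lintegral_lintegral_swap (f := fun x b => g (stepNoise d p b x u w))
    (hgm.comp hD).aemeasurable]
  refine (lintegral_mono (g := fun _ => 1) fun b => ?_).trans (by simp)
  have hDb : Measurable fun x => stepNoise d p b x u w := hD.comp measurable_prodMk_right
  have hgD : Measurable fun x => g (stepNoise d p b x u w) := hgm.comp hDb
  -- The reflection in the line of u keeps ⟨u, x⟩, and with it the shift, but reverses the part of x
  -- orthogonal to u. So it negates the noise while preserving the uniform law.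
  set R := Submodule.reflection (Submodule.span ℝ {u}) with hR
  have hRx : ∀ x, R x = (2 * inner ℝ u x : ℝ) • u - x := fun x => by
    rw [hR, Submodule.reflection_singleton_apply, hu]
    simp [two_smul, two_mul, add_smul]
  have hneg : ∀ x, stepNoise d p b (R x) u w = - stepNoise d p b x u w := fun x => by
    have h1 : inner ℝ u (R x) = inner ℝ u x := by
      rw [hRx, inner_sub_right, real_inner_smul_right, real_inner_self_eq_norm_sq, hu]; ring
    have h2 : inner ℝ (R x) w = 2 * inner ℝ u x * inner ℝ u w - inner ℝ x w := by
      rw [hRx, inner_sub_left, real_inner_smul_left]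
    simp only [stepNoise, h1, h2]
    ring
  have h1 : ∫⁻ x, g (stepNoise d p b x u w) ∂unifSphere d =
      ∫⁻ x, g (- stepNoise d p b x u w) ∂unifSphere d := by
    conv_lhs => rw [← unifSphere_map_isometry d R, lintegral_map hgD
      R.continuous.measurable]
    simp only [hneg]
  have h2 : 2 * ∫⁻ x, g (stepNoise d p b x u w) ∂unifSphere d ≤ 2 := by
    rw [two_mul]
    nth_rw 2 [h1]
    rw [← lintegral_add_left hgD]
    refine (lintegral_mono (g := fun _ => 2) fun x => ?_).trans (by simp)
    simp only [hg]
    set r := stepNoise d p b x u w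
    rw [← ENNReal.ofReal_add (Real.exp_pos _).le (Real.exp_pos _).le]
    refine (ENNReal.ofReal_le_ofReal (q := 2) ?_).trans_eq (by simp)
    have h3 := Real.cosh_le_exp_half_sq (l * r)
    rw [Real.cosh_eq] at h3
    have h4 : Real.exp (l * r - l ^ 2 / 2 * r ^ 2) + Real.exp (l * -r - l ^ 2 / 2 * (-r) ^ 2) =
        (Real.exp (l * r) + Real.exp (-(l * r))) * Real.exp (-((l * r) ^ 2 / 2)) := by
      rw [add_mul, ← Real.exp_add, ← Real.exp_add]; congr 2 <;> ring
    rw [h4]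
    calc _ ≤ (2 * Real.exp ((l * r) ^ 2 / 2)) * Real.exp (-((l * r) ^ 2 / 2)) := by
          gcongr; linarith
      _ = 2 := by rw [mul_assoc, ← Real.exp_add]; simp
  have h5 : (2 : ENNReal) * ∫⁻ x, g (stepNoise d p b x u w) ∂unifSphere d ≤ 2 * 1 := by
    simpa using h2
  exact (ENNReal.mul_le_mul_iff_right (by norm_num) (by norm_num)).1 h5

/-- The moment is at most 1 + (e - 1) · 2p, and e - 1 ≤ 2. -/
lemma lintegral_exp_moveInd_le {p : unitInterval} {u : EuclideanSpace ℝ (Fin d)} (hu : ‖u‖ = 1) :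
    ∫⁻ x, ∫⁻ b, ENNReal.ofReal (Real.exp (moveInd d p b (inner ℝ u x))) ∂coin p ∂unifSphere d ≤
      ENNReal.ofReal (Real.exp (4 * p)) := by
  have hM : Measurable fun y : Prop × ℝ => ENNReal.ofReal (Real.exp (moveInd d p y.1 y.2)) := by
    have := measurable_moveInd (d := d) (p : ℝ)
    fun_prop
  have h1 : ∫⁻ x, ∫⁻ b, ENNReal.ofReal (Real.exp (moveInd d p b (inner ℝ u x))) ∂coin p
      ∂unifSphere d = ∫⁻ y, ENNReal.ofReal (Real.exp (moveInd d p y.1 y.2))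
        ∂(coin p).prod (sphereInnerLaw d) := by
    rw [lintegral_prod_symm _ hM.aemeasurable, ← unifSphere_map_inner u hu,
      lintegral_map hM.lintegral_prod_left' (by fun_prop)]
    simp only [real_inner_comm u]
  have h2 : ∀ y : Prop × ℝ, ENNReal.ofReal (Real.exp (moveInd d p y.1 y.2)) =
      1 + ENNReal.ofReal (Real.exp 1 - 1) *
        Set.indicator {y : Prop × ℝ | IsMoved d p y.1 y.2} 1 y := fun y => by
    by_cases h : IsMoved d p y.1 y.2
    · rw [Set.indicator_of_mem (by exact h), moveInd, if_pos h, Pi.one_apply, mul_one,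
        ← ENNReal.ofReal_one, ← ENNReal.ofReal_add zero_le_one (by linarith [Real.add_one_le_exp 1])]
      congr 1; ring
    · rw [Set.indicator_of_notMem (by exact h), moveInd, if_neg h]; simp
  rw [h1, lintegral_congr h2, lintegral_add_left measurable_const, lintegral_const_mul _
    (measurable_one.indicator (measurableSet_isMoved _)),
    lintegral_indicator_one (measurableSet_isMoved _)]
  have he : Real.exp 1 - 1 ≤ 2 := by have := Real.exp_one_lt_d9; linarith
  have he0 : 0 ≤ Real.exp 1 - 1 := by linarith [Real.add_one_le_exp 1]
  have hp0 := p.2.1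
  calc _ ≤ 1 + ENNReal.ofReal (Real.exp 1 - 1) * ENNReal.ofReal (2 * p) := by
        gcongr
        · simp
        · exact coin_prod_isMoved_le p
    _ = ENNReal.ofReal (1 + (Real.exp 1 - 1) * (2 * p)) := by
        rw [← ENNReal.ofReal_mul he0, ← ENNReal.ofReal_one, ← ENNReal.ofReal_add] <;> positivity
    _ ≤ _ := by
        refine ENNReal.ofReal_le_ofReal ?_
        have := Real.add_one_le_exp (4 * (p : ℝ))
        nlinarith

variable {p : unitInterval}

/-- The number of moves after step `j`. -/
def moveCount (d : ℕ) (p : ℝ) (j m : ℕ)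
    (y : ((ℕ → EuclideanSpace ℝ (Fin d)) × (ℕ → Prop)) × EuclideanSpace ℝ (Fin d)) : ℝ :=
  ∑ k ∈ Finset.Ico (j + 1) m, moveInd d p (y.1.2 k) (inner ℝ (roundVec p k y) (y.1.1 k))

/-- The accumulated noise, after step `j`, of the coordinate along `v j`. -/
def noiseSum (d : ℕ) (p : ℝ) (j m : ℕ)
    (y : ((ℕ → EuclideanSpace ℝ (Fin d)) × (ℕ → Prop)) × EuclideanSpace ℝ (Fin d)) : ℝ :=
  ∑ k ∈ Finset.Ico (j + 1) m, stepNoise d p (y.1.2 k) (y.1.1 k) (roundVec p k y) (y.1.1 j)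

/-- The quadratic variation of `noiseSum`. -/
def noiseSq (d : ℕ) (p : ℝ) (j m : ℕ)
    (y : ((ℕ → EuclideanSpace ℝ (Fin d)) × (ℕ → Prop)) × EuclideanSpace ℝ (Fin d)) : ℝ :=
  ∑ k ∈ Finset.Ico (j + 1) m, stepNoise d p (y.1.2 k) (y.1.1 k) (roundVec p k y) (y.1.1 j) ^ 2

lemma measure_le_of_lintegral_exp_le {α : Type*} [MeasurableSpace α] {μ : Measure α} {f : α → ℝ}
    {S : Set α} {a b : ℝ} (hS : ∀ y ∈ S, a ≤ f y)
    (hf : ∫⁻ y, ENNReal.ofReal (Real.exp (f y)) ∂μ ≤ ENNReal.ofReal (Real.exp b))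
    (hfm : AEMeasurable f μ) :
    μ S ≤ ENNReal.ofReal (Real.exp (b - a)) := by
  have h1 := mul_meas_ge_le_lintegral₀ (μ := μ) (f := fun y => ENNReal.ofReal (Real.exp (f y)))
    (by fun_prop) (ENNReal.ofReal (Real.exp a))
  have h2 : μ S ≤ μ {y | ENNReal.ofReal (Real.exp a) ≤ ENNReal.ofReal (Real.exp (f y))} :=
    measure_mono fun y hy => ENNReal.ofReal_le_ofReal (Real.exp_le_exp.2 (hS y hy))
  rw [Real.exp_sub, ENNReal.ofReal_div_of_pos (Real.exp_pos a), ENNReal.le_div_iff_mul_le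
    (Or.inl (by simp [Real.exp_pos])) (Or.inl (by simp)), mul_comm]
  exact (mul_le_mul_right h2 _).trans (h1.trans hf)

lemma measurable_noise_term (j k : ℕ) :
    Measurable fun y : ((ℕ → EuclideanSpace ℝ (Fin d)) × (ℕ → Prop)) × EuclideanSpace ℝ (Fin d) =>
      stepNoise d p (y.1.2 k) (y.1.1 k) (roundVec p k y) (y.1.1 j) :=
  (measurable_stepNoise (p : ℝ)).comp ((by fun_prop : Measurable
    fun y : ((ℕ → EuclideanSpace ℝ (Fin d)) × (ℕ → Prop)) × EuclideanSpace ℝ (Fin d) =>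
      y.1.2 k).prodMk ((by fun_prop : Measurable fun y : ((ℕ → EuclideanSpace ℝ (Fin d)) ×
        (ℕ → Prop)) × EuclideanSpace ℝ (Fin d) => y.1.1 k).prodMk
          ((measurable_roundVec _ _).prodMk (by fun_prop))))

/-- Markov's inequality for the self-normalised exponential of noise and quadratic variation, which
has mean at most 1. -/
lemma measure_noiseSum_ge_le (hp0 : (0 : ℝ) < p) (hp1 : (p : ℝ) < 1) (j m : ℕ) (l z q : ℝ) :
    roundLaw d p {y | z ≤ l * noiseSum d p j m y ∧ noiseSq d p j m y ≤ q} ≤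
      ENNReal.ofReal (Real.exp (l ^ 2 / 2 * q - z)) := by
  have hfm : Measurable fun y : ((ℕ → EuclideanSpace ℝ (Fin d)) × (ℕ → Prop)) ×
      EuclideanSpace ℝ (Fin d) => l * noiseSum d p j m y - l ^ 2 / 2 * noiseSq d p j m y := by
    unfold noiseSum noiseSq
    refine Measurable.sub (Measurable.const_mul (Finset.measurable_sum _ fun k _ =>
      measurable_noise_term j k) _) (Measurable.const_mul (Finset.measurable_sum _ fun k _ =>
      (measurable_noise_term j k).pow_const 2) _)
  have h1 : ∫⁻ y, ENNReal.ofReal (Real.exp (l * noiseSum d p j m y -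
      l ^ 2 / 2 * noiseSq d p j m y)) ∂roundLaw d p ≤ ENNReal.ofReal (Real.exp 0) := by
    have h2 := lintegral_prod_round_le (d := d) hp0 hp1 j m (G := fun b x u w =>
      ENNReal.ofReal (Real.exp (l * stepNoise d p b x u w - l ^ 2 / 2 * stepNoise d p b x u w ^ 2)))
      (by have := measurable_stepNoise (d := d) (p : ℝ); fun_prop) (c := 1)
      (fun u w hu => lintegral_exp_stepNoise_le l w hu)
    simp only [one_pow] at h2
    rw [Real.exp_zero, ENNReal.ofReal_one]
    refine le_trans (le_of_eq (lintegral_congr fun y => ?_)) h2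
    rw [← ENNReal.ofReal_prod_of_nonneg fun _ _ => (Real.exp_pos _).le, ← Real.exp_sum,
      Finset.sum_sub_distrib, ← Finset.mul_sum, ← Finset.mul_sum]
    rfl
  refine (measure_le_of_lintegral_exp_le (a := z - l ^ 2 / 2 * q) (b := 0) (fun y hy => ?_) h1
    hfm.aemeasurable).trans_eq
    (by rw [show (0 : ℝ) - (z - l ^ 2 / 2 * q) = l ^ 2 / 2 * q - z by ring])
  have := hy.2
  have := hy.1
  have : l ^ 2 / 2 * noiseSq d p j m y ≤ l ^ 2 / 2 * q := by gcongr
  linarith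

lemma measure_moveCount_ge_le (hp0 : (0 : ℝ) < p) (hp1 : (p : ℝ) < 1) (j m : ℕ) (K : ℝ) :
    roundLaw d p {y | K ≤ moveCount d p j m y} ≤ ENNReal.ofReal (Real.exp (4 * p * m - K)) := by
  have hfm : Measurable (moveCount d p j m) := by
    refine Finset.measurable_sum _ fun k _ => (measurable_moveInd (d := d) (p : ℝ)).comp
      (f := fun y : ((ℕ → EuclideanSpace ℝ (Fin d)) × (ℕ → Prop)) × EuclideanSpace ℝ (Fin d) =>
        (y.1.2 k, (inner ℝ (roundVec p k y) (y.1.1 k) : ℝ))) ?_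
    exact (by fun_prop : Measurable fun y : ((ℕ → EuclideanSpace ℝ (Fin d)) × (ℕ → Prop)) ×
      EuclideanSpace ℝ (Fin d) => y.1.2 k).prodMk
        (Measurable.inner (measurable_roundVec _ _) (by fun_prop))
  have h2 := lintegral_prod_round_le (d := d) hp0 hp1 j m (G := fun b x u w =>
      ENNReal.ofReal (Real.exp (moveInd d p b (inner ℝ u x))))
      (by have := measurable_moveInd (d := d) (p : ℝ); fun_prop)
      (fun u w hu => lintegral_exp_moveInd_le hu)
  refine measure_le_of_lintegral_exp_le (f := moveCount d p j m) (fun y hy => hy) ?_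
    hfm.aemeasurable
  refine (le_of_eq (lintegral_congr fun y => ?_)).trans (h2.trans ?_)
  · rw [← ENNReal.ofReal_prod_of_nonneg fun _ _ => (Real.exp_pos _).le, ← Real.exp_sum]
    rfl
  · rw [← ENNReal.ofReal_pow (Real.exp_pos _).le, ← Real.exp_nat_mul]
    refine ENNReal.ofReal_le_ofReal (Real.exp_le_exp.2 ?_)
    have : ((m - (j + 1) : ℕ) : ℝ) ≤ m := by exact_mod_cast Nat.sub_le _ _
    nlinarith

omit hd in
-- The deterministic part: telescoping splits the displacement into drift and noise. In `hz` the
-- noise is controlled only for small quadratic variation, as in the tail bound; smallness follows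
-- from the number of moves.
lemma abs_inner_roundVec_sub_le {s K z : ℝ} {j m : ℕ} (hjm : j < m) (hs0 : 0 ≤ s)
    (hs : s ≤ 1 / 2)
    {y : ((ℕ → EuclideanSpace ℝ (Fin d)) × (ℕ → Prop)) × EuclideanSpace ℝ (Fin d)}
    (hv : ∀ k, ‖y.1.1 k‖ = 1)
    (hU : ∀ k ≤ m, |inner ℝ (roundVec p k y) (y.1.1 j)| ≤ s)
    (hx : ∀ k < m, |inner ℝ (roundVec p k y) (y.1.1 k)| ≤ s)
    (ht : ∀ k < m, |inner ℝ (roundVec p (k + 1) y) (y.1.1 k)| ≤ s)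
    (hvv : ∀ k ∈ Finset.Ico (j + 1) m, |inner ℝ (y.1.1 k) (y.1.1 j)| ≤ s)
    (hK : moveCount d p j m y ≤ K)
    (hz : noiseSq d p j m y ≤ 36 * K * s ^ 4 → |noiseSum d p j m y| ≤ z) :
    |inner ℝ (roundVec p m y) (y.1.1 j) - inner ℝ (roundVec p (j + 1) y) (y.1.1 j)| ≤
      5 * s ^ 3 * K + z := by
  set Y : ℕ → ℝ := fun k => inner ℝ (roundVec p k y) (y.1.1 j) with hY
  set I : ℕ → ℝ := fun k => moveInd d p (y.1.2 k) (inner ℝ (roundVec p k y) (y.1.1 k)) with hI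
  set D : ℕ → ℝ := fun k => stepNoise d p (y.1.2 k) (y.1.1 k) (roundVec p k y) (y.1.1 j) with hD
  have hnew : ∀ k < m, |newCoord d p (y.1.2 k) (inner ℝ (roundVec p k y) (y.1.1 k))| ≤ s := by
    intro k hk
    have h1 := ht k hk
    rwa [roundVec, chain, inner_step _ _ (hv k)] at h1
  have hdrift : ∀ k ∈ Finset.Ico (j + 1) m, |Y (k + 1) - Y k - D k| ≤ 5 * s ^ 3 * I k := by
    intro k hk
    have hk' := (Finset.mem_Ico.1 hk).2
    exact abs_inner_step_sub_le hs (hx k hk') (hnew k hk') (hU k hk'.le)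
  have hsq : noiseSq d p j m y ≤ 36 * K * s ^ 4 := by
    calc noiseSq d p j m y ≤ ∑ k ∈ Finset.Ico (j + 1) m, 36 * s ^ 4 * I k := by
          refine Finset.sum_le_sum fun k hk => ?_
          have hk' := (Finset.mem_Ico.1 hk).2
          exact stepNoise_sq_le hs (hx k hk') (hnew k hk') (hU k hk'.le) (hvv k hk)
      _ = 36 * s ^ 4 * moveCount d p j m y := by rw [← Finset.mul_sum]; rfl
      _ ≤ 36 * s ^ 4 * K := by gcongr
      _ = 36 * K * s ^ 4 := by ring
  have hM := hz hsq
  have htel : Y m - Y (j + 1) = (∑ k ∈ Finset.Ico (j + 1) m, (Y (k + 1) - Y k - D k)) +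
      noiseSum d p j m y := by
    rw [Finset.sum_sub_distrib, Finset.sum_Ico_sub Y (by omega)]
    simp only [noiseSum, hD]
    ring
  have hsum : |∑ k ∈ Finset.Ico (j + 1) m, (Y (k + 1) - Y k - D k)| ≤ 5 * s ^ 3 * K := by
    calc _ ≤ ∑ k ∈ Finset.Ico (j + 1) m, |Y (k + 1) - Y k - D k| :=
          Finset.abs_sum_le_sum_abs _ _
      _ ≤ ∑ k ∈ Finset.Ico (j + 1) m, 5 * s ^ 3 * I k := Finset.sum_le_sum hdrift
      _ = 5 * s ^ 3 * moveCount d p j m y := by rw [← Finset.mul_sum]; rfl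
      _ ≤ 5 * s ^ 3 * K := by gcongr
  change |Y m - Y (j + 1)| ≤ _
  rw [htel]
  exact (abs_add_le _ _).trans (add_le_add hsum hM)

lemma measure_inner_roundVec_sub_gt_le (hp0 : (0 : ℝ) < p) (hp1 : (p : ℝ) < 1) {s K z : ℝ}
    {j m : ℕ} (hjm : j < m) (hs0 : 0 < s) (hs : s ≤ 1 / 2) (hK : 0 < K) (hz : 0 < z) :
    roundLaw d p {y | 5 * s ^ 3 * K + z < |inner ℝ (roundVec p m y) (y.1.1 j) -
      inner ℝ (roundVec p (j + 1) y) (y.1.1 j)|} ≤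
      ENNReal.ofReal ((4 * m + 1) * (2 * Real.exp (-(s ^ 2 * d / 16))) +
        (Real.exp (4 * p * m - K) + 2 * Real.exp (-(z ^ 2 / (72 * K * s ^ 4))))) := by
  set T : ℝ := 2 * Real.exp (-(s ^ 2 * d / 16)) with hT
  have hT0 : 0 ≤ T := by positivity
  have hSm : MeasurableSet {x : ℝ | s < |x|} := measurableSet_lt measurable_const (by fun_prop)
  have htail := sphereInnerLaw_tail (d := d) hs0.le
  set P := roundLaw d p
  set q : ℝ := 36 * K * s ^ 4 with hq
  have hq0 : 0 < q := by positivity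
  let B1 := ⋃ k ∈ Finset.range (m + 1), {y | inner ℝ (roundVec (d := d) p k y) (y.1.1 j) ∈
    {x : ℝ | s < |x|}}
  let B2 := ⋃ k ∈ Finset.range m, {y | inner ℝ (roundVec (d := d) p k y) (y.1.1 k) ∈
    {x : ℝ | s < |x|}}
  let B3 := ⋃ k ∈ Finset.range m, {y | inner ℝ (roundVec (d := d) p (k + 1) y) (y.1.1 k) ∈
    {x : ℝ | s < |x|}}
  let B4 : Set (((ℕ → EuclideanSpace ℝ (Fin d)) × (ℕ → Prop)) × EuclideanSpace ℝ (Fin d)) :=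
    ⋃ k ∈ Finset.Ico (j + 1) m, {y | inner ℝ (y.1.1 k) (y.1.1 j) ∈ {x : ℝ | s < |x|}}
  let B5 := {y | K ≤ moveCount d p j m y}
  -- The parameter z / q minimises l² q / 2 - l z and gives the exponent -z² / (2q); `B7` treats the
  -- opposite sign.
  let B6 := {y | z ^ 2 / q ≤ (z / q) * noiseSum d p j m y ∧ noiseSq d p j m y ≤ q}
  let B7 := {y | z ^ 2 / q ≤ (-(z / q)) * noiseSum d p j m y ∧ noiseSq d p j m y ≤ q}
  have hbU : ∀ (t : Finset ℕ) (f : ℕ → Set (((ℕ → EuclideanSpace ℝ (Fin d)) × (ℕ → Prop)) ×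
      EuclideanSpace ℝ (Fin d))), (∀ k ∈ t, P (f k) ≤ ENNReal.ofReal T) →
      P (⋃ k ∈ t, f k) ≤ ENNReal.ofReal (t.card * T) := fun t f h => by
    refine (measure_biUnion_finset_le t f).trans ((Finset.sum_le_sum h).trans_eq ?_)
    rw [Finset.sum_const, nsmul_eq_mul, ENNReal.ofReal_mul (p := (t.card : ℝ)) (by positivity),
      ENNReal.ofReal_natCast]
  have h1 : P B1 ≤ ENNReal.ofReal ((m + 1 : ℕ) * T) := by
    refine (hbU _ _ fun k _ => ?_).trans_eq (by rw [Finset.card_range])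
    rw [roundVec_inner_law hp0 hp1 k j hSm]; exact htail
  have h2 : P B2 ≤ ENNReal.ofReal (m * T) := by
    refine (hbU _ _ fun k _ => ?_).trans_eq (by rw [Finset.card_range])
    rw [roundVec_inner_law hp0 hp1 k k hSm]; exact htail
  have h3 : P B3 ≤ ENNReal.ofReal (m * T) := by
    refine (hbU _ _ fun k _ => ?_).trans_eq (by rw [Finset.card_range])
    rw [roundVec_inner_law hp0 hp1 (k + 1) k hSm]; exact htail
  have h4 : P B4 ≤ ENNReal.ofReal (m * T) := by
    refine (hbU _ _ fun k hk => ?_).trans (ENNReal.ofReal_le_ofReal ?_)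
    · have := (Finset.mem_Ico.1 hk).1
      rw [unifSeq_inner_law (by omega) hSm]; exact htail
    · gcongr
      rw [Nat.card_Ico]; omega
  have h5 : P B5 ≤ ENNReal.ofReal (Real.exp (4 * p * m - K)) :=
    measure_moveCount_ge_le hp0 hp1 j m K
  have hexp : z ^ 2 / q / 2 = z ^ 2 / (72 * K * s ^ 4) := by rw [hq]; field_simp; norm_num
  have h6 : P B6 ≤ ENNReal.ofReal (Real.exp (-(z ^ 2 / (72 * K * s ^ 4)))) := by
    refine (measure_noiseSum_ge_le hp0 hp1 j m (z / q) (z ^ 2 / q) q).trans_eq ?_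
    rw [← hexp]; congr 2; field_simp; ring
  have h7 : P B7 ≤ ENNReal.ofReal (Real.exp (-(z ^ 2 / (72 * K * s ^ 4)))) := by
    refine (measure_noiseSum_ge_le hp0 hp1 j m (-(z / q)) (z ^ 2 / q) q).trans_eq ?_
    rw [← hexp]; congr 2; field_simp; ring
  have hcover : P {y | 5 * s ^ 3 * K + z < |inner ℝ (roundVec p m y) (y.1.1 j) -
      inner ℝ (roundVec p (j + 1) y) (y.1.1 j)|} ≤
      P (B1 ∪ (B2 ∪ (B3 ∪ (B4 ∪ (B5 ∪ (B6 ∪ B7)))))) := by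
    refine measure_mono_ae ?_
    filter_upwards [roundLaw_ae_norm_vec (d := d) (p := p)] with y hv hy
    by_contra hB
    have hB' : y ∉ (B1 ∪ (B2 ∪ (B3 ∪ (B4 ∪ (B5 ∪ (B6 ∪ B7)))))) := hB
    simp only [Set.mem_union, not_or, B1, B2, B3, B4, B5, B6, B7, Set.mem_iUnion,
      Set.mem_ofPred_eq, not_exists, not_lt, not_le, not_and, Finset.mem_range] at hB'
    obtain ⟨c1, c2, c3, c4, c5, c6, c7⟩ := hB'
    have hy' : 5 * s ^ 3 * K + z < |inner ℝ (roundVec p m y) (y.1.1 j) -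
      inner ℝ (roundVec p (j + 1) y) (y.1.1 j)| := hy
    refine absurd (abs_inner_roundVec_sub_le hjm hs0.le hs hv (fun k hk => c1 k (by omega))
      c2 c3 c4 c5.le fun hsq => ?_) (not_le.2 hy')
    have hzq : 0 < z / q := by positivity
    by_contra! hlt
    rcases lt_abs.1 hlt with h | h
    · have : z ^ 2 / q ≤ (z / q) * noiseSum d p j m y := by
        rw [show z ^ 2 / q = (z / q) * z by ring]; gcongr
      exact absurd hsq (not_le.2 (c6 this))
    · have : z ^ 2 / q ≤ (-(z / q)) * noiseSum d p j m y := by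
        rw [show z ^ 2 / q = (z / q) * z by ring, neg_mul, ← mul_neg]; gcongr
      exact absurd hsq (not_le.2 (c7 this))
  refine hcover.trans ?_
  have hE1 := (Real.exp_pos (4 * p * m - K)).le
  have hE2 := (Real.exp_pos (-(z ^ 2 / (72 * K * s ^ 4)))).le
  calc _ ≤ P B1 + (P B2 + (P B3 + (P B4 + (P B5 + (P B6 + P B7))))) := by
        refine (measure_union_le _ _).trans (add_le_add_right ?_ _)
        refine (measure_union_le _ _).trans (add_le_add_right ?_ _)
        refine (measure_union_le _ _).trans (add_le_add_right ?_ _)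
        refine (measure_union_le _ _).trans (add_le_add_right ?_ _)
        refine (measure_union_le _ _).trans (add_le_add_right ?_ _)
        exact measure_union_le _ _
    _ ≤ _ := add_le_add h1 (add_le_add h2 (add_le_add h3 (add_le_add h4 (add_le_add h5
        (add_le_add h6 h7)))))
    _ = _ := by
        rw [← ENNReal.ofReal_add, ← ENNReal.ofReal_add, ← ENNReal.ofReal_add,
          ← ENNReal.ofReal_add, ← ENNReal.ofReal_add, ← ENNReal.ofReal_add]
        · congr 1; push_cast; ring
        all_goals positivity

end Concentration

/-! ### Coins as a random graph, Gaussian blocks as uniform vectors. -/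

section ProductLaws

lemma infinitePi_map_comp_injective {ι κ X : Type*} [MeasurableSpace X] (μ : Measure X)
    [IsProbabilityMeasure μ] {φ : κ → ι} (hφ : Function.Injective φ) :
    (Measure.infinitePi fun _ : ι => μ).map (fun x => x ∘ φ) =
      Measure.infinitePi fun _ : κ => μ := by
  classical
  refine Measure.eq_infinitePi _ fun s t ht => ?_
  have hm : Measurable fun x : ι → X => x ∘ φ := measurable_pi_lambda _ fun k => by
    simp only [Function.comp_apply]; fun_prop
  rw [Measure.map_apply hm (.pi s.countable_toSet fun _ _ => ht _)]
  let t' : ι → Set X := fun i => if h : ∃ k, φ k = i then t h.choose else Set.univ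
  have ht' : ∀ k, t' (φ k) = t k := fun k => by
    have h : ∃ l, φ l = φ k := ⟨k, rfl⟩
    simp only [t', dif_pos h, hφ h.choose_spec]
  have hpre : (fun x : ι → X => x ∘ φ) ⁻¹' (s : Set κ).pi t =
      ((s.image φ : Finset ι) : Set ι).pi t' := by
    ext x
    simp [Set.mem_pi, ht']
  rw [hpre, Measure.infinitePi_pi, Finset.prod_image fun _ _ _ _ h => hφ h]
  · simp only [ht']
  · intro i hi
    obtain ⟨k, -, rfl⟩ := Finset.mem_image.1 hi
    rw [ht']; exact ht k

/-- The graph on `Fin n` whose edges are read off the strictly lower triangular part of `M`. -/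
def lowerGraph (n : ℕ) (M : ℕ → ℕ → Prop) : SimpleGraph (Fin n) where
  Adj i j := i ≠ j ∧ M (max i j : Fin n) (min i j : Fin n)
  symm := ⟨fun i j h => ⟨h.1.symm, by rw [max_comm, min_comm]; exact h.2⟩⟩
  loopless := ⟨fun i h => h.1 rfl⟩

lemma measurable_lowerGraph (n : ℕ) : Measurable (lowerGraph n) := by
  refine SimpleGraph.measurable_iff_adj.2 fun i j => ?_
  simp only [lowerGraph]
  fun_prop

lemma coin_map_and (p : unitInterval) (a : Prop) :
    (coin p).map (fun b => b ∧ a) = unitInterval.toNNReal p • Measure.dirac a +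
      unitInterval.toNNReal (unitInterval.symm p) • Measure.dirac False := by
  have hm : Measurable fun b : Prop => (b ∧ a) := measurable_of_countable _
  rw [coin, Measure.map_add _ _ hm, Measure.map_smul, Measure.map_smul, Measure.map_dirac' hm,
    Measure.map_dirac' hm]
  simp

/-- An unordered pair reads the single coin at (sup, inf), and distinct pairs read distinct coins.
The conjunction with being off the diagonal produces the degenerate coins of the Bernoulli set law
there. -/
lemma infinitePi_coins_map_lowerGraph (n : ℕ) (p : unitInterval) :
    (Measure.infinitePi fun _ : ℕ => coins p).map (lowerGraph n) =
      SimpleGraph.binomialRandom (Fin n) p := by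
  let φ : Sym2 (Fin n) → ℕ × ℕ := fun e => (e.sup, e.inf)
  have hφ : Function.Injective φ := fun e e' h => by
    simp only [φ, Prod.mk.injEq, Fin.val_inj] at h
    exact Sym2.inf_eq_inf_and_sup_eq_sup.1 ⟨h.2, h.1⟩
  have h1 := Measure.infinitePi_map_curry (ι := ℕ) (κ := ℕ) fun _ _ => coin p
  have h2 := infinitePi_map_comp_injective (coin p) hφ
  have h3 := Measure.infinitePi_map_pi (fun _ : Sym2 (Fin n) => coin p)
    (f := fun e b => b ∧ e ∈ (Sym2.diagSetᶜ : Set (Sym2 (Fin n))))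
    fun _ => measurable_of_countable _
  simp only [coin_map_and] at h3
  have hm1 : Measurable fun x : ℕ × ℕ → Prop => x ∘ φ := measurable_pi_lambda _ fun k => by
    simp only [Function.comp_apply]; fun_prop
  have hm2 : Measurable fun (x : Sym2 (Fin n) → Prop) (e : Sym2 (Fin n)) =>
      (x e ∧ e ∈ (Sym2.diagSetᶜ : Set (Sym2 (Fin n)))) := by fun_prop
  have hm3 : Measurable fun x : Sym2 (Fin n) → Prop => {e | x e} :=
    MeasurableEquiv.setOfPred.measurable
  rw [SimpleGraph.binomialRandom_eq_map, setBernoulli_eq_map, ← h3, ← h2, ← h1,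
    Measure.map_map (measurable_lowerGraph n) (MeasurableEquiv.measurable _),
    Measure.map_map hm2 hm1, Measure.map_map hm3 (hm2.comp hm1),
    Measure.map_map SimpleGraph.measurable_fromEdgeSet (hm3.comp (hm2.comp hm1))]
  congr 1
  funext x
  ext i j
  simp [lowerGraph, φ, and_comm, MeasurableEquiv.curry, Function.curry]

/-- The normalised blocks of length `d` of a sequence. -/
def unitRows (d : ℕ) (ω : ℕ → ℝ) (i : ℕ) : EuclideanSpace ℝ (Fin d) :=
  ‖(WithLp.toLp 2 fun l : Fin d => ω (i * d + l) : EuclideanSpace ℝ (Fin d))‖⁻¹ •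
    WithLp.toLp 2 fun l : Fin d => ω (i * d + l)

lemma measurable_unitRows (d : ℕ) : Measurable (unitRows d) := by
  refine measurable_pi_lambda _ fun i => ?_
  have : Measurable fun ω : ℕ → ℝ =>
      (WithLp.toLp 2 fun l : Fin d => ω (i * d + l) : EuclideanSpace ℝ (Fin d)) := by fun_prop
  exact this.norm.inv.smul this

lemma infinitePi_gaussian_map_unitRows (d : ℕ) [Fact (2 ≤ d)] :
    (Measure.infinitePi fun _ : ℕ => gaussianReal 0 1).map (unitRows d) = unifSeq d := by
  -- Injective since the quotient by d recovers the block and the remainder the position, so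
  -- distinct blocks use disjoint draws.
  let φ : ℕ × Fin d → ℕ := fun k => k.1 * d + k.2
  have hφ : Function.Injective φ := fun k l h => by
    have hd : 0 < d := k.2.pos
    have h1 : φ k / d = k.1 := by simp [φ, Nat.mul_comm _ d, Nat.mul_add_div hd, k.2.isLt]
    have h2 : φ l / d = l.1 := by simp [φ, Nat.mul_comm _ d, Nat.mul_add_div hd, l.2.isLt]
    have h3 : k.1 = l.1 := by rw [← h1, ← h2, h]
    refine Prod.ext h3 (Fin.ext ?_)
    simp only [φ, h3] at h
    omega
  have h1 := infinitePi_map_comp_injective (gaussianReal 0 1) hφ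
  have h2 := Measure.infinitePi_map_curry (ι := ℕ) (κ := Fin d) fun _ _ => gaussianReal 0 1
  let N : (Fin d → ℝ) → EuclideanSpace ℝ (Fin d) := fun x =>
    ‖(WithLp.toLp 2 x : EuclideanSpace ℝ (Fin d))‖⁻¹ • WithLp.toLp 2 x
  have hN' : Measurable fun x : EuclideanSpace ℝ (Fin d) => ‖x‖⁻¹ • x :=
    measurable_norm.inv.smul measurable_id
  have hN : Measurable N := hN'.comp (by fun_prop : Measurable fun x : Fin d → ℝ =>
    (WithLp.toLp 2 x : EuclideanSpace ℝ (Fin d)))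
  have hlaw : (Measure.infinitePi fun _ : Fin d => gaussianReal 0 1).map N = unifSphere d := by
    rw [← stdGaussian_map_normalize, ← map_pi_eq_stdGaussian, Measure.infinitePi_eq_pi,
      Measure.map_map hN' (by fun_prop)]
    rfl
  have h3 := Measure.infinitePi_map_pi
    (fun _ : ℕ => Measure.infinitePi fun _ : Fin d => gaussianReal 0 1) (f := fun _ => N)
    fun _ => hN
  simp only [hlaw] at h3
  have hm1 : Measurable fun x : ℕ → ℝ => x ∘ φ := measurable_pi_lambda _ fun k => by
    simp only [Function.comp_apply]; fun_prop
  have hm2 : Measurable fun (x : ℕ → Fin d → ℝ) i => N (x i) := by fun_prop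
  rw [unifSeq, ← h3, ← h2, ← h1, Measure.map_map (MeasurableEquiv.measurable _) hm1,
    Measure.map_map hm2 ((MeasurableEquiv.measurable _).comp hm1)]
  rfl

end ProductLaws

namespace RealRAM

/-! ### Polynomial running time. -/

section RunningTime

/-- Programs in which registers are only changed by loops, and the length of each loop is the
content of a register. -/
def Cmd.LoopsOverRegs : Cmd → Prop
  | .skip => True
  | .setIdx _ _ => False
  | .store _ _ _ _ => True
  | .normal _ _ _ => True
  | .seq s t => s.LoopsOverRegs ∧ t.LoopsOverRegs
  | .ifIdx _ _ s t => s.LoopsOverRegs ∧ t.LoopsOverRegs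
  | .ifReal _ _ s t => s.LoopsOverRegs ∧ t.LoopsOverRegs
  | .loop _ e s => (∃ y, e = .reg y) ∧ s.LoopsOverRegs

/-- A polynomial which bounds the running time in terms of a bound for the registers. -/
def Cmd.timePoly : Cmd → Polynomial ℕ
  | .skip => 1
  | .setIdx _ e => .C (e.cost + 1)
  | .store _ i j e => .C (i.cost + j.cost + e.cost + 1)
  | .normal _ i j => .C (i.cost + j.cost + 1)
  | .seq s t => s.timePoly + t.timePoly
  | .ifIdx a b s t => .C (a.cost + b.cost + 1) + (s.timePoly + t.timePoly)
  | .ifReal a b s t => .C (a.cost + b.cost + 1) + (s.timePoly + t.timePoly)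
  | .loop _ e s => .C (e.cost + 1) + .X * (1 + s.timePoly)

/-- Invariant rule: `P k` holds just before pass k sets the counter. The number of passes is
evaluated in the entry state. -/
lemma exec_loop_induction {ω : ℕ → ℝ} {x : ℕ} {e : IExpr} {c : Cmd} {s : State}
    (P : ℕ → State → Prop) (h0 : P 0 (s.tick (e.cost + 1)))
    (hstep : ∀ k < e.eval s, ∀ t, P k t → P (k + 1) (exec ω c ((t.setIdx x k).tick 1))) :
    P (e.eval s) (exec ω (.loop x e c) s) := by
  have key : ∀ m ≤ e.eval s, P m ((List.range m).foldl
      (fun t k => exec ω c ((t.setIdx x k).tick 1)) (s.tick (e.cost + 1))) := by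
    intro m hm
    induction m with
    | zero => simpa using h0
    | succ m ih =>
      rw [List.range_succ, List.foldl_append]
      exact hstep m hm _ (ih (by omega))
  rw [exec]
  exact key _ le_rfl

/-- One bound on the registers survives the whole run: only loop counters change, and a counter
stays below the entry content of the limiting register. -/
lemma exec_time_le (ω : ℕ → ℝ) (B : ℕ) (c : Cmd) (hc : c.LoopsOverRegs) (s : State)
    (hs : ∀ x, s.idx x ≤ B) :
    (∀ x, (exec ω c s).idx x ≤ B) ∧ (exec ω c s).time ≤ s.time + c.timePoly.eval B := by
  induction c generalizing s with
  | skip => simpa [exec, State.tick, Cmd.timePoly] using hs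
  | setIdx x e => exact hc.elim
  | store m i j e => simpa [exec, State.tick, State.store, Cmd.timePoly] using hs
  | normal m i j => simpa [exec, State.tick, State.store, Cmd.timePoly] using hs
  | seq a b iha ihb =>
    have h1 := iha hc.1 s hs
    have h2 := ihb hc.2 _ h1.1
    simp only [exec, Cmd.timePoly, Polynomial.eval_add]
    exact ⟨h2.1, by omega⟩
  | ifIdx a b c₁ c₂ ih1 ih2 =>
    have h1 := ih1 hc.1 (s.tick (a.cost + b.cost + 1)) hs
    have h2 := ih2 hc.2 (s.tick (a.cost + b.cost + 1)) hs
    simp only [exec, Cmd.timePoly, Polynomial.eval_add, Polynomial.eval_C]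
    simp only [State.tick] at h1 h2 ⊢
    split_ifs
    · exact ⟨h1.1, by omega⟩
    · exact ⟨h2.1, by omega⟩
  | ifReal a b c₁ c₂ ih1 ih2 =>
    have h1 := ih1 hc.1 (s.tick (a.cost + b.cost + 1)) hs
    have h2 := ih2 hc.2 (s.tick (a.cost + b.cost + 1)) hs
    simp only [exec, Cmd.timePoly, Polynomial.eval_add, Polynomial.eval_C]
    simp only [State.tick] at h1 h2 ⊢
    split_ifs
    · exact ⟨h1.1, by omega⟩
    · exact ⟨h2.1, by omega⟩
  | loop x e c ih =>
    obtain ⟨⟨y, rfl⟩, hc⟩ := hc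
    have hloop := exec_loop_induction (ω := ω) (x := x) (e := .reg y) (c := c) (s := s)
      (fun m t => (∀ x, t.idx x ≤ B) ∧
        t.time ≤ s.time + 2 + m * (1 + c.timePoly.eval B))
      ⟨hs, by simp [State.tick, IExpr.cost]⟩ fun k hk t ht => by
        have hk' : k < s.idx y := hk
        have h := ih hc ((t.setIdx x k).tick 1) fun z => by
          simp only [State.tick, State.setIdx]
          split_ifs
          · exact (hk'.le).trans (hs y)
          · exact ht.1 z
        refine ⟨h.1, h.2.trans ?_⟩
        have := ht.2
        simp only [State.tick, State.setIdx]
        rw [add_mul, one_mul]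
        omega
    refine ⟨hloop.1, hloop.2.trans ?_⟩
    simp only [Cmd.timePoly, Polynomial.eval_add, Polynomial.eval_C, Polynomial.eval_mul,
      Polynomial.eval_X, Polynomial.eval_one, IExpr.cost, IExpr.eval]
    have := Nat.mul_le_mul_right (1 + c.timePoly.eval B) (hs y)
    omega

lemma runTime_le_eval_timePoly (c : Cmd) (hc : c.LoopsOverRegs) (n d : ℕ) (p : ℝ)
    (H : SimpleGraph (Fin n)) (ω : ℕ → ℝ) :
    runTime c n d p H ω ≤ c.timePoly.eval (n + d) := by
  refine (exec_time_le ω (n + d) c hc _ fun x => ?_).2.trans_eq (by simp [init])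
  simp only [init]
  split_ifs <;> omega

end RunningTime

/-! ### The program and its correctness. -/

section Program

/-- Stores a Gaussian vector in the row of array `2` given by register `2`, and its squared norm in
the cell `(0, 0)` of array `3`. -/
def sampleRow : Cmd :=
  .seq (.store 3 (.const 0) (.const 0) (.const 0))
    (.loop 4 (.reg 1) (.seq (.normal 2 (.reg 2) (.reg 4))
      (.store 3 (.const 0) (.const 0) (.add (.cell 3 (.const 0) (.const 0))
        (.mul (.cell 2 (.reg 2) (.reg 4)) (.cell 2 (.reg 2) (.reg 4)))))))

/-- Divides the row of array `2` given by register `2` by the root of the cell `(0, 0)` of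
array `3`. -/
def normalizeRow : Cmd :=
  .loop 4 (.reg 1) (.store 2 (.reg 2) (.reg 4)
    (.div (.cell 2 (.reg 2) (.reg 4)) (.sqrt (.cell 3 (.const 0) (.const 0)))))

/-- Stores the inner product of the rows of array `2` given by the registers `2` and `3` in the cell
`(0, 0)` of array `3`. -/
def dotRows : Cmd :=
  .seq (.store 3 (.const 0) (.const 0) (.const 0))
    (.loop 4 (.reg 1) (.store 3 (.const 0) (.const 0) (.add (.cell 3 (.const 0) (.const 0))
        (.mul (.cell 2 (.reg 2) (.reg 4)) (.cell 2 (.reg 3) (.reg 4))))))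

/-- The expression `1 - p`. -/
def oneSubP : RExpr := .sub (.const 1) (.cell 1 (.const 0) (.const 0))

/-- Computes the new coordinate in the cell `(0, 2)` of array `3`. -/
def adjustCoord : Cmd :=
  .seq (.store 3 (.const 0) (.const 1) (.cdf (.reg 1) (.cell 3 (.const 0) (.const 0))))
    (.ifReal (.cell 0 (.reg 2) (.reg 3)) (.const 0)
      (.ifReal (.cell 3 (.const 0) (.const 1)) oneSubP
        (.store 3 (.const 0) (.const 2) (.cell 3 (.const 0) (.const 0)))
        (.store 3 (.const 0) (.const 2) (.quantile (.reg 1)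
          (.div (.mul oneSubP (.sub (.cell 3 (.const 0) (.const 1)) oneSubP))
            (.cell 1 (.const 0) (.const 0))))))
      (.ifReal (.cell 3 (.const 0) (.const 1)) oneSubP
        (.store 3 (.const 0) (.const 2) (.quantile (.reg 1)
          (.add oneSubP (.div (.mul (.cell 1 (.const 0) (.const 0))
            (.cell 3 (.const 0) (.const 1))) oneSubP))))
        (.store 3 (.const 0) (.const 2) (.cell 3 (.const 0) (.const 0)))))

/-- Computes the scaling factor in the cell `(0, 3)` of array `3`. -/
def scaleFactor : Cmd :=
  .store 3 (.const 0) (.const 3) (.sqrt (.div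
    (.sub (.const 1) (.mul (.cell 3 (.const 0) (.const 2)) (.cell 3 (.const 0) (.const 2))))
    (.sub (.const 1) (.mul (.cell 3 (.const 0) (.const 0)) (.cell 3 (.const 0) (.const 0))))))

/-- Changes the row of array `2` given by register `2` along the row given by register `3`. -/
def combineRows : Cmd :=
  .loop 4 (.reg 1) (.store 2 (.reg 2) (.reg 4)
    (.add (.mul (.cell 3 (.const 0) (.const 3)) (.cell 2 (.reg 2) (.reg 4)))
      (.mul (.sub (.cell 3 (.const 0) (.const 2))
        (.mul (.cell 3 (.const 0) (.const 3)) (.cell 3 (.const 0) (.const 0))))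
        (.cell 2 (.reg 3) (.reg 4)))))

/-- Adjusts the vector given by register `2` with respect to the one given by register `3`. -/
def stepRow : Cmd := .seq dotRows (.seq adjustCoord (.seq scaleFactor combineRows))

/-- The embedding algorithm. -/
def embedProg : Cmd :=
  .loop 2 (.reg 0) (.seq sampleRow (.seq normalizeRow (.loop 3 (.reg 2) stepRow)))

lemma embedProg_loopsOverRegs : embedProg.LoopsOverRegs := by
  simp [embedProg, sampleRow, normalizeRow, stepRow, dotRows, adjustCoord, scaleFactor,
    combineRows, Cmd.LoopsOverRegs]

/-- The states `s` and `t` agree up to register `4`, the row `i` of array `2`, and array `3`. -/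
structure Frame (i : ℕ) (s t : State) : Prop where
  idx : ∀ y, y ≠ 4 → t.idx y = s.idx y
  mem : ∀ a b c, a ≠ 3 → (a = 2 → b ≠ i) → t.mem a b c = s.mem a b c

lemma Frame.trans {i : ℕ} {s t u : State} (h : Frame i s t) (h' : Frame i t u) : Frame i s u :=
  ⟨fun y hy => (h'.idx y hy).trans (h.idx y hy),
    fun a b c ha hb => (h'.mem a b c ha hb).trans (h.mem a b c ha hb)⟩

/-- The row `i` of array `2`. -/
def row (d : ℕ) (s : State) (i : ℕ) : EuclideanSpace ℝ (Fin d) :=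
  WithLp.toLp 2 fun l => s.mem 2 i l

lemma exec_sampleRow (ω : ℕ → ℝ) (s : State) :
    Frame (s.idx 2) s (exec ω sampleRow s) ∧
      (exec ω sampleRow s).draws = s.draws + s.idx 1 ∧
      (∀ l < s.idx 1, (exec ω sampleRow s).mem 2 (s.idx 2) l = ω (s.draws + l)) ∧
      (exec ω sampleRow s).mem 3 0 0 = ∑ l ∈ Finset.range (s.idx 1), ω (s.draws + l) ^ 2 := by
  rw [sampleRow, exec]
  refine exec_loop_induction (fun m t => Frame (s.idx 2) s t ∧ t.draws = s.draws + m ∧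
    (∀ l < m, t.mem 2 (s.idx 2) l = ω (s.draws + l)) ∧
    t.mem 3 0 0 = ∑ l ∈ Finset.range m, ω (s.draws + l) ^ 2) ?_ ?_
  · refine ⟨⟨fun y _ => rfl, fun a b c ha hb => ?_⟩, rfl, by simp, ?_⟩
    · simp [exec, State.tick, State.store, ha]
    · simp [exec, State.tick, State.store, IExpr.eval, RExpr.eval]
  · rintro k - t ⟨hF, hD, hR, hS⟩
    have hi : t.idx 2 = s.idx 2 := hF.idx 2 (by norm_num)
    refine ⟨⟨fun y hy => ?_, fun a b c ha hb => ?_⟩, ?_, fun l hl => ?_, ?_⟩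
    · simp [exec, State.tick, State.store, State.setIdx, hy, hF.idx y hy]
    · rw [← hF.mem a b c ha hb]
      simp only [exec, State.tick, State.store, State.setIdx, IExpr.eval]
      simp [ha, hi]
      tauto
    · simp [exec, State.tick, State.store, State.setIdx, hD]; ring
    · simp only [exec, State.tick, State.store, State.setIdx, IExpr.eval]
      simp only [hi, hD]
      by_cases h : l = k
      · simp [h]
      · simpa [h] using hR l (by omega)
    · simp only [exec, State.tick, State.store, State.setIdx, IExpr.eval, RExpr.eval]
      simp [hi, hD, hS, Finset.sum_range_succ, sq]

lemma exec_normalizeRow (ω : ℕ → ℝ) (s : State) :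
    Frame (s.idx 2) s (exec ω normalizeRow s) ∧
      (exec ω normalizeRow s).draws = s.draws ∧
      ∀ l < s.idx 1, (exec ω normalizeRow s).mem 2 (s.idx 2) l =
        s.mem 2 (s.idx 2) l / √(s.mem 3 0 0) := by
  -- The invariant also records the entries not yet reached, because each pass reads an old entry
  -- before overwriting it.
  have := exec_loop_induction (ω := ω) (x := 4) (e := .reg 1) (c := .store 2 (.reg 2) (.reg 4)
    (.div (.cell 2 (.reg 2) (.reg 4)) (.sqrt (.cell 3 (.const 0) (.const 0))))) (s := s)
    (fun m t => Frame (s.idx 2) s t ∧ t.draws = s.draws ∧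
    (∀ l, t.mem 2 (s.idx 2) l = if l < m then s.mem 2 (s.idx 2) l / √(s.mem 3 0 0) else
      s.mem 2 (s.idx 2) l) ∧ t.mem 3 0 0 = s.mem 3 0 0) ?_ ?_
  · exact ⟨this.1, this.2.1, fun l hl => (this.2.2.1 l).trans (if_pos hl)⟩
  · exact ⟨⟨fun y _ => rfl, fun a b c ha hb => rfl⟩, rfl, by simp [State.tick], rfl⟩
  · rintro k - t ⟨hF, hD, hR, hS⟩
    have hi : t.idx 2 = s.idx 2 := hF.idx 2 (by norm_num)
    refine ⟨⟨fun y hy => ?_, fun a b c ha hb => ?_⟩, ?_, fun l => ?_, ?_⟩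
    · simp [exec, State.tick, State.store, State.setIdx, hy, hF.idx y hy]
    · rw [← hF.mem a b c ha hb]
      simp only [exec, State.tick, State.store, State.setIdx, IExpr.eval]
      simp [hi]
      tauto
    · simp [exec, State.tick, State.store, State.setIdx, hD]
    · simp only [exec, State.tick, State.store, State.setIdx, IExpr.eval, RExpr.eval]
      simp only [hi, hS]
      by_cases h : l = k
      · simp [h, hR]
      · have : l < k + 1 ↔ l < k := by omega
        simp [h, hR, this]
    · simp only [exec, State.tick, State.store, State.setIdx, IExpr.eval, RExpr.eval]
      simp [hS]

lemma exec_dotRows (ω : ℕ → ℝ) (s : State) :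
    (∀ y, y ≠ 4 → (exec ω dotRows s).idx y = s.idx y) ∧
      (∀ a b c, a ≠ 3 → (exec ω dotRows s).mem a b c = s.mem a b c) ∧
      (exec ω dotRows s).draws = s.draws ∧
      (exec ω dotRows s).mem 3 0 0 =
        ∑ l ∈ Finset.range (s.idx 1), s.mem 2 (s.idx 2) l * s.mem 2 (s.idx 3) l := by
  rw [dotRows, exec]
  refine exec_loop_induction (fun m t => (∀ y, y ≠ 4 → t.idx y = s.idx y) ∧
      (∀ a b c, a ≠ 3 → t.mem a b c = s.mem a b c) ∧ t.draws = s.draws ∧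
    t.mem 3 0 0 = ∑ l ∈ Finset.range m, s.mem 2 (s.idx 2) l * s.mem 2 (s.idx 3) l) ?_ ?_
  · refine ⟨fun y _ => rfl, fun a b c ha => ?_, rfl, ?_⟩
    · simp [exec, State.tick, State.store, ha]
    · simp [exec, State.tick, State.store, IExpr.eval, RExpr.eval]
  · rintro k - t ⟨hI, hM, hD, hS⟩
    refine ⟨fun y hy => ?_, fun a b c ha => ?_, ?_, ?_⟩
    · simp [exec, State.tick, State.store, State.setIdx, hy, hI y hy]
    · rw [← hM a b c ha]
      simp [exec, State.tick, State.store, State.setIdx, ha]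
    · simp [exec, State.tick, State.store, State.setIdx, hD]
    · simp only [exec, State.tick, State.store, State.setIdx, IExpr.eval, RExpr.eval]
      simp [hI, hM, hS, Finset.sum_range_succ]

lemma exec_adjustCoord (ω : ℕ → ℝ) (s : State) :
    (exec ω adjustCoord s).idx = s.idx ∧
      (∀ a b c, a ≠ 3 → (exec ω adjustCoord s).mem a b c = s.mem a b c) ∧
      (exec ω adjustCoord s).draws = s.draws ∧
      (exec ω adjustCoord s).mem 3 0 0 = s.mem 3 0 0 ∧
      (exec ω adjustCoord s).mem 3 0 2 = newCoord (s.idx 1) (s.mem 1 0 0)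
        (0 < s.mem 0 (s.idx 2) (s.idx 3)) (s.mem 3 0 0) := by
  simp only [adjustCoord, oneSubP, newCoord, exec, State.tick, State.store, IExpr.eval, RExpr.eval]
  norm_num
  split_ifs <;> first
    | (exfalso; linarith)
    | simp +contextual

/-- Distinctness of the two rows keeps the row that is read unchanged while the other is overwritten
in place. -/
lemma exec_combineRows (ω : ℕ → ℝ) (s : State) (hne : s.idx 3 ≠ s.idx 2) :
    Frame (s.idx 2) s (exec ω combineRows s) ∧
      (exec ω combineRows s).draws = s.draws ∧
      ∀ l < s.idx 1, (exec ω combineRows s).mem 2 (s.idx 2) l =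
        s.mem 3 0 3 * s.mem 2 (s.idx 2) l +
          (s.mem 3 0 2 - s.mem 3 0 3 * s.mem 3 0 0) * s.mem 2 (s.idx 3) l := by
  have := exec_loop_induction (ω := ω) (x := 4) (e := .reg 1) (c := .store 2 (.reg 2) (.reg 4)
    (.add (.mul (.cell 3 (.const 0) (.const 3)) (.cell 2 (.reg 2) (.reg 4)))
      (.mul (.sub (.cell 3 (.const 0) (.const 2))
        (.mul (.cell 3 (.const 0) (.const 3)) (.cell 3 (.const 0) (.const 0))))
        (.cell 2 (.reg 3) (.reg 4))))) (s := s)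
    (fun m t => Frame (s.idx 2) s t ∧ t.draws = s.draws ∧
    (∀ l, t.mem 2 (s.idx 2) l = if l < m then s.mem 3 0 3 * s.mem 2 (s.idx 2) l +
          (s.mem 3 0 2 - s.mem 3 0 3 * s.mem 3 0 0) * s.mem 2 (s.idx 3) l else
      s.mem 2 (s.idx 2) l) ∧ ∀ b c, t.mem 3 b c = s.mem 3 b c) ?_ ?_
  · exact ⟨this.1, this.2.1, fun l hl => (this.2.2.1 l).trans (if_pos hl)⟩
  · exact ⟨⟨fun y _ => rfl, fun a b c ha hb => rfl⟩, rfl, by simp [State.tick], fun _ _ => rfl⟩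
  · rintro k - t ⟨hF, hD, hR, hS⟩
    have hi : t.idx 2 = s.idx 2 := hF.idx 2 (by norm_num)
    have hk : t.idx 3 = s.idx 3 := hF.idx 3 (by norm_num)
    refine ⟨⟨fun y hy => ?_, fun a b c ha hb => ?_⟩, ?_, fun l => ?_, fun b c => ?_⟩
    · simp [exec, State.tick, State.store, State.setIdx, hy, hF.idx y hy]
    · rw [← hF.mem a b c ha hb]
      simp only [exec, State.tick, State.store, State.setIdx, IExpr.eval]
      simp [hi]
      tauto
    · simp [exec, State.tick, State.store, State.setIdx, hD]
    · simp only [exec, State.tick, State.store, State.setIdx, IExpr.eval, RExpr.eval]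
      by_cases h : l = k
      · simp [h, hR, hS, hi, hk, hF.mem 2 (s.idx 3) k (by norm_num) fun _ => hne]
      · have : l < k + 1 ↔ l < k := by omega
        simp [h, hR, this, hi]
    · simp only [exec, State.tick, State.store, State.setIdx, IExpr.eval, RExpr.eval]
      simp [hS]

lemma exec_stepRow (ω : ℕ → ℝ) (s : State) (hne : s.idx 3 ≠ s.idx 2) :
    Frame (s.idx 2) s (exec ω stepRow s) ∧
      (exec ω stepRow s).draws = s.draws ∧
      row (s.idx 1) (exec ω stepRow s) (s.idx 2) =
        step (s.idx 1) (s.mem 1 0 0) (0 < s.mem 0 (s.idx 2) (s.idx 3))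
          (row (s.idx 1) s (s.idx 3)) (row (s.idx 1) s (s.idx 2)) := by
  simp only [stepRow, exec]
  obtain ⟨a1, a2, a3, a4⟩ := exec_dotRows ω s
  set s₁ := exec ω dotRows s
  obtain ⟨b1, b2, b3, b4, b5⟩ := exec_adjustCoord ω s₁
  set s₂ := exec ω adjustCoord s₁
  obtain ⟨c1, c2, c3, c4, c5, c6⟩ : (exec ω scaleFactor s₂).idx = s₂.idx ∧
      (∀ a b c, a ≠ 3 → (exec ω scaleFactor s₂).mem a b c = s₂.mem a b c) ∧
      (exec ω scaleFactor s₂).draws = s₂.draws ∧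
      (exec ω scaleFactor s₂).mem 3 0 0 = s₂.mem 3 0 0 ∧
      (exec ω scaleFactor s₂).mem 3 0 2 = s₂.mem 3 0 2 ∧
      (exec ω scaleFactor s₂).mem 3 0 3 =
        √((1 - s₂.mem 3 0 2 ^ 2) / (1 - s₂.mem 3 0 0 ^ 2)) := by
    simp +contextual [scaleFactor, exec, State.tick, State.store, IExpr.eval, RExpr.eval, sq]
  set s₃ := exec ω scaleFactor s₂
  have e1 : ∀ y, y ≠ 4 → s₃.idx y = s.idx y := fun y hy => by rw [c1, b1, a1 y hy]
  have e2 : ∀ a b c, a ≠ 3 → s₃.mem a b c = s.mem a b c := fun a b c h => by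
    rw [c2 _ _ _ h, b2 _ _ _ h, a2 _ _ _ h]
  obtain ⟨f1, f2, f3⟩ := exec_combineRows ω s₃ (by
    rw [e1 3 (by norm_num), e1 2 (by norm_num)]; exact hne)
  rw [e1 2 (by norm_num)] at f1 f3
  rw [e1 1 (by norm_num), e1 3 (by norm_num)] at f3
  refine ⟨Frame.trans ⟨e1, fun a b c h _ => e2 a b c h⟩ f1, by rw [f2, c3, b3, a3], ?_⟩
  have hx : s₂.mem 3 0 0 = inner ℝ (row (s.idx 1) s (s.idx 2)) (row (s.idx 1) s (s.idx 3)) := by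
    rw [b4, a4, Finset.sum_range, PiLp.inner_apply]
    exact Finset.sum_congr rfl fun l _ => by simp [row, mul_comm]
  have ht : s₂.mem 3 0 2 = newCoord (s.idx 1) (s.mem 1 0 0) (0 < s.mem 0 (s.idx 2) (s.idx 3))
      (inner ℝ (row (s.idx 1) s (s.idx 2)) (row (s.idx 1) s (s.idx 3))) := by
    rw [b5, ← b4, hx, a1 1 (by norm_num), a1 2 (by norm_num), a1 3 (by norm_num),
      a2 _ _ _ (by norm_num), a2 _ _ _ (by norm_num)]
  ext l
  have h := f3 l l.2
  rw [c4, c5, c6, e2 _ _ _ (by norm_num), e2 _ _ _ (by norm_num), ht, hx] at h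
  simpa [row, step] using h

/-- The adjacency relation of a graph on `Fin n`, extended to `ℕ` by `False`. -/
def natAdj {n : ℕ} (H : SimpleGraph (Fin n)) (i j : ℕ) : Prop :=
  ∃ (hi : i < n) (hj : j < n), H.Adj ⟨i, hi⟩ ⟨j, hj⟩

/-- Before pass m of the outer loop the rows below m are final and exactly m · d normals are used,
so each round consumes its own block. The inner invariant identifies the current row with `chain`.
-/
lemma output_embedProg (n d : ℕ) (p : ℝ) (H : SimpleGraph (Fin n)) (ω : ℕ → ℝ) (i : Fin n) :
    output embedProg n d p H ω i = embed d p (natAdj H) (unitRows d ω) n i := by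
  set s₀ := init n d p H with hs₀
  have hadj : ∀ a b, 0 < s₀.mem 0 a b ↔ natAdj H a b := fun a b => by
    simp only [hs₀, init, natAdj, if_true]
    split_ifs with h <;> simp [h]
  suffices hmain : (∀ y < 2, (exec ω embedProg s₀).idx y = s₀.idx y) ∧
      (exec ω embedProg s₀).draws = n * d ∧
      (∀ a b c, a < 2 → (exec ω embedProg s₀).mem a b c = s₀.mem a b c) ∧
      ∀ k < n, row d (exec ω embedProg s₀) k = embed d p (natAdj H) (unitRows d ω) n k from
    hmain.2.2.2 i i.2
  refine exec_loop_induction (x := 2) (e := .reg 0) (s := s₀) (fun m t =>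
    (∀ y < 2, t.idx y = s₀.idx y) ∧ t.draws = m * d ∧
    (∀ a b c, a < 2 → t.mem a b c = s₀.mem a b c) ∧
    ∀ k < m, row d t k = embed d p (natAdj H) (unitRows d ω) m k) ?_ ?_
  · simp [State.tick, hs₀, init]
  · rintro i - t ⟨hI, hD, hM, hR⟩
    set t₀ := (t.setIdx 2 i).tick 1 with ht₀
    have hi0 : ∀ y < 2, t₀.idx y = s₀.idx y := fun y hy => by
      rw [← hI y hy]; simp [ht₀, State.tick, State.setIdx, hy.ne]
    have h2 : t₀.idx 2 = i := by simp [ht₀, State.tick, State.setIdx]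
    have h1 : t₀.idx 1 = d := by rw [hi0 1 (by norm_num)]; simp [hs₀, init]
    simp only [exec]
    obtain ⟨a1, a2, a3, a4⟩ := exec_sampleRow ω t₀
    set t₁ := exec ω sampleRow t₀
    obtain ⟨b1, b2, b3⟩ := exec_normalizeRow ω t₁
    set t₂ := exec ω normalizeRow t₁
    rw [a1.idx 2 (by norm_num), h2] at b1 b3
    rw [a1.idx 1 (by norm_num), h1] at b3
    rw [h1, h2] at a3
    rw [h1] at a2 a4
    rw [h2] at a1
    have hD0 : t₀.draws = i * d := hD
    have hF := a1.trans b1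
    have hrow : row d t₂ i = unitRows d ω i := by
      ext l
      have : t₂.mem 2 i l = ω (i * d + l) / √(∑ l ∈ Finset.range d, ω (i * d + l) ^ 2) := by
        rw [b3 l l.2, a3 l l.2, a4, hD0]
      simp only [row, this, unitRows, EuclideanSpace.norm_eq, Finset.sum_range]
      simp [div_eq_inv_mul]
    have hI2 : t₂.idx 2 = i := by rw [hF.idx 2 (by norm_num), h2]
    have hlt : ∀ k < i, ∀ t' : State, Frame i t₀ t' → row d t' k =
        embed d p (natAdj H) (unitRows d ω) i k := fun k hk t' h => by
      rw [← hR k hk]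
      ext l
      exact h.mem 2 k l (by norm_num) fun _ => hk.ne
    have hloop := exec_loop_induction (ω := ω) (x := 3) (e := .reg 2) (c := stepRow) (s := t₂)
      (fun m t' => (∀ y < 3, t'.idx y = t₀.idx y) ∧ t'.draws = (i + 1) * d ∧
        (∀ a b c, a ≠ 3 → (a = 2 → b ≠ i) → t'.mem a b c = t₀.mem a b c) ∧
        row d t' i = chain d p (embed d p (natAdj H) (unitRows d ω) i) (natAdj H i)
          (unitRows d ω i) m) ⟨fun y hy => hF.idx y (by omega), ?_, hF.mem, hrow⟩ ?_
    · have hev : IExpr.eval t₂ (.reg 2) = i := hI2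
      rw [hev] at hloop
      obtain ⟨c1, c2, c3, c4⟩ := hloop
      refine ⟨fun y hy => (c1 y (by omega)).trans (hi0 y hy), c2, fun a b c ha => ?_,
        fun k hk => ?_⟩
      · exact (c3 a b c (by omega) (by omega)).trans (hM a b c ha)
      · rw [embed]
        rcases Nat.lt_succ_iff_lt_or_eq.1 hk with hk | rfl
        · rw [Function.update_of_ne hk.ne, ← hR k hk]
          ext l
          exact c3 2 k l (by norm_num) fun _ => hk.ne
        · rw [Function.update_self]; exact c4
    · change t₂.draws = _
      rw [b2, a2, hD0]; ring
    · rintro k hk t' ⟨c1, c2, c3, c4⟩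
      have hk' : k < i := by have hev : IExpr.eval t₂ (.reg 2) = i := hI2; omega
      set u := (t'.setIdx 3 k).tick 1 with hu
      have u3 : u.idx 3 = k := by simp [hu, State.tick, State.setIdx]
      have uy : ∀ y < 3, u.idx y = t₀.idx y := fun y hy => by
        rw [← c1 y hy]; simp [hu, State.tick, State.setIdx, hy.ne]
      have u2 : u.idx 2 = i := by rw [uy 2 (by norm_num), h2]
      have u1 : u.idx 1 = d := by rw [uy 1 (by norm_num), h1]
      have um : u.mem = t'.mem := rfl
      obtain ⟨f1, f2, f3⟩ := exec_stepRow ω u (by omega)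
      rw [u1, u2, u3] at f3
      rw [u2] at f1
      refine ⟨fun y hy => (f1.idx y (by omega)).trans (uy y hy), f2.trans c2,
        fun a b c ha hb => (f1.mem a b c ha hb).trans (c3 a b c ha hb), ?_⟩
      have hp : u.mem 1 0 0 = p := by
        rw [um, c3 1 0 0 (by norm_num) (by norm_num)]
        refine (hM 1 0 0 (by norm_num)).trans ?_
        simp [hs₀, init]
      have hh : (0 < u.mem 0 i k) = natAdj H i k := by
        rw [um, c3 0 i k (by norm_num) (by norm_num)]
        refine propext (Iff.trans ?_ (hadj i k))
        rw [← hM 0 i k (by norm_num)]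
        rfl
      have hv : row d u k = embed d p (natAdj H) (unitRows d ω) i k := by
        rw [← hR k hk']
        ext l
        exact c3 2 k l (by norm_num) fun _ => hk'.ne
      have hui : row d u i = row d t' i := rfl
      rw [f3, hp, hh, hv, hui, c4, chain]

end Program

end RealRAM

/-! ### Probability of an error for one pair. -/

section Mismatch

variable {d : ℕ} [hd : Fact (2 ≤ d)] {p : unitInterval}

lemma ae_newCoord_side_roundVec (hp0 : (0 : ℝ) < p) (hp1 : (p : ℝ) < 1) {τ : ℝ}
    (hτ : IsSphereThreshold d p τ) (j : ℕ) : ∀ᵐ y ∂roundLaw d p,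
      (y.1.2 j → τ ≤ inner ℝ (roundVec p (j + 1) y) (y.1.1 j)) ∧
      (¬ y.1.2 j → inner ℝ (roundVec p (j + 1) y) (y.1.1 j) ≤ τ) := by
  have hm : Measurable fun y : ((ℕ → EuclideanSpace ℝ (Fin d)) × (ℕ → Prop)) ×
      EuclideanSpace ℝ (Fin d) => (inner ℝ (roundVec p j y) (y.1.1 j) : ℝ) :=
    Measurable.inner (measurable_roundVec _ _) (by fun_prop)
  have hmap : (roundLaw d p).map (fun y => (inner ℝ (roundVec p j y) (y.1.1 j) : ℝ)) =
      sphereInnerLaw d := by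
    ext S hS
    rw [Measure.map_apply hm hS, ← roundVec_inner_law hp0 hp1 j j hS]
    rfl
  have h := newCoord_side hp0 hp1 hτ
  rw [← hmap] at h
  filter_upwards [ae_of_ae_map hm.aemeasurable h, roundLaw_ae_norm_vec (d := d) (p := p)]
    with y hy hv
  have : (inner ℝ (roundVec p (j + 1) y) (y.1.1 j) : ℝ) =
      newCoord d p (y.1.2 j) (inner ℝ (roundVec p j y) (y.1.1 j)) := by
    rw [roundVec, chain, inner_step _ _ (hv j)]; rfl
  rw [this]
  exact hy _

/-- The value just after step j is on the right side of `τ`. If the final value is not, then `τ`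
lies between the two, so the displacement is at least the final distance to `τ`. -/
lemma measure_mismatch_le_of_ae (hp0 : (0 : ℝ) < p) (hp1 : (p : ℝ) < 1) {τ : ℝ}
    (hτ : IsSphereThreshold d p τ) (m j : ℕ) (W : ℝ) :
    roundLaw d p {y | W ≤ |inner ℝ (roundVec p m y) (y.1.1 j) - τ| ∧
        ¬ (τ ≤ inner ℝ (roundVec p m y) (y.1.1 j) ↔ y.1.2 j)} ≤
      roundLaw d p {y | W ≤ |inner ℝ (roundVec p m y) (y.1.1 j) -
        inner ℝ (roundVec p (j + 1) y) (y.1.1 j)|} := by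
  refine measure_mono_ae ?_
  filter_upwards [ae_newCoord_side_roundVec hp0 hp1 hτ j] with y hy
  rintro ⟨h1, h2⟩
  refine h1.trans ?_
  by_cases hj : y.1.2 j
  · have h3 := hy.1 hj
    have h4 : inner ℝ (roundVec p m y) (y.1.1 j) < τ := by simpa [hj] using h2
    rw [abs_sub_comm, abs_of_pos (sub_pos.2 h4), abs_sub_comm]
    exact (sub_le_sub_right h3 _).trans (le_abs_self _)
  · have h3 := hy.2 hj
    have h4 : τ ≤ inner ℝ (roundVec p m y) (y.1.1 j) := by simpa [hj] using h2
    rw [abs_of_nonneg (sub_nonneg.2 h4)]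
    exact (sub_le_sub_left h3 _).trans (le_abs_self _)

lemma measure_inner_roundVec_sub_ge_le_of_small (hp0 : (0 : ℝ) < p) (hp1 : (p : ℝ) < 1) {s W : ℝ}
    (hs : 0 ≤ s) (hW : 2 * s < W) (m j : ℕ) :
    roundLaw d p {y | W ≤ |inner ℝ (roundVec p m y) (y.1.1 j) -
        inner ℝ (roundVec p (j + 1) y) (y.1.1 j)|} ≤
      ENNReal.ofReal (4 * Real.exp (-(s ^ 2 * d / 16))) := by
  have hSm : MeasurableSet {x : ℝ | s < |x|} := measurableSet_lt measurable_const (by fun_prop)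
  have htail := sphereInnerLaw_tail (d := d) hs
  have hsub : {y : ((ℕ → EuclideanSpace ℝ (Fin d)) × (ℕ → Prop)) × EuclideanSpace ℝ (Fin d) |
      W ≤ |inner ℝ (roundVec p m y) (y.1.1 j) - inner ℝ (roundVec p (j + 1) y) (y.1.1 j)|} ⊆
      {y | inner ℝ (roundVec p m y) (y.1.1 j) ∈ {x : ℝ | s < |x|}} ∪
      {y | inner ℝ (roundVec p (j + 1) y) (y.1.1 j) ∈ {x : ℝ | s < |x|}} := by
    intro y hy
    by_contra h
    simp only [Set.mem_union, Set.mem_ofPred_eq, not_or, not_lt] at h hy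
    have := abs_sub (inner ℝ (roundVec p m y) (y.1.1 j) : ℝ)
      (inner ℝ (roundVec p (j + 1) y) (y.1.1 j))
    linarith
  refine (measure_mono hsub).trans ((measure_union_le _ _).trans ?_)
  rw [roundVec_inner_law hp0 hp1 m j hSm, roundVec_inner_law hp0 hp1 (j + 1) j hSm]
  refine (add_le_add htail htail).trans_eq ?_
  rw [← ENNReal.ofReal_add (by positivity) (by positivity)]
  congr 1; ring

/-- The width of the window around the threshold, up to a constant. -/
def windowWidth (n d : ℕ) (p : ℝ) : ℝ :=
  max (√(n * p)) (√(Real.log n)) * Real.log n ^ (3 / 2 : ℝ) / d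

lemma measure_mismatch_le (hp0 : (0 : ℝ) < p) (hp1 : (p : ℝ) < 1) {τ : ℝ}
    (hτ : IsSphereThreshold d p τ) {n m j : ℕ} (hjm : j < m) (hmn : m ≤ n)
    (hn : 1 ≤ Real.log n) :
    roundLaw d p {y | 20000 * windowWidth n d p ≤ |inner ℝ (roundVec p m y) (y.1.1 j) - τ| ∧
        ¬ (τ ≤ inner ℝ (roundVec p m y) (y.1.1 j) ↔ y.1.2 j)} ≤
      ENNReal.ofReal (13 * Real.exp (-(4 * Real.log n))) := by
  refine (measure_mismatch_le_of_ae hp0 hp1 hτ m j _).trans ?_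
  obtain ⟨l, hl, hlL⟩ : ∃ l : ℝ, 1 ≤ l ∧ l ^ 2 = Real.log n :=
    ⟨√(Real.log n), by rwa [Real.one_le_sqrt], Real.sq_sqrt (by linarith)⟩
  obtain ⟨D, hD, hDd⟩ : ∃ D : ℝ, 0 < D ∧ D ^ 2 = d := by
    have : (0 : ℝ) < d := by exact_mod_cast (by have := hd.out; omega : 0 < d)
    exact ⟨√d, Real.sqrt_pos.2 this, Real.sq_sqrt this.le⟩
  obtain ⟨r, hlr, hnp, hW⟩ : ∃ r : ℝ, l ≤ r ∧ n * (p : ℝ) ≤ r ^ 2 ∧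
      windowWidth n d p = r * l ^ 3 / D ^ 2 := by
    have hll : √(Real.log n) = l := by rw [← hlL, Real.sqrt_sq (by linarith)]
    refine ⟨max (√(n * p)) (√(Real.log n)), by rw [hll]; exact le_max_right _ _, ?_, ?_⟩
    · have h0 : (0 : ℝ) ≤ n * p := by positivity
      calc (n : ℝ) * p = √(n * p) ^ 2 := (Real.sq_sqrt h0).symm
        _ ≤ _ := by gcongr; exact le_max_left _ _
    · rw [windowWidth, hDd, show (3 / 2 : ℝ) = 1 + 1 / 2 by norm_num,
        Real.rpow_add (by linarith), Real.rpow_one, ← Real.sqrt_eq_rpow, hll, ← hlL]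
      ring
  have hr : 0 < r := by linarith
  have hl0 : 0 < l := by linarith
  -- Makes the tail of one inner product 2 exp(-16 log n), leaving room for the union over the O(n)
  -- inner products of a round.
  set s : ℝ := 16 * l / D with hs
  have hs0 : 0 < s := by positivity
  have hsd : s ^ 2 * d / 16 = 16 * l ^ 2 := by rw [hs, ← hDd]; field_simp
  have hexp : Real.exp (-(16 * l ^ 2)) ≤ Real.exp (-(4 * l ^ 2)) :=
    Real.exp_le_exp.2 (by nlinarith)
  rw [hW, ← hlL]
  -- In the first case the window exceeds 2s, so the tails alone suffice. In the second, l ≤ r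
  -- yields s ≤ 1/2, and r / D ≤ 1/32 makes the drift small against the window.
  rcases lt_or_ge D (32 * r) with hDr | hDr
  · refine (measure_inner_roundVec_sub_ge_le_of_small hp0 hp1 hs0.le ?_ m j).trans
      (ENNReal.ofReal_le_ofReal ?_)
    · have h1 : 2 * s = 32 * l * D / D ^ 2 := by rw [hs]; field_simp; norm_num
      rw [h1, ← mul_div_assoc]
      refine div_lt_div_of_pos_right ?_ (by positivity)
      have h2 : 1 ≤ l ^ 2 := one_le_pow₀ hl
      calc 32 * l * D < 32 * l * (32 * r) := by gcongr
        _ = 1024 * (r * l) * 1 := by ring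
        _ ≤ 1024 * (r * l) * l ^ 2 := by gcongr
        _ ≤ 20000 * (r * l) * l ^ 2 := by gcongr; norm_num
        _ = 20000 * (r * l ^ 3) := by ring
    · rw [hsd]
      have := Real.exp_pos (-(4 * l ^ 2))
      linarith
  · have hs2 : s ≤ 1 / 2 := by
      rw [hs, div_le_iff₀ hD]; linarith
    -- Twice the exponent 4pm ≤ 4r² of the moment bound, so that exp(4pm - K) ≤ exp(-4 log n). The
    -- value of `z` then solves z² / (72 K s⁴) = 4 log n. Drift and noise are at most 5120 + 12288 =
    -- 17408 times r l³ / D², hence the constant 20000.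
    set K : ℝ := 8 * r ^ 2 with hK
    set z : ℝ := 12288 * r * l ^ 3 / D ^ 2 with hz
    have hlt : 5 * s ^ 3 * K + z < 20000 * (r * l ^ 3 / D ^ 2) := by
      have h1 : 5 * s ^ 3 * K = 163840 * (r * l ^ 3 / D ^ 2) * (r / D) := by
        rw [hs, hK]; field_simp; norm_num
      have h2 : r / D ≤ 1 / 32 := by rw [div_le_iff₀ hD]; linarith
      have h3 : 0 < r * l ^ 3 / D ^ 2 := by positivity
      have h4 : z = 12288 * (r * l ^ 3 / D ^ 2) := by rw [hz]; ring
      rw [h1, h4]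
      nlinarith
    refine (measure_mono fun y hy => lt_of_lt_of_le hlt hy).trans
      ((measure_inner_roundVec_sub_gt_le hp0 hp1 hjm hs0 hs2 (K := K) (z := z) (by positivity)
        (by positivity)).trans (ENNReal.ofReal_le_ofReal ?_))
    have hze : z ^ 2 / (72 * K * s ^ 4) = 4 * l ^ 2 := by
      rw [hz, hK, hs]; field_simp; norm_num
    have hn0 : (0 : ℝ) < n := by
      have : 0 < n := by omega
      exact_mod_cast this
    have hmn' : (m : ℝ) ≤ n := by exact_mod_cast hmn
    have hn1 : (1 : ℝ) ≤ n := by exact_mod_cast (by omega : 1 ≤ n)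
    have hne : (n : ℝ) = Real.exp (l ^ 2) := by rw [hlL, Real.exp_log hn0]
    have e1 : (4 * (m : ℝ) + 1) * (2 * Real.exp (-(s ^ 2 * d / 16))) ≤
        10 * Real.exp (-(4 * l ^ 2)) := by
      rw [hsd]
      calc (4 * (m : ℝ) + 1) * (2 * Real.exp (-(16 * l ^ 2))) ≤
          (5 * n) * (2 * Real.exp (-(16 * l ^ 2))) := by gcongr; linarith
        _ = 10 * Real.exp (l ^ 2 + -(16 * l ^ 2)) := by rw [hne, Real.exp_add]; ring
        _ ≤ _ := by gcongr; nlinarith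
    have e2 : Real.exp (4 * p * m - K) ≤ Real.exp (-(4 * l ^ 2)) := by
      refine Real.exp_le_exp.2 ?_
      have : 4 * (p : ℝ) * m ≤ 4 * (n * p) := by nlinarith
      have : l ^ 2 ≤ r ^ 2 := by gcongr
      linarith
    rw [hze]
    linarith

/-- Some pair of placed vectors is in the wrong relation to the indicator, outside the window. -/
def mismatchSet (d : ℕ) (p : ℝ) (τ W : ℝ) (i j : ℕ) :
    Set ((ℕ → ℕ → Prop) × (ℕ → EuclideanSpace ℝ (Fin d))) :=
  {y | W ≤ |inner ℝ (embed d p y.1 y.2 (i + 1) i) (embed d p y.1 y.2 i j) - τ| ∧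
        ¬ (τ ≤ inner ℝ (embed d p y.1 y.2 (i + 1) i) (embed d p y.1 y.2 i j) ↔ y.1 i j)}

lemma measure_mismatchSet_le (hp0 : (0 : ℝ) < p) (hp1 : (p : ℝ) < 1) {τ : ℝ}
    (hτ : IsSphereThreshold d p τ) {n i j : ℕ} (hji : j < i) (hin : i ≤ n)
    (hn : 1 ≤ Real.log n) :
    ((Measure.infinitePi fun _ : ℕ => coins p).prod (unifSeq d))
        (mismatchSet d p τ (20000 * windowWidth n d p) i j) ≤
      ENNReal.ofReal (13 * Real.exp (-(4 * Real.log n))) := by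
  set W := 20000 * windowWidth n d p
  let S : Set ((ℕ → EuclideanSpace ℝ (Fin d)) × (ℕ → Prop) × EuclideanSpace ℝ (Fin d)) :=
    {y | W ≤ |inner ℝ (chain d p y.1 y.2.1 y.2.2 i) (y.1 j) - τ| ∧
        ¬ (τ ≤ inner ℝ (chain d p y.1 y.2.1 y.2.2 i) (y.1 j) ↔ y.2.1 j)}
  have hf : Measurable fun y : (ℕ → EuclideanSpace ℝ (Fin d)) × (ℕ → Prop) ×
      EuclideanSpace ℝ (Fin d) => (inner ℝ (chain d p y.1 y.2.1 y.2.2 i) (y.1 j) : ℝ) :=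
    Measurable.inner (measurable_chain _ _) (by fun_prop)
  have hS : MeasurableSet S := by
    refine (measurableSet_le measurable_const (hf.sub_const τ).abs).inter
      (MeasurableSet.compl (measurableSet_setOfPred.2 ?_))
    have h1 := measurableSet_setOfPred.1 (measurableSet_le measurable_const hf :
      MeasurableSet {y : (ℕ → EuclideanSpace ℝ (Fin d)) × (ℕ → Prop) × EuclideanSpace ℝ (Fin d) |
        τ ≤ inner ℝ (chain d p y.1 y.2.1 y.2.2 i) (y.1 j)})
    exact Measurable.iff h1 (by fun_prop)
  have hrow := measure_embed_row hp0 hp1 i hS fun v v' r hv => by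
    have hc : chain d p v r.1 r.2 i = chain d p v' r.1 r.2 i := chain_congr hv fun _ _ => rfl
    simp only [S, Set.mem_ofPred_eq, hc, hv j hji]
  have hset : mismatchSet d p τ W i j = {y | (embed d p y.1 y.2 i, y.1 i, y.2 i) ∈ S} := by
    ext y
    simp [mismatchSet, S, embed]
  have hmp := measurePreserving_prodAssoc (unifSeq d) (coins p) (unifSphere d)
  rw [hset, hrow, ← hmp.map_eq, Measure.map_apply hmp.measurable hS]
  exact measure_mismatch_le hp0 hp1 hτ hji hin hn

end Mismatch

/-! ### From coins and uniform vectors to the program's input, and the union bound. -/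

section Assembly

variable {d : ℕ} {p : unitInterval}

/-- Round k reads only the bits of earlier vertices. So a full array of independent coins can stand
in for the symmetric adjacency relation. -/
lemma embed_congr_lower {q : ℝ} {M M' : ℕ → ℕ → Prop} {u : ℕ → EuclideanSpace ℝ (Fin d)} {i : ℕ}
    (hM : ∀ k < i, ∀ l < k, M k l = M' k l) : embed d q M u i = embed d q M' u i := by
  induction i with
  | zero => rfl
  | succ i ih =>
    simp only [embed]
    rw [ih fun k hk => hM k (by omega), chain_congr (fun _ _ => rfl) (hM i (by omega))]

lemma natAdj_lowerGraph {n : ℕ} (M : ℕ → ℕ → Prop) {k l : ℕ} (hk : k < n) (hl : l < k) :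
    RealRAM.natAdj (lowerGraph n M) k l = M k l := by
  simp [RealRAM.natAdj, lowerGraph, hk, hl.trans hk, hl.ne', max_eq_left hl.le, min_eq_right hl.le]

lemma measurable_natAdj (n : ℕ) : Measurable (RealRAM.natAdj (n := n)) := by
  refine measurable_pi_iff.2 fun i => measurable_pi_iff.2 fun j => ?_
  by_cases hi : i < n
  · by_cases hj : j < n
    · simp only [RealRAM.natAdj, hi, hj, exists_true_left]
      fun_prop
    · simp [RealRAM.natAdj, hj]
  · simp [RealRAM.natAdj, hi]

lemma measurable_output_embedProg (n d : ℕ) [Fact (2 ≤ d)] (q : ℝ) :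
    Measurable fun x : SimpleGraph (Fin n) × (ℕ → ℝ) =>
      RealRAM.output RealRAM.embedProg n d q x.1 x.2 := by
  refine measurable_pi_iff.2 fun i => ?_
  simp only [RealRAM.output_embedProg]
  exact (measurable_pi_apply _).comp ((measurable_embed q n).comp
    (((measurable_natAdj n).comp measurable_fst).prodMk
      ((measurable_unitRows d).comp measurable_snd)))

lemma measurable_lowerGraph_embed (n d : ℕ) [Fact (2 ≤ d)] (q : ℝ) :
    Measurable fun y : (ℕ → ℕ → Prop) × (ℕ → EuclideanSpace ℝ (Fin d)) =>
      (lowerGraph n y.1, fun i : Fin n => embed d q y.1 y.2 n i) :=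
  ((measurable_lowerGraph n).comp measurable_fst).prodMk
    (measurable_pi_iff.2 fun _ => (measurable_pi_apply _).comp (measurable_embed _ _))

/-- The graph is kept next to the output because the error event compares the two. -/
lemma inputLaw_map_output (n : ℕ) [Fact (2 ≤ d)] :
    (RealRAM.inputLaw n p).map
        (fun x => (x.1, RealRAM.output RealRAM.embedProg n d p x.1 x.2)) =
      ((Measure.infinitePi fun _ : ℕ => coins p).prod (unifSeq d)).map
        (fun y => (lowerGraph n y.1, fun i : Fin n => embed d p y.1 y.2 n i)) := by
  have h1 := Measure.map_prod_map (Measure.infinitePi fun _ : ℕ => coins p)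
    (Measure.infinitePi fun _ : ℕ => gaussianReal 0 1) (measurable_lowerGraph n) measurable_id
  rw [infinitePi_coins_map_lowerGraph, Measure.map_id] at h1
  have h2 := Measure.map_prod_map (Measure.infinitePi fun _ : ℕ => coins p)
    (Measure.infinitePi fun _ : ℕ => gaussianReal 0 1) measurable_id (measurable_unitRows d)
  rw [infinitePi_gaussian_map_unitRows, Measure.map_id] at h2
  rw [RealRAM.inputLaw, h1, h2,
    Measure.map_map (measurable_fst.prodMk (measurable_output_embedProg n d p))
      ((measurable_lowerGraph n).prodMap measurable_id),
    Measure.map_map (measurable_lowerGraph_embed n d p) (measurable_id.prodMap (measurable_unitRows d))]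
  congr 1
  funext y
  refine Prod.ext rfl (funext fun i => ?_)
  refine (RealRAM.output_embedProg _ _ _ _ _ _).trans ?_
  exact congrFun (embed_congr_lower fun k hk l hl => natAdj_lowerGraph y.1 hk hl) _

lemma inputLaw_map_output_eq_pi (hp0 : (0 : ℝ) < p) (hp1 : (p : ℝ) < 1) (n : ℕ)
    [Fact (2 ≤ d)] :
    (RealRAM.inputLaw n p).map (fun x => RealRAM.output RealRAM.embedProg n d p x.1 x.2) =
      Measure.pi fun _ : Fin n => unifSphere d := by
  have h := congrArg (fun μ => μ.map Prod.snd) (inputLaw_map_output (d := d) (p := p) n)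
  beta_reduce at h
  rwa [Measure.map_map measurable_snd
      (measurable_fst.prodMk (measurable_output_embedProg n d p)),
    Measure.map_map measurable_snd (measurable_lowerGraph_embed n d p),
    show (Prod.snd ∘ fun y : (ℕ → ℕ → Prop) × (ℕ → EuclideanSpace ℝ (Fin d)) =>
      (lowerGraph n y.1, fun i : Fin n => embed d p y.1 y.2 n i)) =
      fun y (i : Fin n) => embed d p y.1 y.2 n i from rfl, embed_map_eq_pi hp0 hp1 n] at h

lemma inputLaw_mismatch_le (hp0 : (0 : ℝ) < p) (hp1 : (p : ℝ) < 1) {n : ℕ} {τ : ℝ}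
    (hd : 2 ≤ d) (hτ : IsSphereThreshold d p τ) (hn : 1 ≤ Real.log n) :
    RealRAM.inputLaw n p {x | ¬ ∀ i j : Fin n, i ≠ j →
        20000 * windowWidth n d p ≤
          |inner ℝ (RealRAM.output RealRAM.embedProg n d p x.1 x.2 i)
            (RealRAM.output RealRAM.embedProg n d p x.1 x.2 j) - τ| →
        (τ ≤ inner ℝ (RealRAM.output RealRAM.embedProg n d p x.1 x.2 i)
          (RealRAM.output RealRAM.embedProg n d p x.1 x.2 j) ↔ x.1.Adj i j)} ≤
      ENNReal.ofReal (13 / n) := by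
  have : Fact (2 ≤ d) := ⟨hd⟩
  set W := 20000 * windowWidth n d p
  let S : Set (SimpleGraph (Fin n) × (Fin n → EuclideanSpace ℝ (Fin d))) :=
    {x | ¬ ∀ i j : Fin n, i ≠ j → W ≤ |inner ℝ (x.2 i) (x.2 j) - τ| →
        (τ ≤ inner ℝ (x.2 i) (x.2 j) ↔ x.1.Adj i j)}
  have hS : MeasurableSet S := by
    refine MeasurableSet.compl (measurableSet_setOfPred.2 ?_)
    refine .forall fun i => .forall fun j => .imp measurable_const ?_
    have hf : Measurable fun x : SimpleGraph (Fin n) × (Fin n → EuclideanSpace ℝ (Fin d)) =>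
        (inner ℝ (x.2 i) (x.2 j) : ℝ) := Measurable.inner (by fun_prop) (by fun_prop)
    have h1 := measurableSet_setOfPred.1 (measurableSet_le measurable_const hf :
      MeasurableSet {x : SimpleGraph (Fin n) × (Fin n → EuclideanSpace ℝ (Fin d)) |
        τ ≤ inner ℝ (x.2 i) (x.2 j)})
    have h2 := measurableSet_setOfPred.1 (measurableSet_le measurable_const (by fun_prop) :
      MeasurableSet {x : SimpleGraph (Fin n) × (Fin n → EuclideanSpace ℝ (Fin d)) |
        W ≤ |inner ℝ (x.2 i) (x.2 j) - τ|})
    exact h2.imp (h1.iff (by fun_prop))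
  have h := congrArg (fun μ => μ S) (inputLaw_map_output (d := d) (p := p) n)
  beta_reduce at h
  rw [Measure.map_apply (measurable_fst.prodMk (measurable_output_embedProg n d p)) hS,
    Measure.map_apply (measurable_lowerGraph_embed n d p) hS] at h
  refine (le_of_eq h).trans ?_
  have hlow : ∀ (y : (ℕ → ℕ → Prop) × (ℕ → EuclideanSpace ℝ (Fin d))) (i j : Fin n), j < i →
      W ≤ |inner ℝ (embed d p y.1 y.2 n i) (embed d p y.1 y.2 n j) - τ| →
      ¬ (τ ≤ inner ℝ (embed d p y.1 y.2 n i) (embed d p y.1 y.2 n j) ↔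
        (lowerGraph n y.1).Adj i j) → y ∈ mismatchSet d p τ W i j := by
    intro y i j hji h1 h2
    have hadj : (lowerGraph n y.1).Adj i j ↔ y.1 i j := by
      have hji' : (j : ℕ) ≤ i := hji.le
      simp [lowerGraph, hji.ne', max_eq_left hji', min_eq_right hji']
    rw [hadj, embed_apply_eq (Nat.lt_succ_self (i : ℕ)) i.2, embed_apply_eq hji i.2.le] at h2
    rw [embed_apply_eq (Nat.lt_succ_self (i : ℕ)) i.2, embed_apply_eq hji i.2.le] at h1
    exact ⟨h1, h2⟩
  have hsub : (fun y : (ℕ → ℕ → Prop) × (ℕ → EuclideanSpace ℝ (Fin d)) =>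
      (lowerGraph n y.1, fun i : Fin n => embed d p y.1 y.2 n i)) ⁻¹' S ⊆
      ⋃ i ∈ Finset.range n, ⋃ j ∈ Finset.range i, mismatchSet d p τ W i j := by
    intro y hy
    simp only [S, Set.mem_preimage, Set.mem_ofPred_eq] at hy
    simp only [not_forall, exists_prop] at hy
    obtain ⟨i, j, hij, h1, h2⟩ := hy
    simp only [Set.mem_iUnion, Finset.mem_range, exists_prop]
    rcases lt_or_gt_of_ne hij with hlt | hlt
    · refine ⟨j, j.2, i, hlt, hlow y j i hlt ?_ ?_⟩
      · rwa [real_inner_comm]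
      · rw [real_inner_comm, SimpleGraph.adj_comm]; exact h2
    · exact ⟨i, i.2, j, hlt, hlow y i j hlt h1 h2⟩
  set B := ENNReal.ofReal (13 * Real.exp (-(4 * Real.log n))) with hB
  have hn0 : (0 : ℝ) < n := by
    by_contra h0
    have : n = 0 := by exact_mod_cast le_antisymm (not_lt.1 h0) (Nat.cast_nonneg n)
    subst this
    norm_num at hn
  have hn1 : (1 : ℝ) ≤ n := by exact_mod_cast (Nat.cast_pos.1 hn0)
  refine (measure_mono hsub).trans ?_
  -- At most n² pairs, each failing with probability at most 13 n⁻⁴.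
  calc _ ≤ ∑ i ∈ Finset.range n, ∑ _j ∈ Finset.range n, B := by
        refine (measure_biUnion_finset_le _ _).trans (Finset.sum_le_sum fun i hi => ?_)
        have hi' := Finset.mem_range.1 hi
        refine (measure_biUnion_finset_le _ _).trans ((Finset.sum_le_sum fun j hj =>
          measure_mismatchSet_le hp0 hp1 hτ (Finset.mem_range.1 hj) hi'.le hn).trans ?_)
        exact Finset.sum_le_sum_of_subset (Finset.range_mono hi'.le)
    _ = ENNReal.ofReal (n * (n * (13 * Real.exp (-(4 * Real.log n))))) := by
        simp only [Finset.sum_const, Finset.card_range, nsmul_eq_mul]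
        rw [ENNReal.ofReal_mul hn0.le, ENNReal.ofReal_mul (p := (n : ℝ)) hn0.le,
          ENNReal.ofReal_natCast]
    _ ≤ _ := by
        refine ENNReal.ofReal_le_ofReal ?_
        have he : Real.exp (-(4 * Real.log n)) = ((n : ℝ) ^ 4)⁻¹ := by
          rw [Real.exp_neg, show (4 : ℝ) * Real.log n = (4 : ℕ) * Real.log n by norm_num,
            Real.exp_nat_mul, Real.exp_log hn0]
        rw [he, show (n : ℝ) * (n * (13 * ((n : ℝ) ^ 4)⁻¹)) = 13 / (n * n) by field_simp]
        exact div_le_div_of_nonneg_left (by norm_num) hn0 (by nlinarith)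

end Assembly

end

theorem theorem1 :
    ∃ prog : RealRAM.Cmd,
      -- the running time is polynomial
      (∃ Q : Polynomial ℕ, ∀ (n d : ℕ) (p : unitInterval) (H : SimpleGraph (Fin n)) (ω : ℕ → ℝ),
        RealRAM.runTime prog n d p H ω ≤ Q.eval (n + d)) ∧
      ∃ c : ℝ, 0 < c ∧ ∀ a : ℝ, 0 < a → ∀ b : ℝ, 0 < b →
        -- the output vectors are i.i.d. uniform on the sphere
        (∀ (n d : ℕ) (p : unitInterval), 1 ≤ n → 2 ≤ d →
          a * max ((n : ℝ) * p) (Real.log n) ≤ d → b / n ≤ p → (p : ℝ) ≤ 1 / 2 →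
          (RealRAM.inputLaw n p).map (fun x => RealRAM.output prog n d p x.1 x.2) =
            Measure.pi fun _ : Fin n => unifSphere d) ∧
        -- with high probability the geometric graph agrees with the input away from the threshold
        (∀ ε : ℝ, 0 < ε → ∃ N : ℕ, ∀ (n d : ℕ) (p : unitInterval) (τ : ℝ), N ≤ n → 1 ≤ n → 2 ≤ d →
          a * max ((n : ℝ) * p) (Real.log n) ≤ d → b / n ≤ p → (p : ℝ) ≤ 1 / 2 →
          IsSphereThreshold d p τ →
          RealRAM.inputLaw n p {x | ¬ ∀ i j : Fin n, i ≠ j →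
              c * max (Real.sqrt (n * p)) (Real.sqrt (Real.log n)) * Real.log n ^ (3 / 2 : ℝ) / d
                ≤ |inner ℝ (RealRAM.output prog n d p x.1 x.2 i)
                    (RealRAM.output prog n d p x.1 x.2 j) - τ| →
              (τ ≤ inner ℝ (RealRAM.output prog n d p x.1 x.2 i)
                    (RealRAM.output prog n d p x.1 x.2 j) ↔ x.1.Adj i j)}
            ≤ ENNReal.ofReal ε) := by
  refine ⟨RealRAM.embedProg, ⟨_, fun n d p => RealRAM.runTime_le_eval_timePoly _
    RealRAM.embedProg_loopsOverRegs n d p⟩, 20000, by norm_num, fun a _ b hb => ⟨?_, ?_⟩⟩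
  · intro n d p hn hd _ hbp hp
    have : Fact (2 ≤ d) := ⟨hd⟩
    have hn0 : (0 : ℝ) < n := by exact_mod_cast hn
    -- The bounds b / n and 1/2 keep p strictly between 0 and 1, so both sides of the threshold have
    -- positive mass.
    exact inputLaw_map_output_eq_pi ((div_pos hb hn0).trans_le hbp) (by linarith) n
  · intro ε hε
    -- The first bound gives log n ≥ 1, the second brings the failure probability 13 / n below ε.
    obtain ⟨N, hN⟩ := exists_nat_ge (max (Real.exp 1) (13 / ε))
    refine ⟨N, fun n d p τ hNn hn hd _ hbp hp hτ => ?_⟩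
    have hn0 : (0 : ℝ) < n := by exact_mod_cast hn
    have hNn' : max (Real.exp 1) (13 / ε) ≤ n := hN.trans (by exact_mod_cast hNn)
    have hlog : 1 ≤ Real.log n :=
      (Real.le_log_iff_exp_le hn0).2 ((le_max_left _ _).trans hNn')
    have h13 : 13 / (n : ℝ) ≤ ε := by
      rw [div_le_iff₀ hn0, mul_comm, ← div_le_iff₀ hε]
      exact (le_max_right _ _).trans hNn'
    have hmain := inputLaw_mismatch_le ((div_pos hb hn0).trans_le hbp) (by linarith) hd hτ hlog
    refine le_trans (le_of_eq ?_) (hmain.trans (ENNReal.ofReal_le_ofReal h13))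
    simp only [windowWidth, mul_assoc, mul_div_assoc]
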